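/- Let $k$ be a commutative ring and $H$ a Hopf algebra over $k$ whose antipode $S$ is bijective; Sweedler notation $\Delta(h)=h_{(1)}\otimes h_{(2)}$ is used. **The algebra $H_{par}$.** Let $H_{par}$ be the quotient of the tensor algebra $T(H)$ by the two-sided ideal generated by $1_H-1_{T(H)}$ and, for all $h,g\in H$, by $h\otimes g_{(1)}\otimes S(g_{(2)})-hg_{(1)}\otimes S(g_{(2)})$, $h_{(1)}\otimes S(h_{(2)})\otimes g-h_{(1)}\otimes S(h_{(2)})g$, $h\otimes S(g_{(1)})\otimes g_{(2)}-hS(g_{(1)})\otimes g_{(2)}$, $S(h_{(1)})\otimes h_{(2)}\otimes g-S(h_{(1)})\otimes h_{(2)}g$. Write $[h]$ for the class of $h\in H$, and put $\varepsilon_h=[h_{(1)}][S(h_{(2)})]$, $\tilde\varepsilon_h=[S(h_{(1)})][h_{(2)}]$. Let $A$ (resp. $\tilde A$) be the $k$-subalgebra of $H_{par}$ generated by all $\varepsilon_h$ (resp. all $\tilde\varepsilon_h$). **Hopf algebroids.** A left bialgebroid over a $k$-algebra $A$ is a $k$-algebra $\mathcal H$ with an algebra map $s:A\to\mathcal H$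 and an anti-algebra map $t:A\to\mathcal H$ with commuting images, and $k$-linear maps $\Delta_l:\mathcal H\to\mathcal H\otimes_A\mathcal H$, $\epsilon_l:\mathcal H\to A$ such that: $(\mathcal H,\Delta_l,\epsilon_l)$ is an $A$-coring for the bimodule structure $a\triangleright h\triangleleft b=s(a)t(b)h$; the image of $\Delta_l$ lies in $\{\sum x_i\otimes y_i:\sum x_it(a)\otimes y_i=\sum x_i\otimes y_is(a)\ \forall a\in A\}$ and $\Delta_l$ is an algebra map into this algebra (with the factorwise product); $\epsilon_l(1)=1$ and $\epsilon_l(hg)=\epsilon_l(h\,s(\epsilon_l(g)))=\epsilon_l(h\,t(\epsilon_l(g)))$. A right bialgebroid over $\tilde A$, with maps $\tilde s,\tilde t,\Delta_r,\epsilon_r$, is defined in the same way with $a\triangleright h\triangleleft b=h\tilde s(b)\tilde t(a)$, with $\Delta_r$ multiplicative into $\{\sum x_i\otimes y_i:\sum\tilde s(a)x_i\otimes y_i=\sum x_i\otimes\tilde t(a)y_i\ \forall a\in\tilde A\}$, and with $\epsilon_r(1)=1$, $\epsilon_r(hg)=\epsilon_r(\tilde s(\epsilon_r(h))g)=\epsilon_r(\tilde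 t(\epsilon_r(h))g)$. A Hopf algebroid consists of a left bialgebroid over $A$ and a right bialgebroid over $\tilde A$ on the same algebra $\mathcal H$, with $A\cong\tilde A^{op}$, and an anti-algebra map $\mathcal S:\mathcal H\to\mathcal H$ such that (i) $s\epsilon_l\tilde t=\tilde t$, $t\epsilon_l\tilde s=\tilde s$, $\tilde s\epsilon_rt=t$, $\tilde t\epsilon_rs=s$; (ii) $(\Delta_l\otimes_{\tilde A}I)\Delta_r=(I\otimes_A\Delta_r)\Delta_l$ and $(I\otimes_{\tilde A}\Delta_l)\Delta_r=(\Delta_r\otimes_AI)\Delta_l$; (iii) $\mathcal S(t(a)h\tilde t(b))=\tilde s(b)\mathcal S(h)s(a)$ for $a\in A$, $b\in\tilde A$, $h\in\mathcal H$; (iv) $\mu(\mathcal S\otimes I)\Delta_l=\tilde s\epsilon_r$ and $\mu(I\otimes\mathcal S)\Delta_r=s\epsilon_l$, where $\mu$ is the multiplication. **Theorem.** There are anti-algebra maps $\mathcal S,\mathcal S':H_{par}\to H_{par}$ with $$\mathcal S([h^1]\cdots[h^n])=[S(h^n)]\cdots[S(h^1)],\qquad \mathcal S'([h^1]\cdots[h^n])=[S^{-1}(h^n)]\cdots[S^{-1}(h^1)],$$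 and, with $s(a)=a$, $t(a)=\mathcal S'(a)$ for $a\in A$ and $\tilde s(b)=b$, $\tilde t(b)=\mathcal S'(b)$ for $b\in\tilde A$, there are well-defined maps $\Delta_l:H_{par}\to H_{par}\otimes_AH_{par}$, $\epsilon_l:H_{par}\to A$, $\Delta_r:H_{par}\to H_{par}\otimes_{\tilde A}H_{par}$, $\epsilon_r:H_{par}\to\tilde A$ given on products by $$\Delta_l([h^1]\cdots[h^n])=[h^1_{(1)}]\cdots[h^n_{(1)}]\otimes_A[h^1_{(2)}]\cdots[h^n_{(2)}],$$ $$\epsilon_l([h^1]\cdots[h^n])=\varepsilon_{h^1_{(1)}}\varepsilon_{h^1_{(2)}h^2_{(1)}}\cdots\varepsilon_{h^1_{(n)}h^2_{(n-1)}\cdots h^n},$$ $$\Delta_r([h^1]\cdots[h^n])=[h^1_{(1)}]\cdots[h^n_{(1)}]\otimes_{\tilde A}[h^1_{(2)}]\cdots[h^n_{(2)}],$$ $$\epsilon_r([h^1]\cdots[h^n])=\tilde\varepsilon_{h^1h^2_{(1)}\cdots h^n_{(1)}}\tilde\varepsilon_{h^2_{(2)}\cdots h^n_{(2)}}\cdots\tilde\varepsilon_{h^n_{(n)}},$$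 such that $(H_{par},A,\tilde A,s,t,\tilde s,\tilde t,\Delta_l,\Delta_r,\epsilon_l,\epsilon_r,\mathcal S)$ is a Hopf algebroid. -/

import Mathlib

open scoped TensorProduct
open MulOpposite

noncomputable section

universe u v w x

/-! ### Tensor products over a noncommutative base -/

section Balanced

variable (k : Type u) [CommRing k] {H : Type v} [Ring H] [Algebra k H]
  {A : Type w} {B : Type x}

/-- The submodule of `H ⊗ H` (over `k`) generated by the elements `x◁a ⊗ y - x ⊗ a▷y`, where the
right action `x ↦ x◁a` is `ρ a` and the left action `y ↦ a▷y` is `l a`. -/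
def balRel (ρ l : A → H →ₗ[k] H) : Submodule k (H ⊗[k] H) :=
  Submodule.span k {z | ∃ (a : A) (x y : H), z = ρ a x ⊗ₜ[k] y - x ⊗ₜ[k] l a y}

/-- The tensor product `H ⊗_A H`, for the right action `ρ` of `A` on the first factor and the left
action `l` of `A` on the second factor. -/
abbrev BalTensor (ρ l : A → H →ₗ[k] H) : Type _ := (H ⊗[k] H) ⧸ balRel k ρ l

/-- The relations that define `H ⊗_A H ⊗_B H` as a quotient of `H ⊗ H ⊗ H`. -/
def balRelThree (ρ₁ l₁ : A → H →ₗ[k] H) (ρ₂ l₂ : B → H →ₗ[k] H) :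
    Submodule k ((H ⊗[k] H) ⊗[k] H) :=
  Submodule.span k
    ({z | ∃ (a : A) (x y v : H),
        z = (ρ₁ a x ⊗ₜ[k] y) ⊗ₜ[k] v - (x ⊗ₜ[k] l₁ a y) ⊗ₜ[k] v} ∪
     {z | ∃ (b : B) (x y v : H),
        z = (x ⊗ₜ[k] ρ₂ b y) ⊗ₜ[k] v - (x ⊗ₜ[k] y) ⊗ₜ[k] l₂ b v})

/-- The threefold tensor product `H ⊗_A H ⊗_B H`. -/
abbrev BalTensorThree (ρ₁ l₁ : A → H →ₗ[k] H) (ρ₂ l₂ : B → H →ₗ[k] H) : Type _ :=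
  ((H ⊗[k] H) ⊗[k] H) ⧸ balRelThree k ρ₁ l₁ ρ₂ l₂

variable {k}

/-- The canonical map `(H ⊗_A H) ⊗ H → H ⊗_A H ⊗_B H`. -/
def balJoinLeft (ρ₁ l₁ : A → H →ₗ[k] H) (ρ₂ l₂ : B → H →ₗ[k] H) :
    BalTensor k ρ₁ l₁ ⊗[k] H →ₗ[k] BalTensorThree k ρ₁ l₁ ρ₂ l₂ :=
  TensorProduct.lift ((balRel k ρ₁ l₁).liftQ
    ((TensorProduct.mk k (H ⊗[k] H) H).compr₂ (balRelThree k ρ₁ l₁ ρ₂ l₂).mkQ) (by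
      refine Submodule.span_le.2 ?_
      rintro _ ⟨a, x, y, rfl⟩
      refine LinearMap.mem_ker.2 (LinearMap.ext fun v => ?_)
      refine (Submodule.Quotient.mk_eq_zero _).2 ?_
      refine Submodule.subset_span (Or.inl ⟨a, x, y, v, ?_⟩)
      simp))

/-- The canonical map `H ⊗ (H ⊗_B H) → H ⊗_A H ⊗_B H`. -/
def balJoinRight (ρ₁ l₁ : A → H →ₗ[k] H) (ρ₂ l₂ : B → H →ₗ[k] H) :
    H ⊗[k] BalTensor k ρ₂ l₂ →ₗ[k] BalTensorThree k ρ₁ l₁ ρ₂ l₂ :=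
  TensorProduct.lift (LinearMap.flip ((balRel k ρ₂ l₂).liftQ
    (((TensorProduct.mk k H (H ⊗[k] H)).compr₂
      ((balRelThree k ρ₁ l₁ ρ₂ l₂).mkQ ∘ₗ (TensorProduct.assoc k H H H).symm.toLinearMap)).flip)
    (by
      refine Submodule.span_le.2 ?_
      rintro _ ⟨b, y, v, rfl⟩
      refine LinearMap.mem_ker.2 (LinearMap.ext fun x => ?_)
      refine (Submodule.Quotient.mk_eq_zero _).2 ?_
      refine Submodule.subset_span (Or.inr ⟨b, x, y, v, ?_⟩)
      simp [TensorProduct.tmul_sub])))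

end Balanced

/-! ### Bialgebroids and Hopf algebroids

In the axioms below an element of `H ⊗_A H` is handled through its representatives in `H ⊗ H`
(over `k`): the hypothesis that `z` is mapped to `Δ h` says that `z` is a representative
`∑ xᵢ ⊗ yᵢ` of `Δ h`, and the axiom is required for all representatives. So each axiom
includes the claim that the map which it evaluates on `Δ h` is well defined there. -/

section Bialgebroid

section Tensor

variable {k : Type u} [CommRing k] {H : Type v} [Ring H] [Algebra k H]
  {A : Type w} [Ring A] [Algebra k A] (s : A →ₐ[k] H) (t : Aᵐᵒᵖ →ₐ[k] H)

/-- `a ↦ (h ↦ s(a) h)` -/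
def mulLeftSource (a : A) : H →ₗ[k] H := LinearMap.mulLeft k (s a)
/-- `a ↦ (h ↦ t(a) h)` -/
def mulLeftTarget (a : A) : H →ₗ[k] H := LinearMap.mulLeft k (t (op a))
/-- `a ↦ (h ↦ h s(a))` -/
def mulRightSource (a : A) : H →ₗ[k] H := LinearMap.mulRight k (s a)
/-- `a ↦ (h ↦ h t(a))` -/
def mulRightTarget (a : A) : H →ₗ[k] H := LinearMap.mulRight k (t (op a))

/-- `H ⊗_A H` for the bimodule structure `a ▷ h ◁ b = s(a) t(b) h`:
here `t(a) x ⊗ y = x ⊗ s(a) y`. -/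
abbrev LeftTensor : Type _ := BalTensor k (mulLeftTarget t) (mulLeftSource s)

/-- `H ⊗_A H` for the bimodule structure `a ▷ h ◁ b = h s(b) t(a)`:
here `x s(a) ⊗ y = x ⊗ y t(a)`. -/
abbrev RightTensor : Type _ := BalTensor k (mulRightSource s) (mulRightTarget t)

/-- The projection `H ⊗ H → H ⊗_A H`. -/
def leftMk : H ⊗[k] H →ₗ[k] LeftTensor s t :=
  (balRel k (mulLeftTarget t) (mulLeftSource s)).mkQ

/-- The projection `H ⊗ H → H ⊗_A H`. -/
def rightMk : H ⊗[k] H →ₗ[k] RightTensor s t :=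
  (balRel k (mulRightSource s) (mulRightTarget t)).mkQ

end Tensor

variable (k : Type u) [CommRing k]

/-- Left bialgebroids over `A` with total algebra `H`. The bimodule structure of `H` is
`a ▷ h ◁ b = s(a) t(b) h`. An anti-morphism `A → H` is a morphism `Aᵐᵒᵖ → H`. -/
structure LeftBialgebroid (H : Type v) [Ring H] [Algebra k H] (A : Type w) [Ring A]
    [Algebra k A] where
  /-- source map -/
  s : A →ₐ[k] H
  /-- target map -/
  t : Aᵐᵒᵖ →ₐ[k] H
  commute_st : ∀ a b : A, s a * t (op b) = t (op b) * s a
  /-- comultiplication -/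
  comul : H →ₗ[k] LeftTensor s t
  /-- counit -/
  counit : H →ₗ[k] A
  /-- `Δ(a ▷ h ◁ b) = a ▷ Δ(h) ◁ b` -/
  comul_bilinear : ∀ (a b : A) (h : H) (z : H ⊗[k] H), leftMk s t z = comul h →
    comul (s a * t (op b) * h) = leftMk s t ((s a ⊗ₜ[k] t (op b)) * z)
  /-- `ε(a ▷ h ◁ b) = a ε(h) b` -/
  counit_bilinear : ∀ (a b : A) (h : H), counit (s a * t (op b) * h) = a * counit h * b
  /-- `(Δ ⊗_A I) ∘ Δ = (I ⊗_A Δ) ∘ Δ` -/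
  coassoc : ∀ (h : H) (z z' : H ⊗[k] H),
    leftMk s t z = comul h → leftMk s t z' = comul h →
    balJoinLeft (mulLeftTarget t) (mulLeftSource s) (mulLeftTarget t) (mulLeftSource s)
        (TensorProduct.map comul LinearMap.id z) =
      balJoinRight (mulLeftTarget t) (mulLeftSource s) (mulLeftTarget t) (mulLeftSource s)
        (TensorProduct.map LinearMap.id comul z')
  /-- `(ε ⊗_A I) ∘ Δ = I`, that is `∑ ε(h₍₁₎) ▷ h₍₂₎ = h` -/
  counit_comul : ∀ (h : H) (z : H ⊗[k] H), leftMk s t z = comul h →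
    TensorProduct.lift ((LinearMap.mul k H).comp (s.toLinearMap ∘ₗ counit)) z = h
  /-- `(I ⊗_A ε) ∘ Δ = I`, that is `∑ h₍₁₎ ◁ ε(h₍₂₎) = h` -/
  comul_counit : ∀ (h : H) (z : H ⊗[k] H), leftMk s t z = comul h →
    TensorProduct.lift ((LinearMap.mul k H).flip.compl₂
      (t.toLinearMap ∘ₗ (opLinearEquiv k).toLinearMap ∘ₗ counit)) z = h
  /-- `Δ` takes values in the Takeuchi product: `∑ h₍₁₎ t(a) ⊗ h₍₂₎ = ∑ h₍₁₎ ⊗ h₍₂₎ s(a)` -/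
  takeuchi : ∀ (h : H) (z : H ⊗[k] H), leftMk s t z = comul h → ∀ a : A,
    leftMk s t (z * (t (op a) ⊗ₜ[k] 1)) =
      leftMk s t (z * (1 ⊗ₜ[k] s a))
  comul_one : comul 1 = leftMk s t (1 ⊗ₜ[k] 1)
  comul_mul : ∀ (g h : H) (y z : H ⊗[k] H),
    leftMk s t y = comul g → leftMk s t z = comul h →
    comul (g * h) = leftMk s t (y * z)
  counit_one : counit 1 = 1
  counit_mul_source : ∀ g h : H, counit (g * h) = counit (g * s (counit h))
  counit_mul_target : ∀ g h : H, counit (g * h) = counit (g * t (op (counit h)))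

/-- Right bialgebroids over `A` with total algebra `H`. The bimodule structure of `H` is
`a ▷ h ◁ b = h s(b) t(a)`. -/
structure RightBialgebroid (H : Type v) [Ring H] [Algebra k H] (A : Type w) [Ring A]
    [Algebra k A] where
  /-- source map -/
  s : A →ₐ[k] H
  /-- target map -/
  t : Aᵐᵒᵖ →ₐ[k] H
  commute_st : ∀ a b : A, s a * t (op b) = t (op b) * s a
  /-- comultiplication -/
  comul : H →ₗ[k] RightTensor s t
  /-- counit -/
  counit : H →ₗ[k] A
  /-- `Δ(a ▷ h ◁ b) = a ▷ Δ(h) ◁ b` -/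
  comul_bilinear : ∀ (a b : A) (h : H) (z : H ⊗[k] H), rightMk s t z = comul h →
    comul (h * s b * t (op a)) = rightMk s t (z * (t (op a) ⊗ₜ[k] s b))
  /-- `ε(a ▷ h ◁ b) = a ε(h) b` -/
  counit_bilinear : ∀ (a b : A) (h : H), counit (h * s b * t (op a)) = a * counit h * b
  /-- `(Δ ⊗_A I) ∘ Δ = (I ⊗_A Δ) ∘ Δ` -/
  coassoc : ∀ (h : H) (z z' : H ⊗[k] H),
    rightMk s t z = comul h → rightMk s t z' = comul h →
    balJoinLeft (mulRightSource s) (mulRightTarget t) (mulRightSource s) (mulRightTarget t)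
        (TensorProduct.map comul LinearMap.id z) =
      balJoinRight (mulRightSource s) (mulRightTarget t) (mulRightSource s) (mulRightTarget t)
        (TensorProduct.map LinearMap.id comul z')
  /-- `(ε ⊗_A I) ∘ Δ = I`, that is `∑ ε(h₍₁₎) ▷ h₍₂₎ = h` -/
  counit_comul : ∀ (h : H) (z : H ⊗[k] H), rightMk s t z = comul h →
    TensorProduct.lift ((LinearMap.mul k H).flip.comp
      (t.toLinearMap ∘ₗ (opLinearEquiv k).toLinearMap ∘ₗ counit)) z = h
  /-- `(I ⊗_A ε) ∘ Δ = I`, that is `∑ h₍₁₎ ◁ ε(h₍₂₎) = h` -/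
  comul_counit : ∀ (h : H) (z : H ⊗[k] H), rightMk s t z = comul h →
    TensorProduct.lift ((LinearMap.mul k H).compl₂ (s.toLinearMap ∘ₗ counit)) z = h
  /-- `Δ` takes values in the Takeuchi product: `∑ s(a) h₍₁₎ ⊗ h₍₂₎ = ∑ h₍₁₎ ⊗ t(a) h₍₂₎` -/
  takeuchi : ∀ (h : H) (z : H ⊗[k] H), rightMk s t z = comul h → ∀ a : A,
    rightMk s t ((s a ⊗ₜ[k] 1) * z) =
      rightMk s t ((1 ⊗ₜ[k] t (op a)) * z)
  comul_one : comul 1 = rightMk s t (1 ⊗ₜ[k] 1)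
  comul_mul : ∀ (g h : H) (y z : H ⊗[k] H),
    rightMk s t y = comul g → rightMk s t z = comul h →
    comul (g * h) = rightMk s t (y * z)
  counit_one : counit 1 = 1
  counit_mul_source : ∀ g h : H, counit (g * h) = counit (s (counit g) * h)
  counit_mul_target : ∀ g h : H, counit (g * h) = counit (t (op (counit g)) * h)

/-- Hopf algebroids with total algebra `H`, whose left bialgebroid is over `A` and whose right
bialgebroid is over `B`. -/
structure HopfAlgebroid (H : Type v) [Ring H] [Algebra k H] (A : Type w) [Ring A] [Algebra k A]
    (B : Type x) [Ring B] [Algebra k B] where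
  left : LeftBialgebroid k H A
  right : RightBialgebroid k H B
  anti_isomorphic : Nonempty (A ≃ₐ[k] Bᵐᵒᵖ)
  /-- the antipode, an anti-homomorphism of algebras -/
  antipode : H →ₐ[k] Hᵐᵒᵖ
  left_counit_right_target : ∀ b : B,
    left.s (left.counit (right.t (op b))) = right.t (op b)
  left_counit_right_source : ∀ b : B,
    left.t (op (left.counit (right.s b))) = right.s b
  right_counit_left_target : ∀ a : A,
    right.s (right.counit (left.t (op a))) = left.t (op a)
  right_counit_left_source : ∀ a : A,
    right.t (op (right.counit (left.s a))) = left.s a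
  /-- `(Δ_l ⊗_B I) ∘ Δ_r = (I ⊗_A Δ_r) ∘ Δ_l` as maps `H → H ⊗_A H ⊗_B H` -/
  left_right_coassoc : ∀ (h : H) (z z' : H ⊗[k] H),
    rightMk right.s right.t z = right.comul h → leftMk left.s left.t z' = left.comul h →
    balJoinLeft (mulLeftTarget left.t) (mulLeftSource left.s)
        (mulRightSource right.s) (mulRightTarget right.t)
        (TensorProduct.map left.comul LinearMap.id z) =
      balJoinRight (mulLeftTarget left.t) (mulLeftSource left.s)
        (mulRightSource right.s) (mulRightTarget right.t)
        (TensorProduct.map LinearMap.id right.comul z')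
  /-- `(I ⊗_B Δ_l) ∘ Δ_r = (Δ_r ⊗_A I) ∘ Δ_l` as maps `H → H ⊗_B H ⊗_A H` -/
  right_left_coassoc : ∀ (h : H) (z z' : H ⊗[k] H),
    rightMk right.s right.t z = right.comul h → leftMk left.s left.t z' = left.comul h →
    balJoinRight (mulRightSource right.s) (mulRightTarget right.t)
        (mulLeftTarget left.t) (mulLeftSource left.s)
        (TensorProduct.map LinearMap.id left.comul z) =
      balJoinLeft (mulRightSource right.s) (mulRightTarget right.t)
        (mulLeftTarget left.t) (mulLeftSource left.s)
        (TensorProduct.map right.comul LinearMap.id z')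
  /-- `S(t(a) h t̃(b)) = s̃(b) S(h) s(a)` -/
  antipode_target : ∀ (a : A) (b : B) (h : H),
    unop (antipode (left.t (op a) * h * right.t (op b))) =
      right.s b * unop (antipode h) * left.s a
  /-- `∑ S(h₍₁₎) h₍₂₎ = s̃(ε_r(h))`, with the sum taken over `Δ_l(h)` -/
  antipode_mul : ∀ (h : H) (z : H ⊗[k] H), leftMk left.s left.t z = left.comul h →
    TensorProduct.lift ((LinearMap.mul k H).comp
      ((opLinearEquiv k).symm.toLinearMap ∘ₗ antipode.toLinearMap)) z =
      right.s (right.counit h)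
  /-- `∑ h₍₁₎ S(h₍₂₎) = s(ε_l(h))`, with the sum taken over `Δ_r(h)` -/
  mul_antipode : ∀ (h : H) (z : H ⊗[k] H), rightMk right.s right.t z = right.comul h →
    TensorProduct.lift ((LinearMap.mul k H).compl₂
      ((opLinearEquiv k).symm.toLinearMap ∘ₗ antipode.toLinearMap)) z =
      left.s (left.counit h)

end Bialgebroid

/-! ### The partial Hopf algebra -/

section Partial

variable (k : Type u) [CommRing k] (H : Type v) [Ring H] [HopfAlgebra k H]

variable {k H} in
/-- `sweedler f g h = ∑ f(h₍₁₎) g(h₍₂₎)`. -/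
def sweedler {R : Type w} [Ring R] [Algebra k R] (f g : H →ₗ[k] R) : H →ₗ[k] R :=
  LinearMap.mul' k R ∘ₗ TensorProduct.map f g ∘ₗ Coalgebra.comul

/-- The antipode of `H`. -/
abbrev antip : H →ₗ[k] H := HopfAlgebra.antipode k (A := H)

/-- The relations that define the partial Hopf algebra as a quotient of the tensor algebra. -/
inductive HparRel : TensorAlgebra k H → TensorAlgebra k H → Prop
  | one : HparRel (TensorAlgebra.ι k 1) 1
  /-- `h ⊗ g₍₁₎ ⊗ S(g₍₂₎) = h g₍₁₎ ⊗ S(g₍₂₎)` -/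
  | mul_eps (h g : H) : HparRel
      (TensorAlgebra.ι k h * sweedler (TensorAlgebra.ι k) (TensorAlgebra.ι k ∘ₗ antip k H) g)
      (sweedler (TensorAlgebra.ι k ∘ₗ LinearMap.mulLeft k h) (TensorAlgebra.ι k ∘ₗ antip k H) g)
  /-- `h₍₁₎ ⊗ S(h₍₂₎) ⊗ g = h₍₁₎ ⊗ S(h₍₂₎) g` -/
  | eps_mul (h g : H) : HparRel
      (sweedler (TensorAlgebra.ι k) (TensorAlgebra.ι k ∘ₗ antip k H) h * TensorAlgebra.ι k g)
      (sweedler (TensorAlgebra.ι k) (TensorAlgebra.ι k ∘ₗ LinearMap.mulRight k g ∘ₗ antip k H) h)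
  /-- `h ⊗ S(g₍₁₎) ⊗ g₍₂₎ = h S(g₍₁₎) ⊗ g₍₂₎` -/
  | mul_eps' (h g : H) : HparRel
      (TensorAlgebra.ι k h * sweedler (TensorAlgebra.ι k ∘ₗ antip k H) (TensorAlgebra.ι k) g)
      (sweedler (TensorAlgebra.ι k ∘ₗ LinearMap.mulLeft k h ∘ₗ antip k H) (TensorAlgebra.ι k) g)
  /-- `S(h₍₁₎) ⊗ h₍₂₎ ⊗ g = S(h₍₁₎) ⊗ h₍₂₎ g` -/
  | eps_mul' (h g : H) : HparRel
      (sweedler (TensorAlgebra.ι k ∘ₗ antip k H) (TensorAlgebra.ι k) h * TensorAlgebra.ι k g)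
      (sweedler (TensorAlgebra.ι k ∘ₗ antip k H) (TensorAlgebra.ι k ∘ₗ LinearMap.mulRight k g) h)

/-- The partial Hopf algebra of `H`: the quotient of the tensor algebra by the two-sided ideal that
the relations generate. -/
abbrev Hpar : Type (max u v) := RingQuot (HparRel k H)

/-- The canonical map `h ↦ [h]`. -/
def parCls : H →ₗ[k] Hpar k H :=
  (RingQuot.mkAlgHom k (HparRel k H)).toLinearMap ∘ₗ TensorAlgebra.ι k

variable {H} in
/-- The product `[h¹] ⋯ [hⁿ]`. -/
def parWord (w : List H) : Hpar k H := (w.map (parCls k H)).prod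

/-- `ε_h = [h₍₁₎] [S(h₍₂₎)]` -/
def parEps : H →ₗ[k] Hpar k H := sweedler (parCls k H) (parCls k H ∘ₗ antip k H)

/-- `ε̃_h = [S(h₍₁₎)] [h₍₂₎]` -/
def parEpsTilde : H →ₗ[k] Hpar k H := sweedler (parCls k H ∘ₗ antip k H) (parCls k H)

/-- The subalgebra `A` generated by the elements `ε_h`. -/
def parBase : Subalgebra k (Hpar k H) := Algebra.adjoin k (Set.range (parEps k H))

/-- The subalgebra `Ã` generated by the elements `ε̃_h`. -/
def parBaseTilde : Subalgebra k (Hpar k H) := Algebra.adjoin k (Set.range (parEpsTilde k H))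

variable {H} in
/-- `∑ [h¹₍₁₎] ⋯ [hⁿ₍₁₎] ⊗ [h¹₍₂₎] ⋯ [hⁿ₍₂₎]`, as a product in the algebra `H_par ⊗ H_par`
over `k`. -/
def parWordComul (w : List H) : Hpar k H ⊗[k] Hpar k H :=
  (w.map fun h => TensorProduct.map (parCls k H) (parCls k H) (Coalgebra.comul (R := k) h)).prod

variable {H} in
/-- For `w = [h², …, hⁿ]` the linear map
`h¹ ↦ ∑ ε_{h¹₍₁₎} ε_{h¹₍₂₎ h²₍₁₎} ⋯ ε_{h¹₍ₙ₎ h²₍ₙ₋₁₎ ⋯ hⁿ}`,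
by the recursion `E_{[]}(g) = ε_g`, `E_{h :: w}(g) = ∑ ε_{g₍₁₎} E_w(g₍₂₎ h)`. -/
def parCounitLeft (w : List H) : H →ₗ[k] Hpar k H :=
  w.foldr (fun h φ => sweedler (parEps k H) (φ ∘ₗ LinearMap.mulRight k h)) (parEps k H)

variable {H} in
/-- For `w = [h¹, …, hⁿ⁻¹]` the linear map
`hⁿ ↦ ∑ ε̃_{h¹ h²₍₁₎ ⋯ hⁿ₍₁₎} ε̃_{h²₍₂₎ ⋯ hⁿ₍₂₎} ⋯ ε̃_{hⁿ₍ₙ₎}`,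
by the recursion `E_{[]}(g) = ε̃_g`, `E_{w ++ [h]}(g) = ∑ E_w(h g₍₁₎) ε̃_{g₍₂₎}`. -/
def parCounitRight (w : List H) : H →ₗ[k] Hpar k H :=
  w.foldl (fun φ h => sweedler (φ ∘ₗ LinearMap.mulLeft k h) (parEpsTilde k H)) (parEpsTilde k H)

variable {k H} in
/-- The inverse of an invertible antipode. -/
def antipInv (hS : Function.Bijective (antip k H)) : H →ₗ[k] H :=
  (LinearEquiv.ofBijective (antip k H) hS).symm.toLinearMap

end Partial

end

/-!
Write `[h]` for the class of `h`, and `S`, `S'` for the anti-automorphisms of `H_par` induced by the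
antipode and by its inverse; they are inverse to each other and exchange `A` and `Ã`.

The calculus. A sum over Sweedler indices is a product in a convolution algebra `Hom(C, R)`. An
element `h` of `H` is treated as a coalgebra map `x : C → H`, which is an invertible element of
`Hom(C, H)` with inverse `S ∘ x`; two independent elements `h`, `g` are the two projections of
`C = H ⊗ H`, whose product is the coalgebra map `mul : H ⊗ H → H`. In this form the defining
relations of `H_par` say that `p(f) * (p(x) * p(x⁻¹)) = p(f * x) * p(x⁻¹)` and its three variants
(`IsPartialRep.convPost_mul_eps` and the lemmas after it), and everything else is computed from
these: `[h] ε_g = ε_{h₍₁₎ g} [h₍₂₎]`, its mirror images, and `ε_g ε̃_h = ε̃_h ε_g`, so that `A` and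
`Ã` commute.

The comultiplications. The diagonal map `D : T(H) → H_par ⊗ H_par`, `h ↦ [h₍₁₎] ⊗ [h₍₂₎]`, is an
algebra map. Let `M` be the kernel of `H_par ⊗ H_par → H_par ⊗_A H_par`, a right ideal. Since
`S'(ε_{h₍₂₎}) [h₍₁₎] = [h]`, one has `[h₍₁₎] ⊗ ε_{h₍₂₎} = [h] ⊗ 1` modulo `M`
(`map_tmul_eps_one_smodEq`). From this it follows that `D(h) M ⊆ M` (`diag_mem_leftStab`), which is
the Takeuchi condition, and that `D` satisfies the four families of relations modulo `M`
(`diagLift_rel`). Hence `D` induces `Δ_l`, which is multiplicative on arbitrary representatives,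
with `Δ_l(a) = a ⊗ 1` on `A` and `Δ_l(b) = 1 ⊗ b` on `Ã`. The flip `x ⊗ y ↦ S'(y) ⊗ S'(x)` carries
the relations of `H_par ⊗_Ã H_par` to those of `H_par ⊗_A H_par`, and values of `D` to values of `D`
(`diagLift_tensorAnti`), so all statements about `Δ_r` are images of statements about `Δ_l`.

The counits. They are defined by the antipode axioms: `x ⊗ y ↦ x S(y)` is well defined on
`H_par ⊗_Ã H_par`, and `ε_l` is its composition with `Δ_r`; dually, `ε_r` is `x ⊗ y ↦ S(x) y` after
`Δ_l`. Then `ε_l([h] x) = [h₍₁₎] ε_l(x) [S(h₍₂₎)]`, an adjoint action that preserves `A`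
(`adj_mem`), and the counit axioms follow by induction on the length of a product of classes.
The right counit is obtained from `S ∘ ε_r = ε_l ∘ S` (`antiS_counitR`).

Coassociativity. `D` factors through the coassociative coproduct of `T(H)` that extends that of `H`
multiplicatively (`diagLift_eq`), so all four coassociativity laws, mixed ones included, hold as
soon as the maps that they compose are well defined, which is multiplicativity again
(`join_coassoc`).
-/

noncomputable section

/-! ### Convolution of linear maps on a coalgebra -/

section Convolution

open WithConv Coalgebra

variable {k : Type*} [CommRing k] {C : Type*} [AddCommGroup C] [Module k C] [Coalgebra k C]
  {R : Type*} [Ring R] [Algebra k R] {R' : Type*} [Ring R'] [Algebra k R']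

/-- Postcomposition with a linear map, on the convolution ring of maps from a coalgebra. -/
def convPost (g : R →ₗ[k] R') (F : WithConv (C →ₗ[k] R)) : WithConv (C →ₗ[k] R') :=
  toConv (g ∘ₗ F.ofConv)

omit [Coalgebra k C] in
@[simp] lemma convPost_apply (g : R →ₗ[k] R') (F : WithConv (C →ₗ[k] R)) (c : C) :
    (convPost g F).ofConv c = g (F.ofConv c) := rfl

lemma convPost_mul (g : R →ₐ[k] R') (F G : WithConv (C →ₗ[k] R)) :
    convPost g.toLinearMap (F * G) = convPost g.toLinearMap F * convPost g.toLinearMap G :=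
  congrArg toConv (LinearMap.algHom_comp_convMul_distrib g F G)

/-- The map `c ↦ ε(c) r`, through which an element `r` acts on the convolution ring. -/
def convConst (r : R) : WithConv (C →ₗ[k] R) :=
  toConv (LinearMap.toSpanSingleton k R r ∘ₗ counit)

lemma convConst_mul_apply (r : R) (F : WithConv (C →ₗ[k] R)) (c : C) :
    (convConst r * F).ofConv c = r * F.ofConv c := by
  have h := congrArg F.ofConv (sum_counit_smul (ℛ k c))
  rw [(ℛ k c).convMul_apply, ← h, map_sum, Finset.mul_sum]
  refine Finset.sum_congr rfl fun i _ => ?_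
  simp [convConst]

lemma mul_convConst_apply (r : R) (F : WithConv (C →ₗ[k] R)) (c : C) :
    (F * convConst r).ofConv c = F.ofConv c * r := by
  have h := congrArg (fun z => F.ofConv (TensorProduct.rid k C z)) (sum_tmul_counit_eq (ℛ k c))
  simp only [map_sum, TensorProduct.rid_tmul, one_smul] at h
  rw [(ℛ k c).convMul_apply, ← h, Finset.sum_mul]
  refine Finset.sum_congr rfl fun i _ => ?_
  simp [convConst]

lemma convConst_mul (r r' : R) :
    (convConst (r * r') : WithConv (C →ₗ[k] R)) = convConst r * convConst r' := by
  ext c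
  refine Eq.trans ?_ (convConst_mul_apply r (convConst r') c).symm
  simp [convConst]

lemma convConst_one : (convConst 1 : WithConv (C →ₗ[k] R)) = 1 := by
  ext c
  simp [convConst, LinearMap.convOne_def, Algebra.algebraMap_eq_smul_one]

lemma convPost_one (g : R →ₐ[k] R') :
    convPost g.toLinearMap (1 : WithConv (C →ₗ[k] R)) = 1 := by
  ext c
  simp [LinearMap.convOne_def]

lemma convPost_convConst (g : R →ₗ[k] R') (r : R) :
    convPost g (convConst r : WithConv (C →ₗ[k] R)) = convConst (g r) := by
  ext c
  simp [convConst, convPost]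

lemma convConst_commute {r : R} {F : WithConv (C →ₗ[k] R)}
    (h : ∀ c, r * F.ofConv c = F.ofConv c * r) : convConst r * F = F * convConst r := by
  ext c
  exact (convConst_mul_apply r F c).trans ((h c).trans (mul_convConst_apply r F c).symm)

/-- Precomposition with a coalgebra map is multiplicative for convolution. -/
lemma toConv_comp_mul {C' : Type*} [AddCommGroup C'] [Module k C'] [Coalgebra k C']
    (x : C' →ₗc[k] C) (F G : C →ₗ[k] R) :
    toConv ((toConv F * toConv G).ofConv ∘ₗ x.toLinearMap) =
      toConv (F ∘ₗ x.toLinearMap) * toConv (G ∘ₗ x.toLinearMap) :=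
  congrArg toConv (LinearMap.convMul_comp_coalgHom_distrib (toConv F) (toConv G) x)

/-- For a linear map `p`, the sum `∑ p(f(c₍₁₎)) G(c₍₂₎)` is a convolution in `Q ⊗ R` followed by the
linear map `q ⊗ r ↦ p(q) r`. This makes associativity available although `p` need not be
multiplicative. -/
lemma convPost_mul_eq_tensor {Q : Type*} [Ring Q] [Algebra k Q] (p : Q →ₗ[k] R)
    (f : WithConv (C →ₗ[k] Q)) (G : WithConv (C →ₗ[k] R)) :
    convPost p f * G = convPost (LinearMap.mul' k R ∘ₗ TensorProduct.map p LinearMap.id)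
      (convPost (Algebra.TensorProduct.includeLeft : Q →ₐ[k] Q ⊗[k] R).toLinearMap f *
        convPost (Algebra.TensorProduct.includeRight : R →ₐ[k] Q ⊗[k] R).toLinearMap G) := by
  ext c
  rw [convPost_apply, (ℛ k c).convMul_apply, (ℛ k c).convMul_apply, map_sum]
  simp

lemma mul_convPost_eq_tensor {Q : Type*} [Ring Q] [Algebra k Q] (p : Q →ₗ[k] R)
    (G : WithConv (C →ₗ[k] R)) (f : WithConv (C →ₗ[k] Q)) :
    G * convPost p f = convPost (LinearMap.mul' k R ∘ₗ TensorProduct.map LinearMap.id p)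
      (convPost (Algebra.TensorProduct.includeLeft : R →ₐ[k] R ⊗[k] Q).toLinearMap G *
        convPost (Algebra.TensorProduct.includeRight : Q →ₐ[k] R ⊗[k] Q).toLinearMap f) := by
  ext c
  rw [convPost_apply, (ℛ k c).convMul_apply, (ℛ k c).convMul_apply, map_sum]
  simp

end Convolution

/-! ### Partial representations and convolution -/

section ParConv

open WithConv Coalgebra

variable {k : Type*} [CommRing k] {H : Type*} [Ring H] [HopfAlgebra k H]

lemma sweedler_eq_conv {R : Type*} [Ring R] [Algebra k R] (f g : H →ₗ[k] R) :
    sweedler f g = (toConv f * toConv g).ofConv := rfl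

lemma map_sweedler {R R' : Type*} [Ring R] [Algebra k R] [Ring R'] [Algebra k R'] (φ : R →ₐ[k] R')
    (f g : H →ₗ[k] R) (h : H) :
    φ (sweedler f g h) = sweedler (φ.toLinearMap ∘ₗ f) (φ.toLinearMap ∘ₗ g) h :=
  congrArg (fun F => F h) (LinearMap.algHom_comp_convMul_distrib φ (toConv f) (toConv g))

/-- `ε_h = ∑ p(h₍₁₎) p(S(h₍₂₎))`, for any linear map `p` in place of the canonical one. -/
def epsOf {R : Type*} [Ring R] [Algebra k R] (p : H →ₗ[k] R) : H →ₗ[k] R :=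
  sweedler p (p ∘ₗ antip k H)

/-- `ε̃_h = ∑ p(S(h₍₁₎)) p(h₍₂₎)`, for any linear map `p` in place of the canonical one. -/
def epsTildeOf {R : Type*} [Ring R] [Algebra k R] (p : H →ₗ[k] R) : H →ₗ[k] R :=
  sweedler (p ∘ₗ antip k H) p

/-- Partial representations of a Hopf algebra on an algebra: linear maps that satisfy the relations
of the classes `[h]` in the partial Hopf algebra. -/
structure IsPartialRep {R : Type*} [Ring R] [Algebra k R] (p : H →ₗ[k] R) : Prop where
  map_one : p 1 = 1
  map_mul_eps : ∀ h g, p h * epsOf p g = sweedler (p ∘ₗ LinearMap.mulLeft k h) (p ∘ₗ antip k H) g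
  eps_mul_map : ∀ h g, epsOf p h * p g = sweedler p (p ∘ₗ LinearMap.mulRight k g ∘ₗ antip k H) h
  map_mul_epsTilde : ∀ h g, p h * epsTildeOf p g =
    sweedler (p ∘ₗ LinearMap.mulLeft k h ∘ₗ antip k H) p g
  epsTilde_mul_map : ∀ h g, epsTildeOf p h * p g =
    sweedler (p ∘ₗ antip k H) (p ∘ₗ LinearMap.mulRight k g) h

variable {C : Type*} [AddCommGroup C] [Module k C] [Coalgebra k C]

/-- A coalgebra map `C → H` as an element of the convolution ring. -/
def convHom (x : C →ₗc[k] H) : WithConv (C →ₗ[k] H) := toConv x.toLinearMap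

/-- The convolution inverse `S ∘ x` of a coalgebra map `x`. -/
def convHomInv (x : C →ₗc[k] H) : WithConv (C →ₗ[k] H) := toConv (antip k H ∘ₗ x.toLinearMap)

lemma convHom_mul_inv (x : C →ₗc[k] H) : convHom x * convHomInv x = 1 := by
  have h := toConv_comp_mul x (LinearMap.id : H →ₗ[k] H) (antip k H)
  rw [LinearMap.id_mul_antipode] at h
  refine h.symm.trans ?_
  ext c
  simp [LinearMap.convOne_def]

lemma convHomInv_mul (x : C →ₗc[k] H) : convHomInv x * convHom x = 1 := by
  have h := toConv_comp_mul x (antip k H) (LinearMap.id : H →ₗ[k] H)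
  rw [LinearMap.antipode_mul_id] at h
  refine h.symm.trans ?_
  ext c
  simp [LinearMap.convOne_def]

/-- The identity `p(h) p(a(g₍₁₎)) p(b(g₍₂₎)) = p(h a(g₍₁₎)) p(b(g₍₂₎))` for elements implies the
corresponding identity for convolution, in which `h` and `g` are replaced by functions of the same
variable. -/
lemma convPost_mul_assoc_left {R : Type*} [Ring R] [Algebra k R] (p : H →ₗ[k] R)
    {a b : H →ₗ[k] H}
    (hab : ∀ h g, p h * sweedler (p ∘ₗ a) (p ∘ₗ b) g =
      sweedler (p ∘ₗ LinearMap.mulLeft k h ∘ₗ a) (p ∘ₗ b) g)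
    (f : WithConv (C →ₗ[k] H)) (x : C →ₗc[k] H) :
    convPost p f * (convPost p (toConv (a ∘ₗ x.toLinearMap)) *
        convPost p (toConv (b ∘ₗ x.toLinearMap))) =
      convPost p (f * toConv (a ∘ₗ x.toLinearMap)) * convPost p (toConv (b ∘ₗ x.toLinearMap)) := by
  have e : convPost p (toConv (a ∘ₗ x.toLinearMap)) * convPost p (toConv (b ∘ₗ x.toLinearMap)) =
      toConv (sweedler (p ∘ₗ a) (p ∘ₗ b) ∘ₗ x.toLinearMap) :=
    (toConv_comp_mul x (p ∘ₗ a) (p ∘ₗ b)).symm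
  let i₁ : H →ₐ[k] H ⊗[k] R := Algebra.TensorProduct.includeLeft
  let i₂ : R →ₐ[k] H ⊗[k] R := Algebra.TensorProduct.includeRight
  have e' : convPost i₁.toLinearMap (toConv (a ∘ₗ x.toLinearMap)) *
      convPost i₂.toLinearMap (convPost p (toConv (b ∘ₗ x.toLinearMap))) =
      toConv (sweedler (i₁.toLinearMap ∘ₗ a) (i₂.toLinearMap ∘ₗ p ∘ₗ b) ∘ₗ x.toLinearMap) :=
    (toConv_comp_mul x (i₁.toLinearMap ∘ₗ a) (i₂.toLinearMap ∘ₗ p ∘ₗ b)).symm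
  rw [e, convPost_mul_eq_tensor p f, convPost_mul_eq_tensor p (f * _),
    convPost_mul, mul_assoc, e']
  ext c
  rw [convPost_apply, convPost_apply, (ℛ k c).convMul_apply, (ℛ k c).convMul_apply, map_sum,
    map_sum]
  refine Finset.sum_congr rfl fun i _ => ?_
  refine Eq.trans (b := p (f.ofConv ((ℛ k c).left i)) *
    sweedler (p ∘ₗ a) (p ∘ₗ b) (x ((ℛ k c).right i))) (by simp) ?_
  rw [hab, sweedler_eq_conv, (ℛ k _).convMul_apply]
  simp only [LinearMap.comp_apply]
  rw [sweedler_eq_conv, (ℛ k _).convMul_apply, Finset.mul_sum, map_sum]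
  simp [i₁, i₂]

/-- The mirror image of `convPost_mul_assoc_left`. -/
lemma convPost_mul_assoc_right {R : Type*} [Ring R] [Algebra k R] (p : H →ₗ[k] R)
    {a b : H →ₗ[k] H}
    (hab : ∀ h g, sweedler (p ∘ₗ a) (p ∘ₗ b) h * p g =
      sweedler (p ∘ₗ a) (p ∘ₗ LinearMap.mulRight k g ∘ₗ b) h)
    (f : WithConv (C →ₗ[k] H)) (x : C →ₗc[k] H) :
    convPost p (toConv (a ∘ₗ x.toLinearMap)) * convPost p (toConv (b ∘ₗ x.toLinearMap)) *
        convPost p f =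
      convPost p (toConv (a ∘ₗ x.toLinearMap)) * convPost p (toConv (b ∘ₗ x.toLinearMap) * f) := by
  have e : convPost p (toConv (a ∘ₗ x.toLinearMap)) * convPost p (toConv (b ∘ₗ x.toLinearMap)) =
      toConv (sweedler (p ∘ₗ a) (p ∘ₗ b) ∘ₗ x.toLinearMap) :=
    (toConv_comp_mul x (p ∘ₗ a) (p ∘ₗ b)).symm
  let i₁ : R →ₐ[k] R ⊗[k] H := Algebra.TensorProduct.includeLeft
  let i₂ : H →ₐ[k] R ⊗[k] H := Algebra.TensorProduct.includeRight
  have e' : convPost i₁.toLinearMap (convPost p (toConv (a ∘ₗ x.toLinearMap))) *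
      convPost i₂.toLinearMap (toConv (b ∘ₗ x.toLinearMap)) =
      toConv (sweedler (i₁.toLinearMap ∘ₗ p ∘ₗ a) (i₂.toLinearMap ∘ₗ b) ∘ₗ x.toLinearMap) :=
    (toConv_comp_mul x (i₁.toLinearMap ∘ₗ p ∘ₗ a) (i₂.toLinearMap ∘ₗ b)).symm
  rw [e, mul_convPost_eq_tensor p _ f, mul_convPost_eq_tensor p _ (_ * f),
    convPost_mul, ← mul_assoc, e']
  ext c
  rw [convPost_apply, convPost_apply, (ℛ k c).convMul_apply, (ℛ k c).convMul_apply, map_sum,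
    map_sum]
  refine Finset.sum_congr rfl fun i _ => ?_
  refine Eq.trans (b := sweedler (p ∘ₗ a) (p ∘ₗ b) (x ((ℛ k c).left i)) *
    p (f.ofConv ((ℛ k c).right i))) (by simp) ?_
  rw [hab, sweedler_eq_conv, (ℛ k _).convMul_apply]
  simp only [LinearMap.comp_apply]
  rw [sweedler_eq_conv, (ℛ k _).convMul_apply, Finset.sum_mul, map_sum]
  simp [i₁, i₂]

lemma convHomInv_of_mul {x y m : C →ₗc[k] H} (hm : convHom m = convHom x * convHom y) :
    convHomInv m = convHomInv y * convHomInv x := by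
  refine left_inv_eq_right_inv (convHomInv_mul m) ?_
  rw [hm, mul_assoc, ← mul_assoc (convHom y), convHom_mul_inv, one_mul, convHom_mul_inv]

end ParConv

namespace IsPartialRep

open WithConv Coalgebra

variable {k : Type*} [CommRing k] {H : Type*} [Ring H] [HopfAlgebra k H]
  {C : Type*} [AddCommGroup C] [Module k C] [Coalgebra k C]
  {R : Type*} [Ring R] [Algebra k R] {p : H →ₗ[k] R}

section Convolution

variable (hp : IsPartialRep p)
include hp

lemma convPost_unit : convPost p (1 : WithConv (C →ₗ[k] H)) = 1 := by
  rw [← convConst_one, convPost_convConst, hp.map_one, convConst_one]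

/-- `[f] ε_x = [f x₍₁₎] [S(x₍₂₎)]` -/
lemma convPost_mul_eps (f : WithConv (C →ₗ[k] H)) (x : C →ₗc[k] H) :
    convPost p f * (convPost p (convHom x) * convPost p (convHomInv x)) =
      convPost p (f * convHom x) * convPost p (convHomInv x) :=
  convPost_mul_assoc_left p (a := LinearMap.id) (b := antip k H) hp.map_mul_eps f x

/-- `[f] ε̃_x = [f S(x₍₁₎)] [x₍₂₎]` -/
lemma convPost_mul_epsTilde (f : WithConv (C →ₗ[k] H)) (x : C →ₗc[k] H) :
    convPost p f * (convPost p (convHomInv x) * convPost p (convHom x)) =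
      convPost p (f * convHomInv x) * convPost p (convHom x) :=
  convPost_mul_assoc_left p (a := antip k H) (b := LinearMap.id) hp.map_mul_epsTilde f x

/-- `ε_x [f] = [x₍₁₎] [S(x₍₂₎) f]` -/
lemma eps_mul_convPost (f : WithConv (C →ₗ[k] H)) (x : C →ₗc[k] H) :
    convPost p (convHom x) * convPost p (convHomInv x) * convPost p f =
      convPost p (convHom x) * convPost p (convHomInv x * f) :=
  convPost_mul_assoc_right p (a := LinearMap.id) (b := antip k H) hp.eps_mul_map f x

/-- `ε̃_x [f] = [S(x₍₁₎)] [x₍₂₎ f]` -/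
lemma epsTilde_mul_convPost (f : WithConv (C →ₗ[k] H)) (x : C →ₗc[k] H) :
    convPost p (convHomInv x) * convPost p (convHom x) * convPost p f =
      convPost p (convHomInv x) * convPost p (convHom x * f) :=
  convPost_mul_assoc_right p (a := antip k H) (b := LinearMap.id) hp.epsTilde_mul_map f x

/-- `[h][g] = ε_{h₍₁₎} [h₍₂₎ g]` -/
lemma convHom_mul_convPost (f : WithConv (C →ₗ[k] H)) (x : C →ₗc[k] H) :
    convPost p (convHom x) * convPost p f =
      convPost p (convHom x) * convPost p (convHomInv x) * convPost p (convHom x * f) := by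
  rw [hp.eps_mul_convPost, ← mul_assoc, convHomInv_mul, one_mul]

/-- `[h][g] = [h g₍₁₎] ε̃_{g₍₂₎}` -/
lemma convPost_mul_convHom (f : WithConv (C →ₗ[k] H)) (x : C →ₗc[k] H) :
    convPost p f * convPost p (convHom x) =
      convPost p (f * convHom x) * (convPost p (convHomInv x) * convPost p (convHom x)) := by
  rw [hp.convPost_mul_epsTilde, mul_assoc, convHom_mul_inv, mul_one]

lemma convHom_mul_inv_mul (x : C →ₗc[k] H) :
    convPost p (convHom x) * convPost p (convHomInv x) * convPost p (convHom x) =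
      convPost p (convHom x) := by
  rw [hp.eps_mul_convPost, convHomInv_mul, hp.convPost_unit, mul_one]

lemma convHomInv_mul_mul (x : C →ₗc[k] H) :
    convPost p (convHomInv x) * convPost p (convHom x) * convPost p (convHomInv x) =
      convPost p (convHomInv x) := by
  rw [hp.epsTilde_mul_convPost, convHom_mul_inv, hp.convPost_unit, mul_one]

/-! In the next lemmas `x` and `y` stand for elements `h` and `g`, and `m` for the product `h g`.
The hypothesis says that `m` is the convolution product of `x` and `y`. -/

section Pair

variable {x y m : C →ₗc[k] H} (hm : convHom m = convHom x * convHom y)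
include hm

/-- `ε̃_h ε_g = ε_g ε̃_h`: both sides are `[S(h₍₁₎)] [h₍₂₎ g₍₁₎] [S(g₍₂₎)]`. -/
lemma eps_mul_epsTilde_of_mul :
    convPost p (convHomInv x) * convPost p (convHom x) *
        (convPost p (convHom y) * convPost p (convHomInv y)) =
      convPost p (convHom y) * convPost p (convHomInv y) *
        (convPost p (convHomInv x) * convPost p (convHom x)) := by
  have hi := convHomInv_of_mul hm
  have h1 : convPost p (convHomInv x) * convPost p (convHom x) *
        (convPost p (convHom y) * convPost p (convHomInv y)) =
      convPost p (convHomInv x) * convPost p (convHom m) * convPost p (convHomInv y) := by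
    rw [← mul_assoc, hp.epsTilde_mul_convPost, hm]
  have h2 : convPost p (convHomInv x) * convPost p (convHom m) =
      convPost p (convHom y) * convPost p (convHomInv m) * convPost p (convHom m) := by
    conv_lhs => rw [← hp.convHom_mul_inv_mul m, ← mul_assoc, hp.convPost_mul_eps, hm, ← mul_assoc,
      convHomInv_mul, one_mul]
    rw [hm]
  have h3 : convPost p (convHomInv m) * convPost p (convHom m) * convPost p (convHomInv y) =
      convPost p (convHomInv m) * convPost p (convHom x) := by
    rw [hp.epsTilde_mul_convPost, hm, mul_assoc, convHom_mul_inv, mul_one]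
  rw [h1, h2, mul_assoc, mul_assoc, ← mul_assoc (convPost p (convHomInv m)), h3, hi,
    ← hp.convPost_mul_epsTilde]
  simp only [mul_assoc]

/-- `[h] ε_g = ε_{h₍₁₎ g} [h₍₂₎]` -/
lemma convHom_mul_eps_of_mul :
    convPost p (convHom x) * (convPost p (convHom y) * convPost p (convHomInv y)) =
      convPost p (convHom m) * convPost p (convHomInv m) * convPost p (convHom x) := by
  conv_lhs => rw [← hp.convHom_mul_inv_mul x]
  rw [mul_assoc, mul_assoc, ← mul_assoc (convPost p (convHomInv x)), hp.eps_mul_epsTilde_of_mul hm,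
    ← mul_assoc, hp.convPost_mul_eps, ← hm, mul_assoc, hp.convPost_mul_epsTilde,
    ← convHomInv_of_mul hm, mul_assoc]

/-- `[S(h₍₁₎)] ε_{h₍₂₎ g} = ε_g [S(h)]` -/
lemma convHomInv_mul_eps_of_mul :
    convPost p (convHomInv x) * (convPost p (convHom m) * convPost p (convHomInv m)) =
      convPost p (convHom y) * convPost p (convHomInv y) * convPost p (convHomInv x) := by
  rw [hp.convPost_mul_eps, hm, ← mul_assoc, convHomInv_mul, one_mul, convHomInv_of_mul hm,
    hp.eps_mul_convPost]

end Pair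

end Convolution

end IsPartialRep

/-! ### Two independent variables -/

section PairOfVariables

open WithConv Coalgebra

variable {k : Type*} [CommRing k] {H : Type*} [Ring H] [HopfAlgebra k H]
  {R : Type*} [Ring R] [Algebra k R]

variable (k H) in
/-- The coalgebra map `h ⊗ g ↦ ε(g) h`. -/
def coalgFst : H ⊗[k] H →ₗc[k] H :=
  (Coalgebra.TensorProduct.rid k k H).toCoalgHom.comp
    (Coalgebra.TensorProduct.map (CoalgHom.id k H) (Coalgebra.counitCoalgHom k H))

variable (k H) in
/-- The coalgebra map `h ⊗ g ↦ ε(h) g`. -/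
def coalgSnd : H ⊗[k] H →ₗc[k] H :=
  (Coalgebra.TensorProduct.lid k H).toCoalgHom.comp
    (Coalgebra.TensorProduct.map (Coalgebra.counitCoalgHom k H) (CoalgHom.id k H))

@[simp] lemma coalgFst_tmul (h g : H) : coalgFst k H (h ⊗ₜ g) = counit (R := k) g • h := by
  simp [coalgFst]

@[simp] lemma coalgSnd_tmul (h g : H) : coalgSnd k H (h ⊗ₜ g) = counit (R := k) h • g := by
  simp [coalgSnd]

lemma conv_tmul_apply (F G : WithConv (H ⊗[k] H →ₗ[k] R)) (h g : H) :
    (F * G).ofConv (h ⊗ₜ g) = ∑ i ∈ (ℛ k h).index, ∑ j ∈ (ℛ k g).index,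
      F.ofConv ((ℛ k h).left i ⊗ₜ (ℛ k g).left j) *
        G.ofConv ((ℛ k h).right i ⊗ₜ (ℛ k g).right j) := by
  rw [((ℛ k h).tmul (ℛ k g)).convMul_apply]
  simp [Finset.sum_product]

lemma sum_smul_counit {C : Type*} [AddCommGroup C] [Module k C] [Coalgebra k C] (g : C) :
    ∑ i ∈ (ℛ k g).index, counit (R := k) ((ℛ k g).right i) • (ℛ k g).left i = g := by
  simpa only [map_sum, TensorProduct.rid_tmul, one_smul] using
    congrArg (TensorProduct.rid k C) (sum_tmul_counit_eq (ℛ k g))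

/-- On `h ⊗ g`, a convolution with a function of the first variable is a convolution in `h` alone,
for fixed `g`. The three lemmas that follow are the variants. -/
lemma mul_fst_tmul_apply (F : WithConv (H ⊗[k] H →ₗ[k] R)) (f : H →ₗ[k] R) (h g : H) :
    (F * toConv (f ∘ₗ (coalgFst k H).toLinearMap)).ofConv (h ⊗ₜ g) =
      (toConv (F.ofConv ∘ₗ (TensorProduct.mk k H H).flip g) * toConv f).ofConv h := by
  rw [conv_tmul_apply, (ℛ k h).convMul_apply]
  refine Finset.sum_congr rfl fun i _ => ?_
  conv_rhs => simp only [ofConv_toConv, LinearMap.comp_apply, LinearMap.flip_apply,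
    TensorProduct.mk_apply]; rw [← sum_smul_counit (k := k) g]
  simp [TensorProduct.tmul_sum, Finset.sum_mul]

lemma fst_mul_tmul_apply (F : WithConv (H ⊗[k] H →ₗ[k] R)) (f : H →ₗ[k] R) (h g : H) :
    (toConv (f ∘ₗ (coalgFst k H).toLinearMap) * F).ofConv (h ⊗ₜ g) =
      (toConv f * toConv (F.ofConv ∘ₗ (TensorProduct.mk k H H).flip g)).ofConv h := by
  rw [conv_tmul_apply, (ℛ k h).convMul_apply]
  refine Finset.sum_congr rfl fun i _ => ?_
  conv_rhs => simp only [ofConv_toConv, LinearMap.comp_apply, LinearMap.flip_apply,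
    TensorProduct.mk_apply]; rw [← sum_counit_smul (R := k) (ℛ k g)]
  simp [TensorProduct.tmul_sum, Finset.mul_sum]

lemma mul_snd_tmul_apply (F : WithConv (H ⊗[k] H →ₗ[k] R)) (f : H →ₗ[k] R) (h g : H) :
    (F * toConv (f ∘ₗ (coalgSnd k H).toLinearMap)).ofConv (h ⊗ₜ g) =
      (toConv (F.ofConv ∘ₗ TensorProduct.mk k H H h) * toConv f).ofConv g := by
  rw [conv_tmul_apply, (ℛ k g).convMul_apply, Finset.sum_comm]
  refine Finset.sum_congr rfl fun i _ => ?_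
  conv_rhs => simp only [ofConv_toConv, LinearMap.comp_apply,
    TensorProduct.mk_apply]; rw [← sum_smul_counit (k := k) h]
  simp [TensorProduct.sum_tmul, Finset.sum_mul, ← TensorProduct.smul_tmul']

lemma snd_mul_tmul_apply (F : WithConv (H ⊗[k] H →ₗ[k] R)) (f : H →ₗ[k] R) (h g : H) :
    (toConv (f ∘ₗ (coalgSnd k H).toLinearMap) * F).ofConv (h ⊗ₜ g) =
      (toConv f * toConv (F.ofConv ∘ₗ TensorProduct.mk k H H h)).ofConv g := by
  rw [conv_tmul_apply, (ℛ k g).convMul_apply, Finset.sum_comm]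
  refine Finset.sum_congr rfl fun i _ => ?_
  conv_rhs => simp only [ofConv_toConv, LinearMap.comp_apply,
    TensorProduct.mk_apply]; rw [← sum_counit_smul (R := k) (ℛ k h)]
  simp [TensorProduct.sum_tmul, Finset.mul_sum, ← TensorProduct.smul_tmul']

/-- The multiplication, as a function on `H ⊗ H`, is the convolution product of the two
variables. -/
lemma convHom_mulCoalgHom :
    convHom (Bialgebra.mulCoalgHom k H) = convHom (coalgFst k H) * convHom (coalgSnd k H) := by
  refine congrArg toConv (TensorProduct.ext' fun h g => ?_)
  refine Eq.trans ?_ (mul_snd_tmul_apply (convHom (coalgFst k H)) LinearMap.id h g).symm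
  have e : toConv ((convHom (coalgFst k H)).ofConv ∘ₗ TensorProduct.mk k H H h) =
      convConst h := by
    ext g
    simp [convHom, convConst]
  rw [e, convConst_mul_apply]
  simp

variable {p : H →ₗ[k] R} (hp : IsPartialRep p)
include hp

lemma IsPartialRep.epsTilde_comm_eps (h g : H) :
    epsTildeOf p h * epsOf p g = epsOf p g * epsTildeOf p h := by
  have e := congrArg (fun F => F.ofConv (h ⊗ₜ[k] g))
    (hp.eps_mul_epsTilde_of_mul (convHom_mulCoalgHom (k := k) (H := H)))
  have e₁ : convPost p (convHom (coalgSnd k H)) * convPost p (convHomInv (coalgSnd k H)) =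
      toConv (epsOf p ∘ₗ (coalgSnd k H).toLinearMap) :=
    (toConv_comp_mul _ (p) (p ∘ₗ antip k H)).symm
  have e₂ : convPost p (convHomInv (coalgFst k H)) * convPost p (convHom (coalgFst k H)) =
      toConv (epsTildeOf p ∘ₗ (coalgFst k H).toLinearMap) :=
    (toConv_comp_mul _ (p ∘ₗ antip k H) (p)).symm
  rw [e₁, e₂] at e
  have c₁ (F : H →ₗ[k] R) : toConv ((F ∘ₗ (coalgFst k H).toLinearMap) ∘ₗ
      TensorProduct.mk k H H h) = convConst (F h) := by
    ext g
    simp [convConst]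
  simp only [mul_snd_tmul_apply, snd_mul_tmul_apply, c₁, convConst_mul_apply,
    mul_convConst_apply] at e
  exact e

/-- `[h] ε_g = ε_{h₍₁₎ g} [h₍₂₎]` -/
lemma IsPartialRep.map_mul_eps_eq (h g : H) : p h * epsOf p g =
    sweedler (epsOf p ∘ₗ LinearMap.mulRight k g) (p) h := by
  have e := congrArg (fun F => F.ofConv (h ⊗ₜ[k] g))
    (hp.convHom_mul_eps_of_mul (convHom_mulCoalgHom (k := k) (H := H)))
  have e₁ (x : H ⊗[k] H →ₗc[k] H) : convPost p (convHom x) * convPost p (convHomInv x) =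
      toConv (epsOf p ∘ₗ x.toLinearMap) :=
    (toConv_comp_mul _ (p) (p ∘ₗ antip k H)).symm
  have e₂ : convPost p (convHom (coalgFst k H)) =
    toConv (p ∘ₗ (coalgFst k H).toLinearMap) := rfl
  have c₁ : toConv ((epsOf p ∘ₗ (coalgSnd k H).toLinearMap) ∘ₗ
      (TensorProduct.mk k H H).flip g) = convConst (epsOf p g) := by
    ext g
    simp [convConst]
  have c₂ : (epsOf p ∘ₗ (Bialgebra.mulCoalgHom k H).toLinearMap) ∘ₗ
      (TensorProduct.mk k H H).flip g = epsOf p ∘ₗ LinearMap.mulRight k g := by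
    ext
    simp
  rw [e₁, e₁, e₂] at e
  simp only [mul_fst_tmul_apply, fst_mul_tmul_apply, c₁, c₂,
    mul_convConst_apply] at e
  exact e

/-- `ε_g [S(h)] = [S(h₍₁₎)] ε_{h₍₂₎ g}` -/
lemma IsPartialRep.eps_mul_map_antip (g h : H) : epsOf p g * p (antip k H h) =
    sweedler (p ∘ₗ antip k H) (epsOf p ∘ₗ LinearMap.mulRight k g) h := by
  have e := congrArg (fun F => F.ofConv (h ⊗ₜ[k] g))
    (hp.convHomInv_mul_eps_of_mul (convHom_mulCoalgHom (k := k) (H := H)))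
  have e₁ (x : H ⊗[k] H →ₗc[k] H) : convPost p (convHom x) * convPost p (convHomInv x) =
      toConv (epsOf p ∘ₗ x.toLinearMap) :=
    (toConv_comp_mul _ (p) (p ∘ₗ antip k H)).symm
  have e₂ : convPost p (convHomInv (coalgFst k H)) =
    toConv ((p ∘ₗ antip k H) ∘ₗ (coalgFst k H).toLinearMap) := rfl
  have c₁ : toConv ((epsOf p ∘ₗ (coalgSnd k H).toLinearMap) ∘ₗ
      (TensorProduct.mk k H H).flip g) = convConst (epsOf p g) := by
    ext g
    simp [convConst]
  have c₂ : (epsOf p ∘ₗ (Bialgebra.mulCoalgHom k H).toLinearMap) ∘ₗ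
      (TensorProduct.mk k H H).flip g = epsOf p ∘ₗ LinearMap.mulRight k g := by
    ext
    simp
  rw [e₁, e₁, e₂] at e
  simp only [mul_fst_tmul_apply, fst_mul_tmul_apply, c₁, c₂,
    convConst_mul_apply] at e
  exact e.symm

end PairOfVariables

/-! ### Anti-endomorphisms of the Hopf algebra and of its partial Hopf algebra -/

section Anti

open WithConv Coalgebra

variable {k : Type*} [CommRing k] {H : Type*} [Ring H] [HopfAlgebra k H]

/-- The antipode is an anti-homomorphism of coalgebras: `Δ(S(h)) = S(h₍₂₎) ⊗ S(h₍₁₎)`. -/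
lemma comul_antip (h : H) : comul (R := k) (antip k H h) =
    TensorProduct.map (antip k H) (antip k H) (TensorProduct.comm k H H (comul h)) := by
  let i₁ : H →ₐ[k] H ⊗[k] H := Algebra.TensorProduct.includeLeft
  let i₂ : H →ₐ[k] H ⊗[k] H := Algebra.TensorProduct.includeRight
  have e : toConv (comul : H →ₗ[k] H ⊗[k] H) =
      convPost i₁.toLinearMap (toConv LinearMap.id) *
        convPost i₂.toLinearMap (toConv LinearMap.id) := by
    ext h
    rw [(ℛ k h).convMul_apply]
    simp [i₁, i₂, (ℛ k h).eq]
  have e' : toConv ((TensorProduct.map (antip k H) (antip k H)) ∘ₗ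
      (TensorProduct.comm k H H).toLinearMap ∘ₗ (comul : H →ₗ[k] H ⊗[k] H)) =
      convPost i₂.toLinearMap (toConv (antip k H)) *
        convPost i₁.toLinearMap (toConv (antip k H)) := by
    ext h
    rw [(ℛ k h).convMul_apply]
    simp only [LinearMap.comp_apply]
    rw [← (ℛ k h).eq]
    simp [i₁, i₂]
  have hl : toConv ((comul : H →ₗ[k] H ⊗[k] H) ∘ₗ antip k H) * toConv comul = 1 := by
    have := convPost_mul (Bialgebra.comulAlgHom k H) (toConv (antip k H)) (toConv LinearMap.id)
    rw [LinearMap.antipode_mul_id] at this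
    exact this.symm.trans (convPost_one _)
  have hr : toConv comul * toConv ((TensorProduct.map (antip k H) (antip k H)) ∘ₗ
      (TensorProduct.comm k H H).toLinearMap ∘ₗ (comul : H →ₗ[k] H ⊗[k] H)) = 1 := by
    rw [e, e', mul_assoc, ← mul_assoc (convPost i₂.toLinearMap _), ← convPost_mul i₂,
      LinearMap.id_mul_antipode, convPost_one, one_mul, ← convPost_mul i₁,
      LinearMap.id_mul_antipode, convPost_one]
  exact congrArg (fun F => F.ofConv h) (left_inv_eq_right_inv hl hr)

variable (k H) in
/-- Anti-endomorphisms of a Hopf algebra: linear maps that reverse products and coproducts and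
commute with the antipode. -/
structure IsHopfAnti (σ : H →ₗ[k] H) : Prop where
  map_one : σ 1 = 1
  map_mul : ∀ h g, σ (h * g) = σ g * σ h
  comul : ∀ h, comul (R := k) (σ h) =
    TensorProduct.map σ σ (TensorProduct.comm k H H (comul h))
  antip : ∀ h, antip k H (σ h) = σ (antip k H h)

variable (k H) in
lemma isHopfAnti_antip : IsHopfAnti k H (antip k H) where
  map_one := HopfAlgebra.antipode_one
  map_mul := HopfAlgebra.antipode_mul_antidistrib
  comul := comul_antip
  antip _ := rfl

section Inverse

variable (hS : Function.Bijective (antip k H))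

@[simp] lemma antip_antipInv (h : H) : antip k H (antipInv hS h) = h :=
  (LinearEquiv.ofBijective (antip k H) hS).apply_symm_apply h

@[simp] lemma antipInv_antip (h : H) : antipInv hS (antip k H h) = h :=
  (LinearEquiv.ofBijective (antip k H) hS).symm_apply_apply h

lemma isHopfAnti_antipInv : IsHopfAnti k H (antipInv hS) where
  map_one := hS.1 (by rw [antip_antipInv, (isHopfAnti_antip k H).map_one])
  map_mul h g := hS.1 (by simp [(isHopfAnti_antip k H).map_mul])
  comul h := by
    have e := comul_antip (k := k) (antipInv hS h)
    rw [antip_antipInv] at e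
    rw [e, ← (ℛ k (antipInv hS h)).eq]
    simp
  antip h := by simp

end Inverse

lemma sweedler_op {R : Type*} [Ring R] [Algebra k R] {σ : H →ₗ[k] H} (hσ : IsHopfAnti k H σ)
    (f g : H →ₗ[k] R) (h : H) :
    sweedler ((opLinearEquiv k).toLinearMap ∘ₗ f ∘ₗ σ) ((opLinearEquiv k).toLinearMap ∘ₗ g ∘ₗ σ) h =
      op (sweedler g f (σ h)) := by
  rw [sweedler_eq_conv, (ℛ k h).convMul_apply]
  simp only [sweedler, LinearMap.comp_apply]
  rw [hσ.comul, ← (ℛ k h).eq]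
  simp

/-- Reversing the products of a partial representation and twisting it by an anti-endomorphism gives
a partial representation. -/
lemma IsPartialRep.op {R : Type*} [Ring R] [Algebra k R] {p : H →ₗ[k] R} (hp : IsPartialRep p)
    {σ : H →ₗ[k] H} (hσ : IsHopfAnti k H σ) :
    IsPartialRep ((opLinearEquiv k).toLinearMap ∘ₗ p ∘ₗ σ) := by
  have key {a b a' b' : H →ₗ[k] H} (ha : ∀ h, σ (a h) = a' (σ h)) (hb : ∀ h, σ (b h) = b' (σ h))
      (h : H) : sweedler (((opLinearEquiv k).toLinearMap ∘ₗ p ∘ₗ σ) ∘ₗ a)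
        (((opLinearEquiv k).toLinearMap ∘ₗ p ∘ₗ σ) ∘ₗ b) h =
      MulOpposite.op (sweedler (p ∘ₗ b') (p ∘ₗ a') (σ h)) := by
    rw [← sweedler_op hσ]
    congr 2 <;> ext <;> simp [ha, hb]
  have hS (h : H) : σ (antip k H h) = antip k H (σ h) := (hσ.antip h).symm
  have hid (h : H) : σ ((LinearMap.id : H →ₗ[k] H) h) = (LinearMap.id : H →ₗ[k] H) (σ h) := rfl
  have hL (h g : H) : σ (LinearMap.mulLeft k h g) = LinearMap.mulRight k (σ h) (σ g) :=
    hσ.map_mul h g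
  have hR (h g : H) : σ (LinearMap.mulRight k h g) = LinearMap.mulLeft k (σ h) (σ g) :=
    hσ.map_mul g h
  have hLS (h g : H) : σ ((LinearMap.mulLeft k h ∘ₗ antip k H) g) =
      (LinearMap.mulRight k (σ h) ∘ₗ antip k H) (σ g) := by simp [hσ.map_mul, hS]
  have hRS (h g : H) : σ ((LinearMap.mulRight k h ∘ₗ antip k H) g) =
      (LinearMap.mulLeft k (σ h) ∘ₗ antip k H) (σ g) := by simp [hσ.map_mul, hS]
  constructor
  · simp [hσ.map_one, hp.map_one]
  · intro h g
    refine (congrArg (MulOpposite.op (p (σ h)) * ·) (key hid hS g)).trans ?_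
    refine Eq.trans ?_ (key (hL h) hS g).symm
    exact congrArg MulOpposite.op (hp.epsTilde_mul_map (σ g) (σ h))
  · intro h g
    refine (congrArg (· * MulOpposite.op (p (σ g))) (key hid hS h)).trans ?_
    refine Eq.trans ?_ (key hid (hRS g) h).symm
    exact congrArg MulOpposite.op (hp.map_mul_epsTilde (σ g) (σ h))
  · intro h g
    refine (congrArg (MulOpposite.op (p (σ h)) * ·) (key hS hid g)).trans ?_
    refine Eq.trans ?_ (key (hLS h) hid g).symm
    exact congrArg MulOpposite.op (hp.eps_mul_map (σ g) (σ h))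
  · intro h g
    refine (congrArg (· * MulOpposite.op (p (σ g))) (key hS hid h)).trans ?_
    refine Eq.trans ?_ (key hS (hR g) h).symm
    exact congrArg MulOpposite.op (hp.map_mul_eps (σ g) (σ h))

end Anti

/-! ### Presentations of the partial Hopf algebra -/

section Presentation

open WithConv Coalgebra

variable {k : Type*} [CommRing k] {H : Type*} [Ring H] [HopfAlgebra k H]
  {R : Type*} [Ring R] [Algebra k R] {p : H →ₗ[k] R}

lemma lift_sweedler (p : H →ₗ[k] R) (a b : H →ₗ[k] H) (h : H) :
    TensorAlgebra.lift k p (sweedler (TensorAlgebra.ι k ∘ₗ a) (TensorAlgebra.ι k ∘ₗ b) h) =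
      sweedler (p ∘ₗ a) (p ∘ₗ b) h := by
  rw [map_sweedler]
  congr 2 <;> ext <;> simp

/-- A map on `H` is a partial representation if its extension to the tensor algebra respects the
relations of the partial Hopf algebra. -/
lemma isPartialRep_iff : IsPartialRep p ↔
    ∀ x y, HparRel k H x y → TensorAlgebra.lift k p x = TensorAlgebra.lift k p y := by
  constructor
  · intro hp x y hxy
    induction hxy with
    | one => simpa using hp.map_one
    | mul_eps h g =>
      rw [map_mul, TensorAlgebra.lift_ι_apply]
      refine (congrArg _ (lift_sweedler p LinearMap.id (antip k H) g)).trans ?_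
      exact (hp.map_mul_eps h g).trans (lift_sweedler p (LinearMap.mulLeft k h) _ g).symm
    | eps_mul h g =>
      rw [map_mul, TensorAlgebra.lift_ι_apply]
      refine (congrArg (· * _) (lift_sweedler p LinearMap.id (antip k H) h)).trans ?_
      exact (hp.eps_mul_map h g).trans
        (lift_sweedler p LinearMap.id (LinearMap.mulRight k g ∘ₗ antip k H) h).symm
    | mul_eps' h g =>
      rw [map_mul, TensorAlgebra.lift_ι_apply]
      refine (congrArg _ (lift_sweedler p (antip k H) LinearMap.id g)).trans ?_
      exact (hp.map_mul_epsTilde h g).trans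
        (lift_sweedler p (LinearMap.mulLeft k h ∘ₗ antip k H) LinearMap.id g).symm
    | eps_mul' h g =>
      rw [map_mul, TensorAlgebra.lift_ι_apply]
      refine (congrArg (· * _) (lift_sweedler p (antip k H) LinearMap.id h)).trans ?_
      exact (hp.epsTilde_mul_map h g).trans
        (lift_sweedler p (antip k H) (LinearMap.mulRight k g) h).symm
  · intro hp
    constructor
    · simpa using hp _ _ .one
    · intro h g
      have e := hp _ _ (.mul_eps h g)
      rw [map_mul, TensorAlgebra.lift_ι_apply] at e
      exact (congrArg _ (lift_sweedler p LinearMap.id (antip k H) g)).symm.trans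
        (e.trans (lift_sweedler p (LinearMap.mulLeft k h) _ g))
    · intro h g
      have e := hp _ _ (.eps_mul h g)
      rw [map_mul, TensorAlgebra.lift_ι_apply] at e
      exact (congrArg (· * _) (lift_sweedler p LinearMap.id (antip k H) h)).symm.trans
        (e.trans (lift_sweedler p LinearMap.id (LinearMap.mulRight k g ∘ₗ antip k H) h))
    · intro h g
      have e := hp _ _ (.mul_eps' h g)
      rw [map_mul, TensorAlgebra.lift_ι_apply] at e
      exact (congrArg _ (lift_sweedler p (antip k H) LinearMap.id g)).symm.trans
        (e.trans (lift_sweedler p (LinearMap.mulLeft k h ∘ₗ antip k H) LinearMap.id g))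
    · intro h g
      have e := hp _ _ (.eps_mul' h g)
      rw [map_mul, TensorAlgebra.lift_ι_apply] at e
      exact (congrArg (· * _) (lift_sweedler p (antip k H) LinearMap.id h)).symm.trans
        (e.trans (lift_sweedler p (antip k H) (LinearMap.mulRight k g) h))

/-- A partial representation `p` that presents `R` as the partial Hopf algebra: `R` is generated by
the image of `p`, and every linear relation between the products `p(h¹) ⋯ p(hⁿ)` follows from those
that define the partial Hopf algebra. -/
structure IsParPresentation (p : H →ₗ[k] R) : Prop extends IsPartialRep p where
  lift_surjective : Function.Surjective (TensorAlgebra.lift k p)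
  mem_of_lift_eq_zero : ∀ N : Submodule k (TensorAlgebra k H),
    (∀ x y, HparRel k H x y → ∀ a b, a * (x - y) * b ∈ N) →
      ∀ z, TensorAlgebra.lift k p z = 0 → z ∈ N

variable (k H) in
lemma isParPresentation_parCls : IsParPresentation (parCls k H) := by
  have key : TensorAlgebra.lift k (parCls k H) = RingQuot.mkAlgHom k (HparRel k H) :=
    TensorAlgebra.hom_ext (LinearMap.ext fun h => by simp [parCls])
  refine { isPartialRep_iff.2 fun x y h => ?_ with
    lift_surjective := ?_, mem_of_lift_eq_zero := ?_ }
  · rw [key]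
    exact RingQuot.mkAlgHom_rel k h
  · rw [key]
    exact RingQuot.mkAlgHom_surjective _ _
  · intro N hN z hz
    -- the largest two-sided ideal contained in `N`
    let I : Ideal (TensorAlgebra k H) :=
      { carrier := {x | ∀ a b, a * x * b ∈ N}
        add_mem' := fun hx hy a b => by
          rw [mul_add, add_mul]
          exact N.add_mem (hx a b) (hy a b)
        zero_mem' := by simp
        smul_mem' := fun c x hx a b => by
          rw [smul_eq_mul, ← mul_assoc]
          exact hx _ _ }
    have hI : I.IsTwoSided := ⟨fun {x} c hx a b => by
      rw [← mul_assoc, mul_assoc]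
      exact hx _ _⟩
    have hrel : ∀ ⦃x y⦄, HparRel k H x y → Ideal.Quotient.mkₐ k I x = Ideal.Quotient.mkₐ k I y :=
      fun x y h => Ideal.Quotient.eq.2 (hN x y h)
    have hz' := congrArg (RingQuot.liftAlgHom k ⟨Ideal.Quotient.mkₐ k I, hrel⟩) hz
    rw [key, RingQuot.liftAlgHom_mkAlgHom_apply, map_zero] at hz'
    simpa using Ideal.Quotient.eq_zero_iff_mem.1 hz' 1 1

/-- Induction on the tensor algebra by left multiplication with generators. -/
lemma TensorAlgebra.induction_mul_left {p : TensorAlgebra k H → Prop} (one : p 1)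
    (add : ∀ x y, p x → p y → p (x + y)) (smul : ∀ (r : k) x, p x → p (r • x))
    (mul : ∀ h x, p x → p (TensorAlgebra.ι k h * x)) (x : TensorAlgebra k H) : p x := by
  have key : ∀ y, p y → p (x * y) := by
    induction x using TensorAlgebra.induction with
    | algebraMap r =>
      intro y hy
      rw [← Algebra.smul_def]
      exact smul r y hy
    | ι h => exact mul h
    | mul a b ha hb =>
      intro y hy
      rw [mul_assoc]
      exact ha _ (hb y hy)
    | add a b ha hb =>
      intro y hy
      rw [add_mul]
      exact add _ _ (ha y hy) (hb y hy)
  simpa using key 1 one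

end Presentation

namespace IsParPresentation

variable {k : Type*} [CommRing k] {H : Type*} [Ring H] [HopfAlgebra k H]
  {P : Type*} [Ring P] [Algebra k P] {p : H →ₗ[k] P} (hp : IsParPresentation p)

include hp in
lemma induction_mul_left {q : P → Prop} (one : q 1)
    (add : ∀ x y, q x → q y → q (x + y)) (smul : ∀ (r : k) x, q x → q (r • x))
    (mul : ∀ h x, q x → q (p h * x)) (x : P) : q x := by
  obtain ⟨x, rfl⟩ := hp.lift_surjective x
  induction x using TensorAlgebra.induction_mul_left with
  | one => simpa using one
  | add x y hx hy => simpa using add _ _ hx hy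
  | smul r x hx => simpa using smul r _ hx
  | mul h x hx => simpa using mul h _ hx

section Lift

variable {R : Type*} [Ring R] [Algebra k R] {q : H →ₗ[k] R} (hq : IsPartialRep q)

include hp hq in
lemma lift_eq_zero (z : TensorAlgebra k H) (hz : TensorAlgebra.lift k p z = 0) :
    TensorAlgebra.lift k q z = 0 := by
  refine LinearMap.mem_ker.1 (hp.mem_of_lift_eq_zero
    (LinearMap.ker (TensorAlgebra.lift k q).toLinearMap) (fun x y hxy a b => ?_) z hz)
  simp [isPartialRep_iff.1 hq x y hxy]

/-- The algebra map `[h¹] ⋯ [hⁿ] ↦ q(h¹) ⋯ q(hⁿ)` for a partial representation `q`. -/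
def lift : P →ₐ[k] R :=
  (Ideal.Quotient.liftₐ (RingHom.ker (TensorAlgebra.lift k p)) (TensorAlgebra.lift k q)
    (hp.lift_eq_zero hq)).comp
    (Ideal.quotientKerAlgEquivOfSurjective hp.lift_surjective).symm.toAlgHom

@[simp] lemma lift_apply (h : H) : hp.lift hq (p h) = q h := by
  have e : (Ideal.quotientKerAlgEquivOfSurjective hp.lift_surjective).symm (p h) =
      Ideal.Quotient.mk _ (TensorAlgebra.ι k h) := by
    rw [AlgEquiv.symm_apply_eq]
    exact (TensorAlgebra.lift_ι_apply p h).symm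
  exact (congrArg (Ideal.Quotient.liftₐ (RingHom.ker (TensorAlgebra.lift k p))
    (TensorAlgebra.lift k q) (hp.lift_eq_zero hq)) e).trans (TensorAlgebra.lift_ι_apply q h)

end Lift

/-- The anti-endomorphism `[h¹] ⋯ [hⁿ] ↦ [σ(hⁿ)] ⋯ [σ(h¹)]`. -/
def anti {σ : H →ₗ[k] H} (hσ : IsHopfAnti k H σ) : P →ₐ[k] Pᵐᵒᵖ :=
  hp.lift (hp.toIsPartialRep.op hσ)

section Anti

variable {σ : H →ₗ[k] H} (hσ : IsHopfAnti k H σ)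

@[simp] lemma anti_map (h : H) : hp.anti hσ (p h) = op (p (σ h)) :=
  hp.lift_apply (hp.toIsPartialRep.op hσ) h

lemma anti_prod (w : List H) :
    hp.anti hσ (w.map p).prod = op ((w.map σ).reverse.map p).prod := by
  induction w with
  | nil => simp
  | cons h w ih => simp [ih]

lemma anti_sweedler {a b a' b' : H →ₗ[k] H}
    (ha : ∀ h, σ (a h) = a' (σ h)) (hb : ∀ h, σ (b h) = b' (σ h)) (h : H) :
    hp.anti hσ (sweedler (p ∘ₗ a) (p ∘ₗ b) h) =
      op (sweedler (p ∘ₗ b') (p ∘ₗ a') (σ h)) := by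
  rw [map_sweedler, ← sweedler_op hσ]
  congr 2 <;> ext <;> simp [ha, hb]

lemma anti_eps (h : H) : hp.anti hσ (epsOf p h) = op (epsTildeOf p (σ h)) :=
  hp.anti_sweedler hσ (a := LinearMap.id) (a' := LinearMap.id) (b := antip k H) (fun _ => rfl)
    (fun h => (hσ.antip h).symm) h

lemma anti_epsTilde (h : H) : hp.anti hσ (epsTildeOf p h) = op (epsOf p (σ h)) :=
  hp.anti_sweedler hσ (b := LinearMap.id) (b' := LinearMap.id) (a := antip k H)
    (fun h => (hσ.antip h).symm) (fun _ => rfl) h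

lemma anti_anti {τ : H →ₗ[k] H} (hτ : IsHopfAnti k H τ)
    (h : ∀ g, σ (τ g) = g) (x : P) : unop (hp.anti hσ (unop (hp.anti hτ x))) = x := by
  induction x using hp.induction_mul_left with
  | one => simp
  | add x y hx hy => simp [hx, hy]
  | smul r x hx => simp [hx]
  | mul g x hx => simp [hx, h]

end Anti

end IsParPresentation

/-! ### Convolution modulo a right ideal -/

section Congruence

open WithConv Coalgebra

variable {k : Type*} [CommRing k] {C : Type*} [AddCommGroup C] [Module k C] [Coalgebra k C]
  {R : Type*} [Ring R] [Algebra k R]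

variable (C) in
/-- The maps from a coalgebra that take values in a given submodule. -/
def convMod (M : Submodule k R) : Submodule k (WithConv (C →ₗ[k] R)) where
  carrier := {F | ∀ c, F.ofConv c ∈ M}
  add_mem' hF hG c := M.add_mem (hF c) (hG c)
  zero_mem' _ := M.zero_mem
  smul_mem' r _ hF c := M.smul_mem r (hF c)

/-- The elements `r` with `r M ⊆ M`. When `M` is a right ideal, this is its idealizer. -/
def leftStab (M : Submodule k R) : Subalgebra k R where
  carrier := {r | ∀ m ∈ M, r * m ∈ M}
  mul_mem' hr hs m hm := by
    rw [mul_assoc]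
    exact hr _ (hs m hm)
  add_mem' hr hs m hm := by
    rw [add_mul]
    exact M.add_mem (hr m hm) (hs m hm)
  algebraMap_mem' c m hm := by
    rw [← Algebra.smul_def]
    exact M.smul_mem c hm

variable {M : Submodule k R}

omit [Coalgebra k C] in
lemma convMod_smodEq_iff {F G : WithConv (C →ₗ[k] R)} :
    F ≡ G [SMOD convMod C M] ↔ ∀ c, F.ofConv c ≡ G.ofConv c [SMOD M] := by
  simp only [SModEq.sub_mem]
  rfl

lemma SModEq.conv_mul_right (hM : ∀ m ∈ M, ∀ r, m * r ∈ M) {F G : WithConv (C →ₗ[k] R)}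
    (h : F ≡ G [SMOD convMod C M]) (K : WithConv (C →ₗ[k] R)) :
    F * K ≡ G * K [SMOD convMod C M] := by
  rw [SModEq.sub_mem] at h ⊢
  intro c
  rw [← sub_mul, (ℛ k c).convMul_apply]
  exact M.sum_mem fun i _ => hM _ (h _) _

/-- A congruence may be multiplied on the left by maps with values in the stabilizer. -/
lemma SModEq.conv_mul_left {K : WithConv (C →ₗ[k] R)} (hK : ∀ c, K.ofConv c ∈ leftStab M)
    {F G : WithConv (C →ₗ[k] R)} (h : F ≡ G [SMOD convMod C M]) :
    K * F ≡ K * G [SMOD convMod C M] := by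
  rw [SModEq.sub_mem] at h ⊢
  intro c
  rw [← mul_sub, (ℛ k c).convMul_apply]
  exact M.sum_mem fun i _ => hK _ _ (h _)

end Congruence

/-! ### The diagonal map into the Takeuchi product -/

section Diagonal

open WithConv Coalgebra

variable {k : Type*} [CommRing k] {H : Type*} [Ring H] [HopfAlgebra k H]
  {P : Type*} [Ring P] [Algebra k P]

/-- The subalgebra generated by the elements `∑ p(h₍₁₎) p(S(h₍₂₎))`. -/
def baseOf (p : H →ₗ[k] P) : Subalgebra k P := Algebra.adjoin k (Set.range (epsOf p))

/-- The subalgebra generated by the elements `∑ p(S(h₍₁₎)) p(h₍₂₎)`. -/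
def baseTildeOf (p : H →ₗ[k] P) : Subalgebra k P := Algebra.adjoin k (Set.range (epsTildeOf p))

lemma eps_mem (p : H →ₗ[k] P) (h : H) : epsOf p h ∈ baseOf p := Algebra.subset_adjoin ⟨h, rfl⟩

lemma epsTilde_mem (p : H →ₗ[k] P) (h : H) : epsTildeOf p h ∈ baseTildeOf p :=
  Algebra.subset_adjoin ⟨h, rfl⟩

variable (k P) in
/-- `x ↦ x ⊗ 1` -/
abbrev inl : P →ₐ[k] P ⊗[k] P := Algebra.TensorProduct.includeLeft

variable (k P) in
/-- `y ↦ 1 ⊗ y` -/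
abbrev inr : P →ₐ[k] P ⊗[k] P := Algebra.TensorProduct.includeRight

lemma inl_comm_inr (x y : P) : inl k P x * inr k P y = inr k P y * inl k P x := by simp

/-- `h ↦ ∑ p(h₍₁₎) ⊗ p(h₍₂₎)` -/
def diag (p : H →ₗ[k] P) : H →ₗ[k] P ⊗[k] P := TensorProduct.map p p ∘ₗ comul

lemma toConv_map_comul (f g : H →ₗ[k] P) : toConv (TensorProduct.map f g ∘ₗ comul) =
    convPost (inl k P).toLinearMap (toConv f) * convPost (inr k P).toLinearMap (toConv g) := by
  ext h
  rw [(ℛ k h).convMul_apply]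
  simp only [LinearMap.comp_apply]
  rw [← (ℛ k h).eq]
  simp

/-- The legs appear in reverse order because the antipode reverses coproducts. -/
lemma toConv_map_comul_antip (f g : H →ₗ[k] P) :
    toConv (TensorProduct.map f g ∘ₗ comul ∘ₗ antip k H) =
      convPost (inr k P).toLinearMap (toConv (g ∘ₗ antip k H)) *
        convPost (inl k P).toLinearMap (toConv (f ∘ₗ antip k H)) := by
  ext h
  rw [(ℛ k h).convMul_apply]
  simp only [LinearMap.comp_apply]
  rw [comul_antip, ← (ℛ k h).eq]
  simp

lemma toConv_diag (p : H →ₗ[k] P) : toConv (diag p) =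
    convPost (inl k P).toLinearMap (toConv p) * convPost (inr k P).toLinearMap (toConv p) :=
  toConv_map_comul p p

lemma toConv_diag_antip (p : H →ₗ[k] P) : toConv (diag p ∘ₗ antip k H) =
    convPost (inr k P).toLinearMap (toConv (p ∘ₗ antip k H)) *
      convPost (inl k P).toLinearMap (toConv (p ∘ₗ antip k H)) :=
  toConv_map_comul_antip p p

section TargetMaps

variable (S' : P →ₐ[k] Pᵐᵒᵖ) (B : Subalgebra k P)

/-- The anti-morphism `b ↦ S'(b)` on a subalgebra. -/
def targetOf : Bᵐᵒᵖ →ₐ[k] P := AlgHom.opComm (S'.comp B.val)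

@[simp] lemma targetOf_op (b : B) : targetOf S' B (op b) = unop (S' b) := rfl

/-- The relations of the tensor product over `B` for the bimodule structure
`a ▷ h ◁ b = a S'(b) h`. -/
abbrev leftRel : Submodule k (P ⊗[k] P) :=
  balRel k (mulLeftTarget (targetOf S' B)) (mulLeftSource B.val)

lemma leftRel_mul_mem (m : P ⊗[k] P) (hm : m ∈ leftRel S' B) (r : P ⊗[k] P) :
    m * r ∈ leftRel S' B := by
  induction hm using Submodule.span_induction with
  | zero => simp
  | add x y _ _ hx hy => rw [add_mul]; exact Submodule.add_mem _ hx hy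
  | smul c x _ hx => rw [smul_mul_assoc]; exact Submodule.smul_mem _ _ hx
  | mem x hx =>
    obtain ⟨a, x, y, rfl⟩ := hx
    induction r with
    | zero => simp
    | add r r' hr hr' => rw [mul_add]; exact Submodule.add_mem _ hr hr'
    | tmul p q =>
      refine Submodule.subset_span ⟨a, x * p, y * q, ?_⟩
      simp [mulLeftTarget, mulLeftSource, sub_mul, mul_assoc]

variable {S' B} in
lemma smodEq_mul_right {x y : P ⊗[k] P} (e : x ≡ y [SMOD leftRel S' B]) (r : P ⊗[k] P) :
    x * r ≡ y * r [SMOD leftRel S' B] := by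
  rw [SModEq.sub_mem, ← sub_mul]
  exact leftRel_mul_mem _ _ _ (SModEq.sub_mem.1 e) r

variable {B} in
/-- `(S'(a) ⊗ 1) r = (1 ⊗ a) r` in the tensor product over `B`. -/
lemma inl_smodEq_inr {a : P} (ha : a ∈ B) (r : P ⊗[k] P) :
    inl k P (unop (S' a)) * r ≡ inr k P a * r [SMOD leftRel S' B] := by
  refine smodEq_mul_right (SModEq.sub_mem.2 (Submodule.subset_span ⟨⟨a, ha⟩, 1, 1, ?_⟩)) r
  simp [mulLeftTarget, mulLeftSource]

end TargetMaps

end Diagonal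

namespace IsParPresentation

section Relations

open WithConv Coalgebra

variable {k : Type*} [CommRing k] {H : Type*} [Ring H] [HopfAlgebra k H]
  {P : Type*} [Ring P] [Algebra k P] {p : H →ₗ[k] P} (hp : IsParPresentation p)
  (hS : Function.Bijective (antip k H))

/-- The anti-endomorphism induced by the antipode. -/
abbrev antiS : P →ₐ[k] Pᵐᵒᵖ := hp.anti (isHopfAnti_antip k H)

/-- The anti-endomorphism induced by the inverse of the antipode. -/
abbrev antiInv : P →ₐ[k] Pᵐᵒᵖ := hp.anti (isHopfAnti_antipInv hS)

lemma antiS_antiInv (x : P) : unop (hp.antiS (unop (hp.antiInv hS x))) = x :=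
  hp.anti_anti (isHopfAnti_antip k H) (isHopfAnti_antipInv hS) (antip_antipInv hS) x

lemma antiInv_antiS (x : P) : unop (hp.antiInv hS (unop (hp.antiS x))) = x :=
  hp.anti_anti (isHopfAnti_antipInv hS) (isHopfAnti_antip k H) (antipInv_antip hS) x

/-- The relations of `H_par ⊗_A H_par`. -/
abbrev relA : Submodule k (P ⊗[k] P) := leftRel (hp.antiInv hS) (baseOf p)

/-- `S'(ε_{h₍₂₎ S(g)}) [h₍₁₎] = [h] ε̃_g` -/
lemma sum_antiInv_eps (h g : H) : ∑ i ∈ (ℛ k h).index,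
    unop (hp.antiInv hS (epsOf p ((ℛ k h).right i * antip k H g))) * p ((ℛ k h).left i) =
      p h * epsTildeOf p g := by
  have e := congrArg (hp.antiInv hS) (hp.toIsPartialRep.eps_mul_map_antip (antip k H g) h)
  rw [sweedler_eq_conv, (ℛ k h).convMul_apply, map_sum] at e
  have e' := congrArg unop e.symm
  simpa [hp.anti_eps] using e'

/-- `∑ [h₍₁₎] ⊗ ε_{h₍₂₎ S(g)} = [h] ε̃_g ⊗ 1` in `H_par ⊗_A H_par`. -/
lemma map_tmul_eps_smodEq (g : H) :
    convPost (inl k P).toLinearMap (toConv p) *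
        convPost (inr k P).toLinearMap (toConv (epsOf p ∘ₗ LinearMap.mulRight k (antip k H g))) ≡
      convPost (inl k P).toLinearMap (toConv p) * convConst (inl k P (epsTildeOf p g))
        [SMOD convMod H (hp.relA hS)] := by
  rw [convMod_smodEq_iff]
  intro h
  rw [mul_convConst_apply, convPost_apply]
  simp only [AlgHom.toLinearMap_apply]
  rw [← map_mul, ← hp.sum_antiInv_eps hS, map_sum, (ℛ k h).convMul_apply]
  refine SModEq.sum fun i _ => ?_
  simp only [convPost_apply, AlgHom.toLinearMap_apply, map_mul]
  refine SModEq.trans ?_ (inl_smodEq_inr _ (eps_mem p _) _).symm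
  rw [inl_comm_inr]
  rfl

/-- `∑ [h₍₁₎] ⊗ ε_{h₍₂₎} = [h] ⊗ 1` in `H_par ⊗_A H_par`. -/
lemma map_tmul_eps_one_smodEq :
    convPost (inl k P).toLinearMap (toConv p) * convPost (inr k P).toLinearMap (toConv (epsOf p)) ≡
      convPost (inl k P).toLinearMap (toConv p) [SMOD convMod H (hp.relA hS)] := by
  have e := hp.map_tmul_eps_smodEq hS 1
  have e₁ : epsTildeOf p (1 : H) = 1 := by
    simp [epsTildeOf, sweedler, hp.map_one, Algebra.TensorProduct.one_def]
  have e₂ : epsOf p ∘ₗ LinearMap.mulRight k (antip k H 1) = epsOf p := by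
    ext
    simp
  rwa [e₁, e₂, map_one, convConst_one, mul_one] at e

/-- `∑ ε̃_{h₍₂₎} ⊗ [S(h₍₁₎)] = 1 ⊗ [S(h)]` in `H_par ⊗_A H_par`. -/
lemma epsTilde_tmul_map_smodEq :
    convPost (inr k P).toLinearMap (toConv (p ∘ₗ antip k H)) *
        convPost (inl k P).toLinearMap (toConv (epsTildeOf p)) ≡
      convPost (inr k P).toLinearMap (toConv (p ∘ₗ antip k H))
        [SMOD convMod H (hp.relA hS)] := by
  rw [convMod_smodEq_iff]
  intro h
  have e : ∑ i ∈ (ℛ k h).index, epsOf p (antip k H ((ℛ k h).right i)) *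
      p (antip k H ((ℛ k h).left i)) = p (antip k H h) := by
    have e := congrArg (fun F => hp.antiS (F.ofConv h))
      (hp.toIsPartialRep.convHom_mul_inv_mul (CoalgHom.id k H))
    simp only [mul_assoc] at e
    rw [(ℛ k h).convMul_apply, map_sum] at e
    have e' := congrArg unop e
    have e₁ (g : H) : (convPost p (convHomInv (CoalgHom.id k H)) *
      convPost p (convHom (CoalgHom.id k H))).ofConv g = epsTildeOf p g := rfl
    have e₂ (g : H) : (convPost p (convHom (CoalgHom.id k H))).ofConv g = p g := rfl
    simpa [e₁, e₂, hp.anti_epsTilde] using e'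
  rw [(ℛ k h).convMul_apply, convPost_apply]
  simp only [convPost_apply, AlgHom.toLinearMap_apply, LinearMap.comp_apply]
  rw [← e, map_sum]
  refine SModEq.sum fun i _ => ?_
  rw [map_mul, ← inl_comm_inr]
  refine SModEq.trans ?_ (inl_smodEq_inr _ (eps_mem p _) _)
  simp [hp.anti_eps]

/-- The Takeuchi condition: `∑ [h₍₁₎] S'(a) ⊗ [h₍₂₎] = ∑ [h₍₁₎] ⊗ [h₍₂₎] a` in `H_par ⊗_A H_par`. -/
lemma diag_mul_smodEq {a : P} (ha : a ∈ baseOf p) (h : H) :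
    diag p h * inl k P (unop (hp.antiInv hS a)) ≡ diag p h * inr k P a [SMOD hp.relA hS] := by
  induction ha using Algebra.adjoin_induction with
  | mem x hx =>
    obtain ⟨g, rfl⟩ := hx
    obtain ⟨g, rfl⟩ := hS.2 g
    have e : toConv (diag p) * convConst (inl k P (epsTildeOf p g)) ≡
        toConv (diag p) * convConst (inr k P (epsOf p (antip k H g)))
        [SMOD convMod H (hp.relA hS)] := by
      have e₁ := (hp.map_tmul_eps_smodEq hS g).symm.conv_mul_right (leftRel_mul_mem _ _)
        (convPost (inr k P).toLinearMap (toConv p))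
      rw [mul_assoc, convConst_commute (fun c => inl_comm_inr _ _), ← mul_assoc,
        ← toConv_diag, mul_assoc, ← convPost_mul] at e₁
      refine e₁.trans (Eq.subst (motive := fun z => _ ≡ z [SMOD _]) ?_ SModEq.rfl)
      rw [toConv_diag, mul_assoc]
      have e₂ : toConv (epsOf p ∘ₗ LinearMap.mulRight k (antip k H g)) * toConv p =
          toConv p * convConst (epsOf p (antip k H g)) := by
        ext h
        rw [mul_convConst_apply]
        exact (hp.toIsPartialRep.map_mul_eps_eq h (antip k H g)).symm
      rw [e₂, convPost_mul, convPost_convConst]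
      rfl
    have := convMod_smodEq_iff.1 e h
    rw [mul_convConst_apply, mul_convConst_apply] at this
    simpa [hp.anti_eps] using this
  | algebraMap r => simp [Algebra.algebraMap_eq_smul_one]
  | add x y _ _ hx hy =>
    rw [map_add, unop_add, map_add, map_add, mul_add, mul_add]
    exact hx.add hy
  | mul x y _ _ hx hy =>
    rw [map_mul, unop_mul, map_mul, map_mul, ← mul_assoc, ← mul_assoc]
    refine (smodEq_mul_right hy _).trans ?_
    rw [mul_assoc, ← inl_comm_inr, ← mul_assoc]
    exact smodEq_mul_right hx _

/-- Left multiplication by `∑ [h₍₁₎] ⊗ [h₍₂₎]` is well defined on `H_par ⊗_A H_par`. -/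
lemma diag_mem_leftStab (h : H) : diag p h ∈ leftStab (hp.relA hS) := by
  intro m hm
  induction hm using Submodule.span_induction with
  | zero => simp
  | add x y _ _ hx hy => rw [mul_add]; exact Submodule.add_mem _ hx hy
  | smul c x _ hx => rw [mul_smul_comm]; exact Submodule.smul_mem _ _ hx
  | mem x hx =>
    obtain ⟨a, x, y, rfl⟩ := hx
    have e := smodEq_mul_right (hp.diag_mul_smodEq hS a.2 h) (x ⊗ₜ[k] y)
    rw [SModEq.sub_mem, mul_assoc, mul_assoc, ← mul_sub] at e
    simpa [mulLeftTarget, mulLeftSource] using e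

end Relations

end IsParPresentation

/-! ### The relations of the partial Hopf algebra for the diagonal map -/

section CommuteVariables

open WithConv Coalgebra

variable {k : Type*} [CommRing k] {H : Type*} [Ring H] [HopfAlgebra k H]
  {R : Type*} [Ring R] [Algebra k R]

/-- Maps of two independent variables commute for convolution if their values commute. -/
lemma fst_mul_snd_comm {f g : H →ₗ[k] R} (hfg : ∀ a b, f a * g b = g b * f a) :
    toConv (f ∘ₗ (coalgFst k H).toLinearMap) * toConv (g ∘ₗ (coalgSnd k H).toLinearMap) =
      toConv (g ∘ₗ (coalgSnd k H).toLinearMap) * toConv (f ∘ₗ (coalgFst k H).toLinearMap) := by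
  refine congrArg toConv (TensorProduct.ext' fun a b => ?_)
  refine (mul_snd_tmul_apply _ g a b).trans (Eq.trans ?_ (snd_mul_tmul_apply _ g a b).symm)
  have e : (toConv (f ∘ₗ (coalgFst k H).toLinearMap)).ofConv ∘ₗ TensorProduct.mk k H H a =
      (convConst (f a)).ofConv := by
    ext b
    simp [convConst]
  rw [e]
  refine (convConst_mul_apply (f a) (toConv g) b).trans ?_
  exact (hfg a b).trans (mul_convConst_apply (f a) (toConv g) b).symm

end CommuteVariables

namespace IsParPresentation

section DiagonalRelations

open WithConv Coalgebra

variable {k : Type*} [CommRing k] {H : Type*} [Ring H] [HopfAlgebra k H]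
  {P : Type*} [Ring P] [Algebra k P] {p : H →ₗ[k] P} (hp : IsParPresentation p)
  (hS : Function.Bijective (antip k H))
  {C : Type*} [AddCommGroup C] [Module k C] [Coalgebra k C] (x : C →ₗc[k] H)

/-- `∑ [h₍₁₎] ⊗ ε_{h₍₂₎} = [h] ⊗ 1`, for `h = x(c)`. -/
lemma convHom_eps_smodEq :
    convPost (inl k P).toLinearMap (convPost p (convHom x)) *
        convPost (inr k P).toLinearMap (convPost p (convHom x) * convPost p (convHomInv x)) ≡
      convPost (inl k P).toLinearMap (convPost p (convHom x))
        [SMOD convMod C (hp.relA hS)] := by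
  have e := convMod_smodEq_iff.1 (hp.map_tmul_eps_one_smodEq hS)
  rw [convMod_smodEq_iff]
  intro c
  refine Eq.subst (motive := fun z => z ≡ _ [SMOD _]) ?_ (e (x c))
  have e₁ : convPost p (convHom x) * convPost p (convHomInv x) =
      toConv (epsOf p ∘ₗ x.toLinearMap) :=
    (toConv_comp_mul x p (p ∘ₗ antip k H)).symm
  rw [e₁]
  exact congrArg (fun F => F.ofConv c) (toConv_comp_mul x ((inl k P).toLinearMap ∘ₗ p)
    ((inr k P).toLinearMap ∘ₗ epsOf p))

/-- `∑ ε̃_{h₍₂₎} ⊗ [S(h₍₁₎)] = 1 ⊗ [S(h)]`, for `h = x(c)`. -/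
lemma convHomInv_epsTilde_smodEq :
    convPost (inr k P).toLinearMap (convPost p (convHomInv x)) *
        convPost (inl k P).toLinearMap (convPost p (convHomInv x) * convPost p (convHom x)) ≡
      convPost (inr k P).toLinearMap (convPost p (convHomInv x))
        [SMOD convMod C (hp.relA hS)] := by
  have e := convMod_smodEq_iff.1 (hp.epsTilde_tmul_map_smodEq hS)
  rw [convMod_smodEq_iff]
  intro c
  refine Eq.subst (motive := fun z => z ≡ _ [SMOD _]) ?_ (e (x c))
  have e₁ : convPost p (convHomInv x) * convPost p (convHom x) =
      toConv (epsTildeOf p ∘ₗ x.toLinearMap) :=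
    (toConv_comp_mul x (p ∘ₗ antip k H) p).symm
  rw [e₁]
  exact congrArg (fun F => F.ofConv c) (toConv_comp_mul x
    ((inr k P).toLinearMap ∘ₗ p ∘ₗ antip k H) ((inl k P).toLinearMap ∘ₗ epsTildeOf p))

lemma toConv_diag_comp : toConv (diag p ∘ₗ x.toLinearMap) =
    convPost (inl k P).toLinearMap (convPost p (convHom x)) *
      convPost (inr k P).toLinearMap (convPost p (convHom x)) :=
  (congrArg (fun F => toConv (F.ofConv ∘ₗ x.toLinearMap)) (toConv_diag p)).trans
    (toConv_comp_mul x ((inl k P).toLinearMap ∘ₗ p) ((inr k P).toLinearMap ∘ₗ p))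

lemma toConv_diag_antip_comp : toConv (diag p ∘ₗ antip k H ∘ₗ x.toLinearMap) =
    convPost (inr k P).toLinearMap (convPost p (convHomInv x)) *
      convPost (inl k P).toLinearMap (convPost p (convHomInv x)) :=
  (congrArg (fun F => toConv (F.ofConv ∘ₗ x.toLinearMap)) (toConv_diag_antip p)).trans
    (toConv_comp_mul x ((inr k P).toLinearMap ∘ₗ p ∘ₗ antip k H)
      ((inl k P).toLinearMap ∘ₗ p ∘ₗ antip k H))

/-- `∑ [h₍₁₎][S(h₍₄₎)] ⊗ [h₍₂₎][S(h₍₃₎)] = ε_h ⊗ 1` -/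
lemma diag_eps_smodEq :
    toConv (diag p ∘ₗ x.toLinearMap) * toConv (diag p ∘ₗ antip k H ∘ₗ x.toLinearMap) ≡
      convPost (inl k P).toLinearMap (convPost p (convHom x) * convPost p (convHomInv x))
        [SMOD convMod C (hp.relA hS)] := by
  have e := (hp.convHom_eps_smodEq hS x).conv_mul_right (leftRel_mul_mem _ _)
    (convPost (inl k P).toLinearMap (convPost p (convHomInv x)))
  rw [convPost_mul, ← convPost_mul (inl k P)] at e
  rw [toConv_diag_comp, toConv_diag_antip_comp]
  simpa only [mul_assoc] using e

/-- `∑ [S(h₍₂₎)][h₍₃₎] ⊗ [S(h₍₁₎)][h₍₄₎] = 1 ⊗ ε̃_h` -/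
lemma diag_epsTilde_smodEq :
    toConv (diag p ∘ₗ antip k H ∘ₗ x.toLinearMap) * toConv (diag p ∘ₗ x.toLinearMap) ≡
      convPost (inr k P).toLinearMap (convPost p (convHomInv x) * convPost p (convHom x))
        [SMOD convMod C (hp.relA hS)] := by
  have e := (hp.convHomInv_epsTilde_smodEq hS x).conv_mul_right (leftRel_mul_mem _ _)
    (convPost (inr k P).toLinearMap (convPost p (convHom x)))
  rw [convPost_mul, ← convPost_mul (inr k P)] at e
  rw [toConv_diag_comp, toConv_diag_antip_comp]
  simpa only [mul_assoc] using e

/-- The relation `[h] [g₍₁₎] [S(g₍₂₎)] = [h g₍₁₎] [S(g₍₂₎)]` for the diagonal map. Both sides are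
`∑ [h₍₁₎ g₍₁₎] [S(g₍₂₎)] ⊗ [h₍₂₎]` modulo the relations of `H_par ⊗_A H_par`. -/
lemma diag_mul_eps_smodEq (h g : H) :
    diag p h * sweedler (diag p) (diag p ∘ₗ antip k H) g ≡
      sweedler (diag p ∘ₗ LinearMap.mulLeft k h) (diag p ∘ₗ antip k H) g
        [SMOD hp.relA hS] := by
  set x := coalgFst k H
  set y := coalgSnd k H
  set m := Bialgebra.mulCoalgHom k H
  have hm : convHom m = convHom x * convHom y := convHom_mulCoalgHom
  have key : toConv (diag p ∘ₗ x.toLinearMap) * (toConv (diag p ∘ₗ y.toLinearMap) *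
        toConv (diag p ∘ₗ antip k H ∘ₗ y.toLinearMap)) ≡
      toConv (diag p ∘ₗ m.toLinearMap) * toConv (diag p ∘ₗ antip k H ∘ₗ y.toLinearMap)
        [SMOD convMod (H ⊗[k] H) (hp.relA hS)] := by
    have l := (hp.diag_eps_smodEq hS y).conv_mul_left (K := toConv (diag p ∘ₗ x.toLinearMap))
      (fun c => hp.diag_mem_leftStab hS _)
    have r := (hp.convHom_eps_smodEq hS m).conv_mul_right (leftRel_mul_mem _ _)
      (convPost (inr k P).toLinearMap (convPost p (convHom x)) *
        convPost (inl k P).toLinearMap (convPost p (convHomInv y)))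
    have c₁ : convPost (inr k P).toLinearMap (convPost p (convHom x)) *
        convPost (inl k P).toLinearMap (convPost p (convHomInv y)) =
        convPost (inl k P).toLinearMap (convPost p (convHomInv y)) *
          convPost (inr k P).toLinearMap (convPost p (convHom x)) :=
      fst_mul_snd_comm (f := (inr k P).toLinearMap ∘ₗ p)
        (g := (inl k P).toLinearMap ∘ₗ p ∘ₗ antip k H) (fun a b => (inl_comm_inr _ _).symm)
    have c₂ : convPost (inr k P).toLinearMap (convPost p (convHom x)) *
        convPost (inl k P).toLinearMap (convPost p (convHom y)) =
        convPost (inl k P).toLinearMap (convPost p (convHom y)) *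
          convPost (inr k P).toLinearMap (convPost p (convHom x)) :=
      fst_mul_snd_comm (f := (inr k P).toLinearMap ∘ₗ p)
        (g := (inl k P).toLinearMap ∘ₗ p) (fun a b => (inl_comm_inr _ _).symm)
    have f₁ : convPost p (convHom x) * (convPost p (convHom y) * convPost p (convHomInv y)) =
        convPost p (convHom m) * convPost p (convHomInv y) := by
      rw [hp.convPost_mul_eps, hm]
    have f₂ := hp.convHom_mul_eps_of_mul hm
    rw [f₁] at f₂
    have e₁ := congrArg (convPost (inl k P).toLinearMap) f₁
    have e₂ := congrArg (convPost (inr k P).toLinearMap) f₂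
    simp only [convPost_mul] at e₁ e₂ l r
    rw [toConv_diag_comp x, toConv_diag_comp y, toConv_diag_comp m, toConv_diag_antip_comp]
    rw [toConv_diag_comp x, toConv_diag_comp y, toConv_diag_antip_comp] at l
    have l' : convPost (inl k P).toLinearMap (convPost p (convHom x)) *
          convPost (inr k P).toLinearMap (convPost p (convHom x)) *
          (convPost (inl k P).toLinearMap (convPost p (convHom y)) *
            convPost (inl k P).toLinearMap (convPost p (convHomInv y))) =
        convPost (inl k P).toLinearMap (convPost p (convHom m)) *
          (convPost (inr k P).toLinearMap (convPost p (convHom x)) *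
            convPost (inl k P).toLinearMap (convPost p (convHomInv y))) := by
      rw [c₁, ← mul_assoc (convPost (inl k P).toLinearMap (convPost p (convHom m))), ← e₁,
        mul_assoc, ← mul_assoc (convPost (inr k P).toLinearMap (convPost p (convHom x))), c₂,
        mul_assoc, c₁]
      simp only [mul_assoc]
    have r' : convPost (inl k P).toLinearMap (convPost p (convHom m)) *
          convPost (inr k P).toLinearMap (convPost p (convHom m)) *
          (convPost (inr k P).toLinearMap (convPost p (convHomInv y)) *
            convPost (inl k P).toLinearMap (convPost p (convHomInv y))) =
        convPost (inl k P).toLinearMap (convPost p (convHom m)) *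
          (convPost (inr k P).toLinearMap (convPost p (convHom m)) *
            convPost (inr k P).toLinearMap (convPost p (convHomInv m))) *
          (convPost (inr k P).toLinearMap (convPost p (convHom x)) *
            convPost (inl k P).toLinearMap (convPost p (convHomInv y))) := by
      rw [mul_assoc, ← mul_assoc (convPost (inr k P).toLinearMap (convPost p (convHom m))), e₂]
      simp only [mul_assoc]
    rw [r']
    rw [l'] at l
    exact l.trans r.symm
  have key' := convMod_smodEq_iff.1 key (h ⊗ₜ[k] g)
  have d₁ : toConv (diag p ∘ₗ y.toLinearMap) * toConv (diag p ∘ₗ antip k H ∘ₗ y.toLinearMap) =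
      toConv (sweedler (diag p) (diag p ∘ₗ antip k H) ∘ₗ y.toLinearMap) :=
    (toConv_comp_mul y (diag p) (diag p ∘ₗ antip k H)).symm
  have d₂ : toConv ((diag p ∘ₗ x.toLinearMap) ∘ₗ TensorProduct.mk k H H h) =
      convConst (diag p h) := by
    ext g : 2
    simp [convConst, x]
  have d₃ : (diag p ∘ₗ m.toLinearMap) ∘ₗ TensorProduct.mk k H H h =
      diag p ∘ₗ LinearMap.mulLeft k h := by
    ext g
    simp [m]
  rw [d₁] at key'
  have a₁ := (mul_snd_tmul_apply (toConv (diag p ∘ₗ x.toLinearMap))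
    (sweedler (diag p) (diag p ∘ₗ antip k H)) h g)
  have a₂ := (mul_snd_tmul_apply (toConv (diag p ∘ₗ m.toLinearMap))
    (diag p ∘ₗ antip k H) h g)
  rw [ofConv_toConv, d₂, convConst_mul_apply] at a₁
  rw [ofConv_toConv, d₃] at a₂
  exact Eq.subst (motive := fun z => z ≡ _ [SMOD _]) a₁
    (Eq.subst (motive := fun z => _ ≡ z [SMOD _]) a₂ key')

/-- A congruence of convolutions that involves right multiplication by `w ∈ H ⊗ H` need only be
checked for pure tensors. -/
lemma mul_convConst_smodEq_of_tmul {M : Submodule k (P ⊗[k] P)} (T : H →ₗ[k] H ⊗[k] H)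
    {F G : WithConv (H →ₗ[k] P ⊗[k] P)}
    (e : ∀ y v : H, F * convConst (p y ⊗ₜ p v) ≡
      G * toConv (TensorProduct.map (p ∘ₗ LinearMap.mulRight k y)
        (p ∘ₗ LinearMap.mulRight k v) ∘ₗ T)
        [SMOD convMod H M]) (w : H ⊗[k] H) :
    F * convConst (TensorProduct.map p p w) ≡
      G * toConv (TensorProduct.map p p ∘ₗ LinearMap.mulRight k w ∘ₗ T) [SMOD convMod H M] := by
  induction w with
  | zero =>
    have e₁ : (convConst (TensorProduct.map p p 0) : WithConv (H →ₗ[k] P ⊗[k] P)) = 0 := by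
      ext
      simp [convConst]
    have e₂ : toConv (TensorProduct.map p p ∘ₗ LinearMap.mulRight k (0 : H ⊗[k] H) ∘ₗ T) = 0 := by
      ext
      simp
    rw [e₁, e₂, mul_zero, mul_zero]
  | add w w' hw hw' =>
    have e₁ : (convConst (TensorProduct.map p p (w + w')) : WithConv (H →ₗ[k] P ⊗[k] P)) =
        convConst (TensorProduct.map p p w) + convConst (TensorProduct.map p p w') := by
      ext
      simp [convConst]
    have e₂ : toConv (TensorProduct.map p p ∘ₗ LinearMap.mulRight k (w + w') ∘ₗ T) =
        toConv (TensorProduct.map p p ∘ₗ LinearMap.mulRight k w ∘ₗ T) +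
        toConv (TensorProduct.map p p ∘ₗ LinearMap.mulRight k w' ∘ₗ T) := by
      ext
      simp [mul_add]
    rw [e₁, e₂, mul_add, mul_add]
    exact hw.add hw'
  | tmul y v =>
    have e₁ : TensorProduct.map p p ∘ₗ LinearMap.mulRight k (y ⊗ₜ[k] v) =
        TensorProduct.map (p ∘ₗ LinearMap.mulRight k y) (p ∘ₗ LinearMap.mulRight k v) := by
      ext
      simp
    rw [← LinearMap.comp_assoc, e₁, TensorProduct.map_tmul]
    exact e y v

lemma convConst_tmul (y v : P) : (convConst (y ⊗ₜ v) : WithConv (C →ₗ[k] P ⊗[k] P)) =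
    convPost (inl k P).toLinearMap (convConst y) *
      convPost (inr k P).toLinearMap (convConst v) := by
  rw [convPost_convConst, convPost_convConst, ← convConst_mul]
  simp

lemma inl_convConst_comm (y : P) (F : WithConv (C →ₗ[k] P)) :
    convPost (inl k P).toLinearMap (convConst y) * convPost (inr k P).toLinearMap F =
      convPost (inr k P).toLinearMap F * convPost (inl k P).toLinearMap (convConst y) := by
  rw [convPost_convConst]
  exact convConst_commute fun c => inl_comm_inr _ _

lemma inr_convConst_comm (y : P) (F : WithConv (C →ₗ[k] P)) :
    convPost (inr k P).toLinearMap (convConst y) * convPost (inl k P).toLinearMap F =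
      convPost (inl k P).toLinearMap F * convPost (inr k P).toLinearMap (convConst y) := by
  rw [convPost_convConst]
  exact convConst_commute fun c => (inl_comm_inr _ _).symm

/-- The relation `[h₍₁₎] [S(h₍₂₎)] [g] = [h₍₁₎] [S(h₍₂₎) g]` for the diagonal map. It is linear in
`∑ g₍₁₎ ⊗ g₍₂₎`, and for a pure tensor `y ⊗ v` in place of this sum both sides are
`ε_h [y] ⊗ [v]`. -/
lemma diag_eps_mul_smodEq (h g : H) :
    sweedler (diag p) (diag p ∘ₗ antip k H) h * diag p g ≡
      sweedler (diag p) (diag p ∘ₗ LinearMap.mulRight k g ∘ₗ antip k H) h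
        [SMOD hp.relA hS] := by
  have key (y v : H) : toConv (diag p) * toConv (diag p ∘ₗ antip k H) *
        convConst (p y ⊗ₜ p v) ≡
      toConv (diag p) * toConv (TensorProduct.map (p ∘ₗ LinearMap.mulRight k y)
        (p ∘ₗ LinearMap.mulRight k v) ∘ₗ comul ∘ₗ antip k H)
        [SMOD convMod H (hp.relA hS)] := by
    have f (v : H) : convPost p (convHom (.id k H)) * convPost p (convHomInv (.id k H)) *
        convConst (p v) =
        convPost p (convHom (.id k H)) * toConv (p ∘ₗ LinearMap.mulRight k v ∘ₗ antip k H) := by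
      rw [← convPost_convConst, hp.eps_mul_convPost]
      congr 2
      ext h
      exact mul_convConst_apply _ _ _
    have l := (hp.diag_eps_smodEq hS (.id k H)).conv_mul_right (leftRel_mul_mem _ _)
      (convConst (p y ⊗ₜ p v))
    have r := (hp.convHom_eps_smodEq hS (.id k H)).conv_mul_right (leftRel_mul_mem _ _)
      (convPost (inl k P).toLinearMap (toConv (p ∘ₗ LinearMap.mulRight k y ∘ₗ antip k H)) *
        convPost (inr k P).toLinearMap (convConst (p v)))
    refine l.trans (Eq.subst (motive := fun z => z ≡ _ [SMOD _]) ?_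
      (r.symm.trans (Eq.subst (motive := fun z => _ ≡ z [SMOD _]) ?_ SModEq.rfl)))
    · rw [convConst_tmul, ← mul_assoc, ← mul_assoc, ← convPost_mul, ← convPost_mul, ← f]
    · rw [← inr_convConst_comm, mul_assoc, ← mul_assoc (convPost (inr k P).toLinearMap _),
        ← convPost_mul, f, convPost_mul, ← mul_assoc, ← mul_assoc, ← toConv_diag_comp, mul_assoc,
        toConv_map_comul_antip]
      rfl
  have e := convMod_smodEq_iff.1 (mul_convConst_smodEq_of_tmul _ key (comul g)) h
  rw [mul_convConst_apply] at e
  have e₁ : TensorProduct.map p p ∘ₗ LinearMap.mulRight k (comul g) ∘ₗ comul ∘ₗ antip k H =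
      diag p ∘ₗ LinearMap.mulRight k g ∘ₗ antip k H := by
    ext
    simp [diag]
  rw [e₁] at e
  exact e

/-- The relation `[S(h₍₁₎)] [h₍₂₎] [g] = [S(h₍₁₎)] [h₍₂₎ g]` for the diagonal map. It is linear in
`∑ g₍₁₎ ⊗ g₍₂₎`, and for a pure tensor `y ⊗ v` in place of this sum both sides are
`[y] ⊗ ε̃_h [v]`. -/
lemma diag_epsTilde_mul_smodEq (h g : H) :
    sweedler (diag p ∘ₗ antip k H) (diag p) h * diag p g ≡
      sweedler (diag p ∘ₗ antip k H) (diag p ∘ₗ LinearMap.mulRight k g) h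
        [SMOD hp.relA hS] := by
  have key (y v : H) : toConv (diag p ∘ₗ antip k H) * toConv (diag p) *
        convConst (p y ⊗ₜ p v) ≡
      toConv (diag p ∘ₗ antip k H) * toConv (TensorProduct.map (p ∘ₗ LinearMap.mulRight k y)
        (p ∘ₗ LinearMap.mulRight k v) ∘ₗ comul)
        [SMOD convMod H (hp.relA hS)] := by
    have f (v : H) : convPost p (convHomInv (.id k H)) * convPost p (convHom (.id k H)) *
        convConst (p v) =
        convPost p (convHomInv (.id k H)) * toConv (p ∘ₗ LinearMap.mulRight k v) := by
      rw [← convPost_convConst, hp.epsTilde_mul_convPost]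
      congr 2
      ext h
      exact mul_convConst_apply _ _ _
    have l := (hp.diag_epsTilde_smodEq hS (.id k H)).conv_mul_right (leftRel_mul_mem _ _)
      (convConst (p y ⊗ₜ p v))
    have r := (hp.convHomInv_epsTilde_smodEq hS (.id k H)).conv_mul_right (leftRel_mul_mem _ _)
      (convPost (inr k P).toLinearMap (toConv (p ∘ₗ LinearMap.mulRight k v)) *
        convPost (inl k P).toLinearMap (convConst (p y)))
    refine l.trans (Eq.subst (motive := fun z => z ≡ _ [SMOD _]) ?_
      (r.symm.trans (Eq.subst (motive := fun z => _ ≡ z [SMOD _]) ?_ SModEq.rfl)))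
    · rw [convConst_tmul, inl_convConst_comm, ← mul_assoc, ← mul_assoc, ← convPost_mul,
        ← convPost_mul, ← f]
    · rw [← inl_convConst_comm, mul_assoc, ← mul_assoc (convPost (inl k P).toLinearMap _),
        ← convPost_mul, f, convPost_mul, ← mul_assoc, ← mul_assoc, ← toConv_diag_antip_comp,
        mul_assoc, toConv_map_comul]
      rfl
  have e := convMod_smodEq_iff.1 (mul_convConst_smodEq_of_tmul _ key (comul g)) h
  rw [mul_convConst_apply] at e
  have e₁ : TensorProduct.map p p ∘ₗ LinearMap.mulRight k (comul g) ∘ₗ comul =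
      diag p ∘ₗ LinearMap.mulRight k g := by
    ext
    simp [diag]
  rw [e₁] at e
  exact e

include hp in
/-- For `w = ∑ y ⊗ v`, the sum `∑ [y S(g₍₂₎)] [g₍₃₎] ⊗ [v S(g₍₁₎)] [g₍₄₎]` equals
`∑ [y] ε̃_{g₍₂₎} ⊗ [v S(g₍₁₎)] [g₍₃₎]`. -/
lemma toConv_map_mulLeft_antip_mul_diag (w : H ⊗[k] H) :
    toConv (TensorProduct.map p p ∘ₗ LinearMap.mulLeft k w ∘ₗ comul ∘ₗ antip k H) *
        toConv (diag p) =
      toConv (TensorProduct.map p p ∘ₗ LinearMap.mulLeft k w ∘ₗ (inr k H).toLinearMap ∘ₗ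
          antip k H) *
        (convPost (inl k P).toLinearMap
          (convPost p (convHomInv (.id k H)) * convPost p (convHom (.id k H))) *
          convPost (inr k P).toLinearMap (toConv p)) := by
  induction w with
  | zero =>
    have e (T : H →ₗ[k] H ⊗[k] H) :
        toConv (TensorProduct.map p p ∘ₗ LinearMap.mulLeft k (0 : H ⊗[k] H) ∘ₗ T) = 0 := by
      ext
      simp
    rw [e, e, zero_mul, zero_mul]
  | add w w' hw hw' =>
    have e (T : H →ₗ[k] H ⊗[k] H) :
        toConv (TensorProduct.map p p ∘ₗ LinearMap.mulLeft k (w + w') ∘ₗ T) =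
        toConv (TensorProduct.map p p ∘ₗ LinearMap.mulLeft k w ∘ₗ T) +
        toConv (TensorProduct.map p p ∘ₗ LinearMap.mulLeft k w' ∘ₗ T) := by
      ext
      simp [add_mul]
    rw [e, e, add_mul, add_mul, hw, hw']
  | tmul y v =>
    have e₁ : TensorProduct.map p p ∘ₗ LinearMap.mulLeft k (y ⊗ₜ[k] v) =
        TensorProduct.map (p ∘ₗ LinearMap.mulLeft k y) (p ∘ₗ LinearMap.mulLeft k v) := by
      ext
      simp
    have e₂ : toConv (TensorProduct.map p p ∘ₗ LinearMap.mulLeft k (y ⊗ₜ[k] v) ∘ₗ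
          (inr k H).toLinearMap ∘ₗ antip k H) =
        convPost (inr k P).toLinearMap (toConv (p ∘ₗ LinearMap.mulLeft k v ∘ₗ antip k H)) *
          convPost (inl k P).toLinearMap (convConst (p y)) := by
      ext h
      rw [convPost_convConst, mul_convConst_apply]
      simp
    have f : toConv (p ∘ₗ LinearMap.mulLeft k y ∘ₗ antip k H) * convPost p (convHom (.id k H)) =
        convConst (p y) *
          (convPost p (convHomInv (.id k H)) * convPost p (convHom (.id k H))) := by
      rw [← convPost_convConst, hp.convPost_mul_epsTilde]
      congr 2
      ext h
      exact congrArg p (convConst_mul_apply y (convHomInv (CoalgHom.id k H)) h).symm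
    have f' := congrArg (convPost (inl k P).toLinearMap) f
    rw [convPost_mul, convPost_mul (inl k P) (convConst (p y))] at f'
    rw [e₂, ← LinearMap.comp_assoc, e₁, toConv_map_comul_antip, toConv_diag, mul_assoc, mul_assoc,
      ← mul_assoc (convPost (inl k P).toLinearMap (convConst (p y))), ← f', ← mul_assoc _ _
      (convPost (inr k P).toLinearMap (toConv p))]
    rfl

/-- `∑ [h₍₁₎] ⊗ [h₍₂₎ g] = ∑ [h₍₁₎] ⊗ [h₍₂₎] [g]` in `H_par ⊗_A H_par`. -/
lemma map_comul_mul_inr_smodEq (h g : H) :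
    TensorProduct.map p p (comul h * inr k H g) ≡ diag p h * inr k P (p g) [SMOD hp.relA hS] := by
  have e := (hp.convHom_eps_smodEq hS (.id k H)).conv_mul_right (leftRel_mul_mem _ _)
    (convPost (inr k P).toLinearMap (toConv (p ∘ₗ LinearMap.mulRight k g)))
  have f : convPost p (convHom (.id k H)) * convConst (p g) =
      convPost p (convHom (.id k H)) * convPost p (convHomInv (.id k H)) *
        toConv (p ∘ₗ LinearMap.mulRight k g) := by
    rw [← convPost_convConst, hp.convHom_mul_convPost]
    congr 2
    ext h
    exact mul_convConst_apply _ _ _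
  rw [mul_assoc, ← convPost_mul, ← f, convPost_mul, ← mul_assoc, ← toConv_diag_comp] at e
  have e' := convMod_smodEq_iff.1 e.symm h
  rw [convPost_convConst, mul_convConst_apply] at e'
  refine Eq.subst (motive := fun z => z ≡ _ [SMOD _]) ?_ e'
  refine (congrArg (fun F => F.ofConv h)
    (toConv_map_comul p (p ∘ₗ LinearMap.mulRight k g))).symm.trans ?_
  have e₁ : TensorProduct.map p (p ∘ₗ LinearMap.mulRight k g) =
      TensorProduct.map p p ∘ₗ LinearMap.mulRight k (inr k H g) := by
    ext
    simp
  rw [e₁]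
  rfl

/-- The relation `[h] [S(g₍₁₎)] [g₍₂₎] = [h S(g₍₁₎)] [g₍₂₎]` for the diagonal map. The two sides
agree with `∑ [h₍₁₎] ⊗ [h₍₂₎] ε̃_g`. -/
lemma diag_mul_epsTilde_smodEq (h g : H) :
    diag p h * sweedler (diag p ∘ₗ antip k H) (diag p) g ≡
      sweedler (diag p ∘ₗ LinearMap.mulLeft k h ∘ₗ antip k H) (diag p) g
        [SMOD hp.relA hS] := by
  have e : toConv (TensorProduct.map p p ∘ₗ LinearMap.mulLeft k (comul h) ∘ₗ
      (inr k H).toLinearMap ∘ₗ antip k H) ≡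
      convConst (diag p h) * convPost (inr k P).toLinearMap (convPost p (convHomInv (.id k H)))
      [SMOD convMod H (hp.relA hS)] := by
    rw [convMod_smodEq_iff]
    intro g
    rw [convConst_mul_apply]
    exact hp.map_comul_mul_inr_smodEq hS h (antip k H g)
  have e₁ := e.conv_mul_right (leftRel_mul_mem _ _) (convPost (inl k P).toLinearMap
    (convPost p (convHomInv (.id k H)) * convPost p (convHom (.id k H))) *
      convPost (inr k P).toLinearMap (toConv p))
  have hst : ∀ c, (convConst (diag p h) : WithConv (H →ₗ[k] P ⊗[k] P)).ofConv c ∈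
      leftStab (hp.relA hS) := fun c => (leftStab _).smul_mem (hp.diag_mem_leftStab hS h) _
  have e₂ := ((hp.convHomInv_epsTilde_smodEq hS (.id k H)).conv_mul_right (leftRel_mul_mem _ _)
    (convPost (inr k P).toLinearMap (toConv p))).conv_mul_left hst
  have e₃ := (hp.diag_epsTilde_smodEq hS (.id k H)).conv_mul_left hst
  rw [convPost_mul] at e₃
  rw [← hp.toConv_map_mulLeft_antip_mul_diag, mul_assoc,
    ← mul_assoc (convPost (inr k P).toLinearMap _)] at e₁
  have e₄ := convMod_smodEq_iff.1 (e₁.trans (e₂.trans e₃.symm)) g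
  rw [convConst_mul_apply] at e₄
  have e₅ : TensorProduct.map p p ∘ₗ LinearMap.mulLeft k (comul h) ∘ₗ comul ∘ₗ antip k H =
      diag p ∘ₗ LinearMap.mulLeft k h ∘ₗ antip k H := by
    ext
    simp [diag]
  rw [e₅] at e₄
  exact e₄.symm

lemma diag_one (h : p 1 = 1) : diag p 1 = 1 := by
  simp [diag, Algebra.TensorProduct.one_def, h]

end DiagonalRelations

end IsParPresentation

/-! ### The left comultiplication -/

namespace IsParPresentation

variable {k : Type*} [CommRing k] {H : Type*} [Ring H] [HopfAlgebra k H]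
  {P : Type*} [Ring P] [Algebra k P] {p : H →ₗ[k] P} (hp : IsParPresentation p)
  (hS : Function.Bijective (antip k H))

/-- A linear map on the tensor algebra that vanishes on the relations between the products
`[h¹] ⋯ [hⁿ]` descends to the partial Hopf algebra. -/
def descend {M : Type*} [AddCommGroup M] [Module k M] (f : TensorAlgebra k H →ₗ[k] M)
    (hf : ∀ z, TensorAlgebra.lift k p z = 0 → f z = 0) : P →ₗ[k] M :=
  (LinearMap.ker (TensorAlgebra.lift k p).toLinearMap).liftQ f (fun z hz => hf z hz) ∘ₗ
    ((TensorAlgebra.lift k p).toLinearMap.quotKerEquivOfSurjective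
      hp.lift_surjective).symm.toLinearMap

@[simp] lemma descend_lift {M : Type*} [AddCommGroup M] [Module k M]
    (f : TensorAlgebra k H →ₗ[k] M) (hf : ∀ z, TensorAlgebra.lift k p z = 0 → f z = 0)
    (z : TensorAlgebra k H) : hp.descend f hf (TensorAlgebra.lift k p z) = f z := by
  have e : ((TensorAlgebra.lift k p).toLinearMap.quotKerEquivOfSurjective
      hp.lift_surjective).symm (TensorAlgebra.lift k p z) = Submodule.Quotient.mk z := by
    rw [LinearEquiv.symm_apply_eq]
    rfl
  exact (congrArg ((LinearMap.ker (TensorAlgebra.lift k p).toLinearMap).liftQ f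
    fun z hz => hf z hz) e).trans rfl

variable (p) in
/-- The diagonal map `h¹ ⊗ ⋯ ⊗ hⁿ ↦ ∑ [h¹₍₁₎] ⋯ [hⁿ₍₁₎] ⊗ [h¹₍₂₎] ⋯ [hⁿ₍₂₎]`. -/
abbrev diagLift : TensorAlgebra k H →ₐ[k] P ⊗[k] P := TensorAlgebra.lift k (diag p)

lemma diagLift_rel {x y : TensorAlgebra k H} (h : HparRel k H x y) :
    diagLift p x ≡ diagLift p y [SMOD hp.relA hS] := by
  induction h with
  | one =>
    rw [TensorAlgebra.lift_ι_apply, diag_one hp.map_one, map_one]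
  | mul_eps h g =>
    have e₁ := lift_sweedler (diag p) LinearMap.id (antip k H) g
    have e₂ := lift_sweedler (diag p) (LinearMap.mulLeft k h) (antip k H) g
    rw [LinearMap.comp_id, LinearMap.comp_id] at e₁
    rw [map_mul, TensorAlgebra.lift_ι_apply, e₁, e₂]
    exact hp.diag_mul_eps_smodEq hS h g
  | eps_mul h g =>
    have e₁ := lift_sweedler (diag p) LinearMap.id (antip k H) h
    have e₂ := lift_sweedler (diag p) LinearMap.id (LinearMap.mulRight k g ∘ₗ antip k H) h
    rw [LinearMap.comp_id, LinearMap.comp_id] at e₁ e₂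
    rw [map_mul, TensorAlgebra.lift_ι_apply, e₁, e₂]
    exact hp.diag_eps_mul_smodEq hS h g
  | mul_eps' h g =>
    have e₁ := lift_sweedler (diag p) (antip k H) LinearMap.id g
    have e₂ := lift_sweedler (diag p) (LinearMap.mulLeft k h ∘ₗ antip k H) LinearMap.id g
    rw [LinearMap.comp_id, LinearMap.comp_id] at e₁ e₂
    rw [map_mul, TensorAlgebra.lift_ι_apply, e₁, e₂]
    exact hp.diag_mul_epsTilde_smodEq hS h g
  | eps_mul' h g =>
    have e₁ := lift_sweedler (diag p) (antip k H) LinearMap.id h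
    have e₂ := lift_sweedler (diag p) (antip k H) (LinearMap.mulRight k g) h
    rw [LinearMap.comp_id, LinearMap.comp_id] at e₁
    rw [map_mul, TensorAlgebra.lift_ι_apply, e₁, e₂]
    exact hp.diag_epsTilde_mul_smodEq hS h g

lemma diagLift_mem_leftStab (z : TensorAlgebra k H) : diagLift p z ∈ leftStab (hp.relA hS) := by
  induction z using TensorAlgebra.induction_mul_left with
  | one => rw [map_one]; exact one_mem _
  | add x y hx hy => rw [map_add]; exact add_mem hx hy
  | smul r x hx => rw [map_smul]; exact (leftStab _).smul_mem hx r
  | mul h x hx =>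
    rw [map_mul, TensorAlgebra.lift_ι_apply]
    exact mul_mem (hp.diag_mem_leftStab hS h) hx

/-- The left comultiplication is well defined. -/
lemma diagLift_mem_relA {z : TensorAlgebra k H} (hz : TensorAlgebra.lift k p z = 0) :
    diagLift p z ∈ hp.relA hS := by
  refine hp.mem_of_lift_eq_zero ((hp.relA hS).comap (diagLift p).toLinearMap)
    (fun x y hxy a b => ?_) z hz
  rw [Submodule.mem_comap, AlgHom.toLinearMap_apply, map_mul, map_mul, map_sub]
  exact leftRel_mul_mem _ _ _ (hp.diagLift_mem_leftStab hS a _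
    (SModEq.sub_mem.1 (hp.diagLift_rel hS hxy))) _

/-- The target map of the left bialgebroid. -/
abbrev tA : (baseOf p)ᵐᵒᵖ →ₐ[k] P := targetOf (hp.antiInv hS) (baseOf p)

/-- The left comultiplication `[h¹] ⋯ [hⁿ] ↦ ∑ [h¹₍₁₎] ⋯ [hⁿ₍₁₎] ⊗ [h¹₍₂₎] ⋯ [hⁿ₍₂₎]`. -/
def comulL : P →ₗ[k] LeftTensor (baseOf p).val (hp.tA hS) :=
  hp.descend (leftMk (baseOf p).val (hp.tA hS) ∘ₗ (diagLift p).toLinearMap)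
    fun _ hz => (Submodule.Quotient.mk_eq_zero _).2 (hp.diagLift_mem_relA hS hz)

lemma comulL_lift (z : TensorAlgebra k H) :
    hp.comulL hS (TensorAlgebra.lift k p z) = leftMk _ _ (diagLift p z) :=
  hp.descend_lift _ _ z

lemma leftMk_eq_iff {x y : P ⊗[k] P} :
    leftMk (baseOf p).val (hp.tA hS) x = leftMk (baseOf p).val (hp.tA hS) y ↔
      x ≡ y [SMOD hp.relA hS] := Iff.rfl

lemma leftMk_eq_comulL_iff {x : P ⊗[k] P} {z : TensorAlgebra k H} :
    leftMk _ _ x = hp.comulL hS (TensorAlgebra.lift k p z) ↔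
      x ≡ diagLift p z [SMOD hp.relA hS] := by
  rw [comulL_lift, leftMk_eq_iff]

/-- Representatives of `Δ_l(h)` act on `H_par ⊗_A H_par` from the left. -/
lemma mem_leftStab_of_leftMk {z : P ⊗[k] P} {h : P} (hz : leftMk _ _ z = hp.comulL hS h) :
    z ∈ leftStab (hp.relA hS) := by
  obtain ⟨w, rfl⟩ := hp.lift_surjective h
  have e := SModEq.sub_mem.1 ((hp.leftMk_eq_comulL_iff hS).1 hz)
  have : z = (z - diagLift p w) + diagLift p w := by abel
  rw [this]
  exact (leftStab _).add_mem (fun m _ => leftRel_mul_mem _ _ _ e m)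
    (hp.diagLift_mem_leftStab hS w)

/-- The left comultiplication is multiplicative for all choices of representatives. -/
lemma comulL_mul {g h : P} {y z : P ⊗[k] P} (hy : leftMk _ _ y = hp.comulL hS g)
    (hz : leftMk _ _ z = hp.comulL hS h) : hp.comulL hS (g * h) = leftMk _ _ (y * z) := by
  obtain ⟨v, rfl⟩ := hp.lift_surjective g
  obtain ⟨w, rfl⟩ := hp.lift_surjective h
  rw [← map_mul, eq_comm, leftMk_eq_comulL_iff, map_mul]
  rw [leftMk_eq_comulL_iff] at hy hz
  refine (smodEq_mul_right hy z).trans ?_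
  rw [SModEq.sub_mem, ← mul_sub]
  exact hp.diagLift_mem_leftStab hS v _ (SModEq.sub_mem.1 hz)

lemma comulL_one : hp.comulL hS 1 = leftMk _ _ 1 := by
  rw [← map_one (TensorAlgebra.lift k p), comulL_lift, map_one]

lemma comulL_map (h : H) : hp.comulL hS (p h) = leftMk _ _ (diag p h) := by
  rw [← TensorAlgebra.lift_ι_apply (R := k) p h, comulL_lift, TensorAlgebra.lift_ι_apply]

lemma comulL_takeuchi {z : P ⊗[k] P} {h : P} (hz : leftMk _ _ z = hp.comulL hS h)
    (a : baseOf p) :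
    leftMk (baseOf p).val (hp.tA hS) (z * (hp.tA hS (op a) ⊗ₜ[k] 1)) =
      leftMk (baseOf p).val (hp.tA hS) (z * (1 ⊗ₜ[k] (a : P))) := by
  rw [leftMk_eq_iff, SModEq.sub_mem, ← mul_sub]
  refine hp.mem_leftStab_of_leftMk hS hz _ ?_
  have := SModEq.sub_mem.1 (inl_smodEq_inr (hp.antiInv hS) a.2 1)
  rwa [mul_one, mul_one] at this

/-- `Δ_l(a) = a ⊗ 1` for `a ∈ A` -/
lemma comulL_of_mem_base {a : P} (ha : a ∈ baseOf p) :
    hp.comulL hS a = leftMk _ _ (inl k P a) := by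
  induction ha using Algebra.adjoin_induction with
  | mem x hx =>
    obtain ⟨h, rfl⟩ := hx
    have e := lift_sweedler (p := p) LinearMap.id (antip k H) h
    have e' := lift_sweedler (diag p) LinearMap.id (antip k H) h
    rw [LinearMap.comp_id, LinearMap.comp_id] at e e'
    refine (congrArg (hp.comulL hS) e.symm).trans ?_
    rw [comulL_lift, e', leftMk_eq_iff]
    exact convMod_smodEq_iff.1 (hp.diag_eps_smodEq hS (.id k H)) h
  | algebraMap r =>
    rw [Algebra.algebraMap_eq_smul_one, map_smul, map_smul, map_smul, comulL_one, map_one (inl k P)]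
  | add x y _ _ hx hy => rw [map_add, map_add, map_add, hx, hy]
  | mul x y _ _ hx hy => rw [hp.comulL_mul hS hx.symm hy.symm, map_mul (inl k P)]

/-- `Δ_l(b) = 1 ⊗ b` for `b ∈ Ã` -/
lemma comulL_of_mem_baseTilde {b : P} (hb : b ∈ baseTildeOf p) :
    hp.comulL hS b = leftMk _ _ (inr k P b) := by
  induction hb using Algebra.adjoin_induction with
  | mem x hx =>
    obtain ⟨h, rfl⟩ := hx
    have e := lift_sweedler (p := p) (antip k H) LinearMap.id h
    have e' := lift_sweedler (diag p) (antip k H) LinearMap.id h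
    rw [LinearMap.comp_id, LinearMap.comp_id] at e e'
    refine (congrArg (hp.comulL hS) e.symm).trans ?_
    rw [comulL_lift, e', leftMk_eq_iff]
    exact convMod_smodEq_iff.1 (hp.diag_epsTilde_smodEq hS (.id k H)) h
  | algebraMap r =>
    rw [Algebra.algebraMap_eq_smul_one, map_smul, map_smul, map_smul, comulL_one, map_one (inr k P)]
  | add x y _ _ hx hy => rw [map_add, map_add, map_add, hx, hy]
  | mul x y _ _ hx hy => rw [hp.comulL_mul hS hx.symm hy.symm, map_mul (inr k P)]

/-! ### The right comultiplication -/

section Flip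

variable (S' : P →ₐ[k] Pᵐᵒᵖ)

/-- `x ⊗ y ↦ S'(y) ⊗ S'(x)` for an anti-endomorphism `S'`. -/
def flipMap : P ⊗[k] P →ₗ[k] P ⊗[k] P :=
  TensorProduct.map ((opLinearEquiv k).symm.toLinearMap ∘ₗ S'.toLinearMap)
    ((opLinearEquiv k).symm.toLinearMap ∘ₗ S'.toLinearMap) ∘ₗ
    (TensorProduct.comm k P P).toLinearMap

@[simp] lemma flipMap_tmul (x y : P) : flipMap S' (x ⊗ₜ y) = unop (S' y) ⊗ₜ unop (S' x) := rfl

lemma flipMap_mul (x y : P ⊗[k] P) : flipMap S' (x * y) = flipMap S' y * flipMap S' x := by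
  induction x with
  | zero => simp
  | add a b ha hb => rw [add_mul, map_add, map_add, mul_add, ha, hb]
  | tmul a b =>
    induction y with
    | zero => simp
    | add c d hc hd => rw [mul_add, map_add, map_add, add_mul, hc, hd]
    | tmul c d => simp

lemma flipMap_flipMap (S T : P →ₐ[k] Pᵐᵒᵖ) (h : ∀ x, unop (S (unop (T x))) = x)
    (x : P ⊗[k] P) : flipMap S (flipMap T x) = x := by
  induction x with
  | zero => simp
  | add a b ha hb => rw [map_add, map_add, ha, hb]
  | tmul a b => simp [h]

end Flip

lemma flipMap_diag {σ : H →ₗ[k] H} (hσ : IsHopfAnti k H σ) (h : H) :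
    flipMap (hp.anti hσ) (diag p h) = diag p (σ h) := by
  simp only [diag, LinearMap.comp_apply]
  rw [hσ.comul]
  induction Coalgebra.comul (R := k) h with
  | zero => simp
  | add a b ha hb => simp [ha, hb]
  | tmul a b => simp

/-- `h¹ ⊗ ⋯ ⊗ hⁿ ↦ σ(hⁿ) ⊗ ⋯ ⊗ σ(h¹)` -/
def tensorAnti (σ : H →ₗ[k] H) : TensorAlgebra k H →ₐ[k] (TensorAlgebra k H)ᵐᵒᵖ :=
  TensorAlgebra.lift k ((opLinearEquiv k).toLinearMap ∘ₗ TensorAlgebra.ι k ∘ₗ σ)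

@[simp] lemma tensorAnti_ι (σ : H →ₗ[k] H) (h : H) :
    tensorAnti σ (TensorAlgebra.ι k h) = op (TensorAlgebra.ι k (σ h)) := by
  simp [tensorAnti]

lemma lift_tensorAnti {σ : H →ₗ[k] H} (hσ : IsHopfAnti k H σ) (z : TensorAlgebra k H) :
    TensorAlgebra.lift k p (unop (tensorAnti σ z)) =
      unop (hp.anti hσ (TensorAlgebra.lift k p z)) := by
  induction z using TensorAlgebra.induction_mul_left with
  | one => simp
  | add x y hx hy => simp [hx, hy]
  | smul r x hx => simp [hx]
  | mul h x hx => simp [hx]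

lemma diagLift_tensorAnti {σ : H →ₗ[k] H} (hσ : IsHopfAnti k H σ) (z : TensorAlgebra k H) :
    diagLift p (unop (tensorAnti σ z)) = flipMap (hp.anti hσ) (diagLift p z) := by
  induction z using TensorAlgebra.induction_mul_left with
  | one => simp [Algebra.TensorProduct.one_def]
  | add x y hx hy => simp [hx, hy]
  | smul r x hx => simp [hx]
  | mul h x hx => simp [hx, flipMap_mul, hp.flipMap_diag]

lemma unop_anti_mem_baseTilde {σ : H →ₗ[k] H} (hσ : IsHopfAnti k H σ) {a : P}
    (ha : a ∈ baseOf p) : unop (hp.anti hσ a) ∈ baseTildeOf p := by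
  induction ha using Algebra.adjoin_induction with
  | mem x hx =>
    obtain ⟨h, rfl⟩ := hx
    rw [hp.anti_eps]
    exact epsTilde_mem _ _
  | algebraMap r =>
    rw [AlgHom.commutes]
    exact (baseTildeOf p).algebraMap_mem r
  | add x y _ _ hx hy => rw [map_add, unop_add]; exact add_mem hx hy
  | mul x y _ _ hx hy => rw [map_mul, unop_mul]; exact mul_mem hy hx

lemma unop_anti_mem_base {σ : H →ₗ[k] H} (hσ : IsHopfAnti k H σ) {b : P}
    (hb : b ∈ baseTildeOf p) : unop (hp.anti hσ b) ∈ baseOf p := by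
  induction hb using Algebra.adjoin_induction with
  | mem x hx =>
    obtain ⟨h, rfl⟩ := hx
    rw [hp.anti_epsTilde]
    exact eps_mem _ _
  | algebraMap r =>
    rw [AlgHom.commutes]
    exact (baseOf p).algebraMap_mem r
  | add x y _ _ hx hy => rw [map_add, unop_add]; exact add_mem hx hy
  | mul x y _ _ hx hy => rw [map_mul, unop_mul]; exact mul_mem hy hx

/-- The target map of the right bialgebroid. -/
abbrev tB : (baseTildeOf p)ᵐᵒᵖ →ₐ[k] P := targetOf (hp.antiInv hS) (baseTildeOf p)

/-- The relations of `H_par ⊗_Ã H_par`. -/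
abbrev relB : Submodule k (P ⊗[k] P) :=
  balRel k (mulRightSource (baseTildeOf p).val) (mulRightTarget (hp.tB hS))

lemma flipMap_antiS_mem {m : P ⊗[k] P} (hm : m ∈ hp.relA hS) :
    flipMap hp.antiS m ∈ hp.relB hS := by
  induction hm using Submodule.span_induction with
  | zero => simp
  | add x y _ _ hx hy => rw [map_add]; exact Submodule.add_mem _ hx hy
  | smul c x _ hx => rw [map_smul]; exact Submodule.smul_mem _ _ hx
  | mem x hx =>
    obtain ⟨a, x, y, rfl⟩ := hx
    refine (Submodule.neg_mem_iff _).1 (Submodule.subset_span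
      ⟨⟨_, hp.unop_anti_mem_baseTilde (isHopfAnti_antip k H) a.2⟩,
        unop (hp.antiS y), unop (hp.antiS x), ?_⟩)
    have e₁ := hp.antiInv_antiS hS a
    have e₂ := hp.antiS_antiInv hS a
    simp [mulLeftTarget, mulLeftSource, mulRightSource, mulRightTarget, e₁, e₂]

lemma flipMap_antiInv_mem {m : P ⊗[k] P} (hm : m ∈ hp.relB hS) :
    flipMap (hp.antiInv hS) m ∈ hp.relA hS := by
  induction hm using Submodule.span_induction with
  | zero => simp
  | add x y _ _ hx hy => rw [map_add]; exact Submodule.add_mem _ hx hy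
  | smul c x _ hx => rw [map_smul]; exact Submodule.smul_mem _ _ hx
  | mem x hx =>
    obtain ⟨b, x, y, rfl⟩ := hx
    refine (Submodule.neg_mem_iff _).1 (Submodule.subset_span
      ⟨⟨_, hp.unop_anti_mem_base (isHopfAnti_antipInv hS) b.2⟩,
        unop (hp.antiInv hS y), unop (hp.antiInv hS x), ?_⟩)
    simp [mulLeftTarget, mulLeftSource, mulRightSource, mulRightTarget]

/-- The flip `x ⊗ y ↦ S⁻¹(y) ⊗ S⁻¹(x)` identifies `H_par ⊗_Ã H_par` with `H_par ⊗_A H_par`. -/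
lemma flipMap_antiInv_mem_iff {m : P ⊗[k] P} :
    flipMap (hp.antiInv hS) m ∈ hp.relA hS ↔ m ∈ hp.relB hS := by
  refine ⟨fun h => ?_, hp.flipMap_antiInv_mem hS⟩
  have e := hp.flipMap_antiS_mem hS h
  rwa [flipMap_flipMap _ _ (hp.antiS_antiInv hS)] at e

/-- The right comultiplication `[h¹] ⋯ [hⁿ] ↦ ∑ [h¹₍₁₎] ⋯ [hⁿ₍₁₎] ⊗ [h¹₍₂₎] ⋯ [hⁿ₍₂₎]`. -/
def comulR : P →ₗ[k] RightTensor (baseTildeOf p).val (hp.tB hS) :=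
  hp.descend (rightMk (baseTildeOf p).val (hp.tB hS) ∘ₗ (diagLift p).toLinearMap)
    fun z hz => (Submodule.Quotient.mk_eq_zero _).2 <| by
      refine (hp.flipMap_antiInv_mem_iff hS).1 ?_
      rw [AlgHom.toLinearMap_apply, ← hp.diagLift_tensorAnti]
      refine hp.diagLift_mem_relA hS ?_
      rw [hp.lift_tensorAnti (isHopfAnti_antipInv hS), hz]
      simp

lemma comulR_lift (z : TensorAlgebra k H) :
    hp.comulR hS (TensorAlgebra.lift k p z) = rightMk _ _ (diagLift p z) :=
  hp.descend_lift _ _ z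

lemma rightMk_eq_iff {x y : P ⊗[k] P} :
    rightMk (baseTildeOf p).val (hp.tB hS) x = rightMk (baseTildeOf p).val (hp.tB hS) y ↔
      leftMk (baseOf p).val (hp.tA hS) (flipMap (hp.antiInv hS) x) =
        leftMk (baseOf p).val (hp.tA hS) (flipMap (hp.antiInv hS) y) := by
  rw [leftMk_eq_iff, SModEq.sub_mem, ← map_sub, hp.flipMap_antiInv_mem_iff hS, ← SModEq.sub_mem]
  exact Iff.rfl

/-- The anti-automorphism `S⁻¹` exchanges the two comultiplications. -/
lemma rightMk_eq_comulR_iff {x : P ⊗[k] P} {h : P} :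
    rightMk _ _ x = hp.comulR hS h ↔
      leftMk _ _ (flipMap (hp.antiInv hS) x) = hp.comulL hS (unop (hp.antiInv hS h)) := by
  obtain ⟨w, rfl⟩ := hp.lift_surjective h
  rw [comulR_lift, rightMk_eq_iff, ← hp.lift_tensorAnti (isHopfAnti_antipInv hS), comulL_lift,
    ← hp.diagLift_tensorAnti]

lemma comulR_mul {g h : P} {y z : P ⊗[k] P} (hy : rightMk _ _ y = hp.comulR hS g)
    (hz : rightMk _ _ z = hp.comulR hS h) : hp.comulR hS (g * h) = rightMk _ _ (y * z) := by
  rw [rightMk_eq_comulR_iff] at hy hz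
  rw [eq_comm, rightMk_eq_comulR_iff, flipMap_mul, map_mul (hp.antiInv hS), unop_mul,
    hp.comulL_mul hS hz hy]

lemma comulR_one : hp.comulR hS 1 = rightMk _ _ 1 := by
  rw [← map_one (TensorAlgebra.lift k p), comulR_lift, map_one]

lemma comulR_map (h : H) : hp.comulR hS (p h) = rightMk _ _ (diag p h) := by
  rw [← TensorAlgebra.lift_ι_apply (R := k) p h, comulR_lift, TensorAlgebra.lift_ι_apply]

lemma comulR_takeuchi {z : P ⊗[k] P} {h : P} (hz : rightMk _ _ z = hp.comulR hS h)
    (b : baseTildeOf p) :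
    rightMk (baseTildeOf p).val (hp.tB hS) (((b : P) ⊗ₜ[k] 1) * z) =
      rightMk (baseTildeOf p).val (hp.tB hS) ((1 ⊗ₜ[k] hp.tB hS (op b)) * z) := by
  rw [rightMk_eq_comulR_iff] at hz
  rw [rightMk_eq_iff, flipMap_mul, flipMap_mul]
  have e := hp.comulL_takeuchi hS hz ⟨_, hp.unop_anti_mem_base (isHopfAnti_antipInv hS) b.2⟩
  simpa using e.symm

/-- `Δ_r(a) = a ⊗ 1` for `a ∈ A` -/
lemma comulR_of_mem_base {a : P} (ha : a ∈ baseOf p) :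
    hp.comulR hS a = rightMk _ _ (inl k P a) := by
  rw [eq_comm, rightMk_eq_comulR_iff, hp.comulL_of_mem_baseTilde hS
    (hp.unop_anti_mem_baseTilde (isHopfAnti_antipInv hS) ha)]
  simp

/-- `Δ_r(b) = 1 ⊗ b` for `b ∈ Ã` -/
lemma comulR_of_mem_baseTilde {b : P} (hb : b ∈ baseTildeOf p) :
    hp.comulR hS b = rightMk _ _ (inr k P b) := by
  rw [eq_comm, rightMk_eq_comulR_iff, hp.comulL_of_mem_base hS
    (hp.unop_anti_mem_base (isHopfAnti_antipInv hS) hb)]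
  simp

end IsParPresentation

/-! ### The counits -/

namespace IsParPresentation

open WithConv Coalgebra

variable {k : Type*} [CommRing k] {H : Type*} [Ring H] [HopfAlgebra k H]
  {P : Type*} [Ring P] [Algebra k P] {p : H →ₗ[k] P} (hp : IsParPresentation p)
  (hS : Function.Bijective (antip k H))

/-- `S` as a linear endomorphism. -/
abbrev antiSLin : P →ₗ[k] P := (opLinearEquiv k).symm.toLinearMap ∘ₗ hp.antiS.toLinearMap

/-- `S⁻¹` as a linear endomorphism. -/
abbrev antiInvLin : P →ₗ[k] P :=
  (opLinearEquiv k).symm.toLinearMap ∘ₗ (hp.antiInv hS).toLinearMap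

/-- `x ⊗ y ↦ x S(y)` -/
abbrev mulAntiS : P ⊗[k] P →ₗ[k] P :=
  TensorProduct.lift ((LinearMap.mul k P).compl₂ hp.antiSLin)

/-- `x ⊗ y ↦ S(x) y` -/
abbrev antiSMul : P ⊗[k] P →ₗ[k] P :=
  TensorProduct.lift ((LinearMap.mul k P).comp hp.antiSLin)

lemma mulAntiS_relB {m : P ⊗[k] P} (hm : m ∈ hp.relB hS) : hp.mulAntiS m = 0 := by
  refine LinearMap.mem_ker.1 ((Submodule.span_le (p := LinearMap.ker hp.mulAntiS)).2 ?_ hm)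
  rintro _ ⟨b, x, y, rfl⟩
  have e := hp.antiS_antiInv hS b
  simp [mulRightSource, mulRightTarget, e, mul_assoc]

lemma antiSMul_relA {m : P ⊗[k] P} (hm : m ∈ hp.relA hS) : hp.antiSMul m = 0 := by
  refine LinearMap.mem_ker.1 ((Submodule.span_le (p := LinearMap.ker hp.antiSMul)).2 ?_ hm)
  rintro _ ⟨a, x, y, rfl⟩
  have e := hp.antiS_antiInv hS a
  simp [mulLeftTarget, mulLeftSource, e, mul_assoc]

/-- The left counit, with values in the whole algebra: the product `∑ x₍₁₎ S(x₍₂₎)` over the right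
comultiplication. -/
def counitL : P →ₗ[k] P :=
  (hp.relB hS).liftQ hp.mulAntiS (fun _ hm => hp.mulAntiS_relB hS hm) ∘ₗ hp.comulR hS

/-- The right counit, with values in the whole algebra: the product `∑ S(x₍₁₎) x₍₂₎` over the left
comultiplication. -/
def counitR : P →ₗ[k] P :=
  (hp.relA hS).liftQ hp.antiSMul (fun _ hm => hp.antiSMul_relA hS hm) ∘ₗ hp.comulL hS

lemma mulAntiS_eq_counitL {z : P ⊗[k] P} {h : P} (hz : rightMk _ _ z = hp.comulR hS h) :
    hp.mulAntiS z = hp.counitL hS h := by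
  rw [counitL, LinearMap.comp_apply, ← hz]
  rfl

lemma antiSMul_eq_counitR {z : P ⊗[k] P} {h : P} (hz : leftMk _ _ z = hp.comulL hS h) :
    hp.antiSMul z = hp.counitR hS h := by
  rw [counitR, LinearMap.comp_apply, ← hz]
  rfl

lemma counitL_lift (w : TensorAlgebra k H) :
    hp.counitL hS (TensorAlgebra.lift k p w) = hp.mulAntiS (diagLift p w) :=
  (hp.mulAntiS_eq_counitL hS (hp.comulR_lift hS w).symm).symm

lemma counitL_one : hp.counitL hS 1 = 1 := by
  rw [← hp.mulAntiS_eq_counitL hS (hp.comulR_one hS).symm]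
  simp [Algebra.TensorProduct.one_def]

lemma counitL_base_mul {a : P} (ha : a ∈ baseOf p) (x : P) :
    hp.counitL hS (a * x) = a * hp.counitL hS x := by
  obtain ⟨w, rfl⟩ := hp.lift_surjective x
  rw [← hp.mulAntiS_eq_counitL hS (hp.comulR_mul hS (hp.comulR_of_mem_base hS ha).symm
    (hp.comulR_lift hS w).symm).symm, counitL_lift]
  induction diagLift p w with
  | zero => simp
  | add y z hy hz => rw [mul_add, map_add, map_add, mul_add, hy, hz]
  | tmul y z => simp [mul_assoc]

lemma counitL_baseTilde_mul {b : P} (hb : b ∈ baseTildeOf p) (x : P) :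
    hp.counitL hS (b * x) = hp.counitL hS x * unop (hp.antiS b) := by
  obtain ⟨w, rfl⟩ := hp.lift_surjective x
  rw [← hp.mulAntiS_eq_counitL hS (hp.comulR_mul hS (hp.comulR_of_mem_baseTilde hS hb).symm
    (hp.comulR_lift hS w).symm).symm, counitL_lift]
  induction diagLift p w with
  | zero => simp
  | add y z hy hz => rw [mul_add, map_add, map_add, add_mul, hy, hz]
  | tmul y z => simp [mul_assoc]

lemma counitL_of_mem_base {a : P} (ha : a ∈ baseOf p) : hp.counitL hS a = a := by
  have e := hp.counitL_base_mul hS ha 1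
  rwa [mul_one, counitL_one, mul_one] at e

/-- The adjoint action `h ↦ ∑ [h₍₁₎] r [S(h₍₂₎)]`. -/
def adj (p : H →ₗ[k] P) (r : P) : WithConv (H →ₗ[k] P) :=
  toConv p * convConst r * toConv (p ∘ₗ antip k H)

lemma counitL_map_mul (h : H) (x : P) :
    hp.counitL hS (p h * x) = (adj p (hp.counitL hS x)).ofConv h := by
  obtain ⟨w, rfl⟩ := hp.lift_surjective x
  rw [← hp.mulAntiS_eq_counitL hS (hp.comulR_mul hS (hp.comulR_map hS h).symm
    (hp.comulR_lift hS w).symm).symm, counitL_lift, adj, (ℛ k h).convMul_apply]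
  simp only [mul_convConst_apply]
  have e : diag p h = ∑ i ∈ (ℛ k h).index, p ((ℛ k h).left i) ⊗ₜ p ((ℛ k h).right i) := by
    rw [diag, LinearMap.comp_apply, ← (ℛ k h).eq]
    simp
  rw [e, Finset.sum_mul, map_sum]
  refine Finset.sum_congr rfl fun i _ => ?_
  induction diagLift p w with
  | zero => simp
  | add y z hy hz => rw [mul_add, map_add, map_add, mul_add, add_mul, hy, hz]
  | tmul y z => simp [mul_assoc]

/-- The two base algebras commute with each other. -/
lemma base_comm_baseTilde (hp : IsPartialRep p) {a b : P} (ha : a ∈ baseOf p)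
    (hb : b ∈ baseTildeOf p) : a * b = b * a := by
  have h₁ (g : H) : epsOf p g * b = b * epsOf p g := by
    induction hb using Algebra.adjoin_induction with
    | mem x hx =>
      obtain ⟨h, rfl⟩ := hx
      exact (hp.epsTilde_comm_eps h g).symm
    | algebraMap r => exact (Algebra.commutes r _).symm
    | add x y _ _ hx hy => rw [mul_add, add_mul, hx, hy]
    | mul x y _ _ hx hy => rw [← mul_assoc, hx, mul_assoc, hy, mul_assoc]
  induction ha using Algebra.adjoin_induction with
  | mem x hx =>
    obtain ⟨h, rfl⟩ := hx
    exact h₁ h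
  | algebraMap r => exact Algebra.commutes r _
  | add x y _ _ hx hy => rw [mul_add, add_mul, hx, hy]
  | mul x y _ _ hx hy => rw [mul_assoc, hy, ← mul_assoc, hx, mul_assoc]

section Adjoint

variable {a : P} (ha : a ∈ baseOf p)
include hp ha

lemma convConst_comm_epsTilde : convConst a * (toConv (p ∘ₗ antip k H) * toConv p) =
    toConv (p ∘ₗ antip k H) * toConv p * convConst a :=
  convConst_commute fun c => base_comm_baseTilde hp.toIsPartialRep ha (epsTilde_mem p c)

/-- `∑ [h₍₁₎] a [S(h₍₂₎)] [h₍₃₎] = [h] a` for `a` in the base algebra. -/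
lemma adj_mul : adj p a * toConv p = toConv p * convConst a := by
  have e : toConv p * toConv (p ∘ₗ antip k H) * toConv p = toConv p :=
    hp.toIsPartialRep.convHom_mul_inv_mul (.id k H)
  rw [adj, mul_assoc, mul_assoc, hp.convConst_comm_epsTilde ha, ← mul_assoc, ← mul_assoc, e]

/-- `∑ [S(h₍₁₎)] [h₍₂₎] a [S(h₍₃₎)] = a [S(h)]` for `a` in the base algebra. -/
lemma mul_adj : toConv (p ∘ₗ antip k H) * adj p a =
    convConst a * toConv (p ∘ₗ antip k H) := by
  have e : toConv (p ∘ₗ antip k H) * toConv p * toConv (p ∘ₗ antip k H) =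
      toConv (p ∘ₗ antip k H) := hp.toIsPartialRep.convHomInv_mul_mul (.id k H)
  rw [adj, ← mul_assoc, ← mul_assoc, ← hp.convConst_comm_epsTilde ha, mul_assoc, e]

/-- The adjoint action preserves the base algebra: `∑ [h₍₁₎] ε_g [S(h₍₂₎)] = ∑ ε_{h₍₁₎ g} ε_{h₍₂₎}`,
and the action on a product `a b` is `∑ (h₍₁₎ · a) (h₍₂₎ · b)`. -/
lemma adj_mem (h : H) : (adj p a).ofConv h ∈ baseOf p := by
  induction ha using Algebra.adjoin_induction generalizing h with
  | mem x hx =>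
    obtain ⟨g, rfl⟩ := hx
    have e : toConv p * convConst (epsOf p g) =
        toConv (epsOf p ∘ₗ LinearMap.mulRight k g) * toConv p := by
      ext h
      rw [mul_convConst_apply]
      exact hp.toIsPartialRep.map_mul_eps_eq h g
    rw [adj, e, mul_assoc, (ℛ k h).convMul_apply]
    exact sum_mem fun i _ => mul_mem (eps_mem p _) (eps_mem p _)
  | algebraMap r =>
    have e : adj p (algebraMap k P r) = r • toConv (epsOf p) := by
      have e₁ : (convConst (algebraMap k P r) : WithConv (H →ₗ[k] P)) = r • 1 := by
        rw [← convConst_one]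
        ext h
        simp [convConst, Algebra.algebraMap_eq_smul_one, smul_smul, mul_comm]
      rw [adj, e₁, mul_smul_comm, mul_one, smul_mul_assoc]
      rfl
    rw [e]
    exact (baseOf p).smul_mem (eps_mem p h) r
  | add x y _ _ hx hy =>
    have e : adj p (x + y) = adj p x + adj p y := by
      have e₁ : (convConst (x + y) : WithConv (H →ₗ[k] P)) = convConst x + convConst y := by
        ext h
        simp [convConst]
      rw [adj, e₁, mul_add, add_mul]
      rfl
    rw [e]
    exact add_mem (hx h) (hy h)
  | mul x y hx' hy' hx hy =>
    have e : adj p (x * y) = adj p x * adj p y := by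
      rw [adj, convConst_mul, ← mul_assoc, ← hp.adj_mul hx', adj.eq_1 p y]
      simp only [mul_assoc]
    rw [e, (ℛ k h).convMul_apply]
    exact sum_mem fun i _ => mul_mem (hx _) (hy _)

end Adjoint

lemma counitL_mem (x : P) : hp.counitL hS x ∈ baseOf p := by
  induction x using hp.induction_mul_left with
  | one => rw [counitL_one]; exact one_mem _
  | add x y hx hy => rw [map_add]; exact add_mem hx hy
  | smul r x hx => rw [map_smul]; exact (baseOf p).smul_mem hx r
  | mul h x hx => rw [counitL_map_mul]; exact hp.adj_mem hx h

/-- `ε_l(g x)` depends on `x` only through `ε_l(x)`. -/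
lemma counitL_mul_congr (g : P) {x y : P} (h : hp.counitL hS x = hp.counitL hS y) :
    hp.counitL hS (g * x) = hp.counitL hS (g * y) := by
  induction g using hp.induction_mul_left with
  | one => rwa [one_mul, one_mul]
  | add u v hu hv => rw [add_mul, add_mul, map_add, map_add, hu, hv]
  | smul r u hu => rw [smul_mul_assoc, smul_mul_assoc, map_smul, map_smul, hu]
  | mul u v hv => rw [mul_assoc, mul_assoc, counitL_map_mul, counitL_map_mul, hv]

/-- `ε_l(S'(a)) = a` for `a ∈ A` -/
lemma counitL_target (a : P) (ha : a ∈ baseOf p) :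
    hp.counitL hS (unop (hp.antiInv hS a)) = a := by
  have e := hp.counitL_baseTilde_mul hS
    (hp.unop_anti_mem_baseTilde (isHopfAnti_antipInv hS) ha) 1
  rwa [mul_one, counitL_one, one_mul, antiS_antiInv] at e

/-- `x ⊗ y ↦ ε_l(x) y` -/
abbrev counitLMul : P ⊗[k] P →ₗ[k] P :=
  TensorProduct.lift ((LinearMap.mul k P).comp (hp.counitL hS))

/-- `∑ ε_l(h₍₁₎) h₍₂₎ = h` -/
lemma counitLMul_of_leftMk {z : P ⊗[k] P} {h : P} (hz : leftMk _ _ z = hp.comulL hS h) :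
    hp.counitLMul hS z = h := by
  have hM : hp.relA hS ≤ LinearMap.ker (hp.counitLMul hS) := by
    refine Submodule.span_le.2 ?_
    rintro _ ⟨a, x, y, rfl⟩
    have e := hp.counitL_baseTilde_mul hS
      (hp.unop_anti_mem_baseTilde (isHopfAnti_antipInv hS) a.2) x
    rw [antiS_antiInv] at e
    simp [mulLeftTarget, mulLeftSource, e, mul_assoc]
  -- `∑ ε_l([g₍₁₎] x) [g₍₂₎] y = [g] ε_l(x) y`, by `adj_mul`
  have key (g : H) (r : P ⊗[k] P) :
      hp.counitLMul hS (diag p g * r) = p g * hp.counitLMul hS r := by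
    induction r with
    | zero => simp
    | add y z hy hz => rw [mul_add, map_add, map_add, mul_add, hy, hz]
    | tmul x y =>
      have e : diag p g = ∑ i ∈ (ℛ k g).index, p ((ℛ k g).left i) ⊗ₜ p ((ℛ k g).right i) := by
        rw [diag, LinearMap.comp_apply, ← (ℛ k g).eq]
        simp
      have e₁ := congrArg (fun F => F.ofConv g) (hp.adj_mul (hp.counitL_mem hS x))
      rw [mul_convConst_apply, (ℛ k g).convMul_apply] at e₁
      rw [e, Finset.sum_mul, map_sum]
      simp only [Algebra.TensorProduct.tmul_mul_tmul, TensorProduct.lift.tmul,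
        LinearMap.comp_apply, LinearMap.mul_apply', counitL_map_mul]
      rw [← mul_assoc (p g), ← e₁, Finset.sum_mul]
      simp only [mul_assoc]
  obtain ⟨w, rfl⟩ := hp.lift_surjective h
  have e := SModEq.sub_mem.1 ((hp.leftMk_eq_comulL_iff hS).1 hz)
  have e' := hM e
  rw [LinearMap.mem_ker, map_sub, sub_eq_zero] at e'
  rw [e']
  clear hz e e'
  induction w using TensorAlgebra.induction_mul_left with
  | one => simp [Algebra.TensorProduct.one_def, counitL_one]
  | add x y hx hy => rw [map_add, map_add, map_add, hx, hy]
  | smul r x hx => rw [map_smul, map_smul, map_smul, hx]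
  | mul g x hx =>
    rw [map_mul (diagLift p), map_mul (TensorAlgebra.lift k p), TensorAlgebra.lift_ι_apply,
      TensorAlgebra.lift_ι_apply, key, hx]

/-- `x ⊗ y ↦ S(x) ε_l(y)` -/
abbrev antiSMulCounitL : P ⊗[k] P →ₗ[k] P :=
  TensorProduct.lift ((LinearMap.mul k P).compl₁₂ hp.antiSLin (hp.counitL hS))

/-- `∑ S(h₍₁₎) ε_l(h₍₂₎) = S(h)` -/
lemma antiSMulCounitL_of_leftMk {z : P ⊗[k] P} {h : P} (hz : leftMk _ _ z = hp.comulL hS h) :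
    hp.antiSMulCounitL hS z = unop (hp.antiS h) := by
  have hM : hp.relA hS ≤ LinearMap.ker (hp.antiSMulCounitL hS) := by
    refine Submodule.span_le.2 ?_
    rintro _ ⟨a, x, y, rfl⟩
    have e := hp.antiS_antiInv hS a
    simp [mulLeftTarget, mulLeftSource, e, mul_assoc, hp.counitL_base_mul hS a.2]
  -- `∑ S(x) [S(g₍₁₎)] ε_l([g₍₂₎] y) = S(x) ε_l(y) [S(g)]`, by `mul_adj`
  have key (g : H) (r : P ⊗[k] P) : hp.antiSMulCounitL hS (diag p g * r) =
      hp.antiSMulCounitL hS r * p (antip k H g) := by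
    induction r with
    | zero => simp
    | add y z hy hz => rw [mul_add, map_add, map_add, add_mul, hy, hz]
    | tmul x y =>
      have e : diag p g = ∑ i ∈ (ℛ k g).index, p ((ℛ k g).left i) ⊗ₜ p ((ℛ k g).right i) := by
        rw [diag, LinearMap.comp_apply, ← (ℛ k g).eq]
        simp
      have e₁ := congrArg (fun F => F.ofConv g) (hp.mul_adj (hp.counitL_mem hS y))
      rw [convConst_mul_apply, (ℛ k g).convMul_apply] at e₁
      simp only [LinearMap.comp_apply] at e₁
      rw [e, Finset.sum_mul, map_sum]
      simp only [Algebra.TensorProduct.tmul_mul_tmul, TensorProduct.lift.tmul,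
        LinearMap.compl₁₂_apply, LinearMap.mul_apply', counitL_map_mul]
      simp only [LinearMap.comp_apply, AlgHom.toLinearMap_apply, map_mul]
      simp only [anti_map, LinearEquiv.coe_coe, coe_opLinearEquiv_symm, unop_mul, unop_op]
      simp only [mul_assoc]
      rw [← e₁, Finset.mul_sum]
  obtain ⟨w, rfl⟩ := hp.lift_surjective h
  have e := SModEq.sub_mem.1 ((hp.leftMk_eq_comulL_iff hS).1 hz)
  have e' := hM e
  rw [LinearMap.mem_ker, map_sub, sub_eq_zero] at e'
  rw [e']
  clear hz e e'
  induction w using TensorAlgebra.induction_mul_left with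
  | one => simp [Algebra.TensorProduct.one_def, counitL_one]
  | add x y hx hy => rw [map_add, map_add, map_add, map_add, unop_add, hx, hy]
  | smul r x hx => rw [map_smul, map_smul, map_smul, map_smul, unop_smul, hx]
  | mul g x hx =>
    rw [map_mul (diagLift p), map_mul (TensorAlgebra.lift k p), TensorAlgebra.lift_ι_apply,
      TensorAlgebra.lift_ι_apply, key, hx, map_mul hp.antiS, unop_mul, anti_map, unop_op]

/-- `x ⊗ y ↦ S⁻¹(ε_l(y)) x` -/
abbrev mulCounitL : P ⊗[k] P →ₗ[k] P :=
  TensorProduct.lift ((LinearMap.mul k P).flip.compl₂ (hp.antiInvLin hS ∘ₗ hp.counitL hS))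

/-- `∑ S⁻¹(ε_l(h₍₂₎)) h₍₁₎ = h` -/
lemma mulCounitL_of_leftMk {z : P ⊗[k] P} {h : P} (hz : leftMk _ _ z = hp.comulL hS h) :
    hp.mulCounitL hS z = h := by
  have e (z : P ⊗[k] P) :
      hp.mulCounitL hS z = unop (hp.antiInv hS (hp.antiSMulCounitL hS z)) := by
    induction z with
    | zero => simp
    | add y z hy hz => rw [map_add, map_add, map_add, unop_add, hy, hz]
    | tmul x y => simp [antiInv_antiS]
  rw [e, hp.antiSMulCounitL_of_leftMk hS hz, antiInv_antiS]

end IsParPresentation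

/-! ### The antipode exchanges the two bialgebroids -/

namespace IsParPresentation

open WithConv Coalgebra

variable {k : Type*} [CommRing k] {H : Type*} [Ring H] [HopfAlgebra k H]
  {P : Type*} [Ring P] [Algebra k P] {p : H →ₗ[k] P} (hp : IsParPresentation p)
  (hS : Function.Bijective (antip k H))

include hS in
lemma antiS_injective {x y : P} (h : hp.antiS x = hp.antiS y) : x = y := by
  rw [← hp.antiInv_antiS hS x, h, antiInv_antiS]

lemma flipMap_antiS_mem' {m : P ⊗[k] P} (hm : m ∈ hp.relB hS) :
    flipMap hp.antiS m ∈ hp.relA hS := by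
  induction hm using Submodule.span_induction with
  | zero => simp
  | add x y _ _ hx hy => rw [map_add]; exact Submodule.add_mem _ hx hy
  | smul c x _ hx => rw [map_smul]; exact Submodule.smul_mem _ _ hx
  | mem x hx =>
    obtain ⟨b, x, y, rfl⟩ := hx
    refine (Submodule.neg_mem_iff _).1 (Submodule.subset_span
      ⟨⟨_, hp.unop_anti_mem_base (isHopfAnti_antip k H) b.2⟩,
        unop (hp.antiS y), unop (hp.antiS x), ?_⟩)
    have e₁ := hp.antiInv_antiS hS b
    have e₂ := hp.antiS_antiInv hS b
    simp [mulLeftTarget, mulLeftSource, mulRightSource, mulRightTarget, e₁, e₂]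

/-- The flip by `S` carries representatives of `Δ_r(h)` to representatives of `Δ_l(S(h))`. -/
lemma leftMk_flipMap_antiS {z : P ⊗[k] P} {h : P} (hz : rightMk _ _ z = hp.comulR hS h) :
    leftMk _ _ (flipMap hp.antiS z) = hp.comulL hS (unop (hp.antiS h)) := by
  obtain ⟨w, rfl⟩ := hp.lift_surjective h
  rw [← hp.lift_tensorAnti (isHopfAnti_antip k H), leftMk_eq_comulL_iff,
    hp.diagLift_tensorAnti (isHopfAnti_antip k H),
    SModEq.sub_mem, ← map_sub]
  refine hp.flipMap_antiS_mem' hS ?_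
  rw [comulR_lift] at hz
  exact (Submodule.Quotient.eq _).1 hz

/-- The flip by `S` carries representatives of `Δ_l(h)` to representatives of `Δ_r(S(h))`. -/
lemma rightMk_flipMap_antiS {z : P ⊗[k] P} {h : P} (hz : leftMk _ _ z = hp.comulL hS h) :
    rightMk _ _ (flipMap hp.antiS z) = hp.comulR hS (unop (hp.antiS h)) := by
  rw [rightMk_eq_comulR_iff, flipMap_flipMap _ _ (hp.antiInv_antiS hS), antiInv_antiS, hz]

/-- `S ∘ ε_r = ε_l ∘ S` -/
lemma antiS_counitR (h : P) :
    unop (hp.antiS (hp.counitR hS h)) = hp.counitL hS (unop (hp.antiS h)) := by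
  obtain ⟨z, hz⟩ := Submodule.mkQ_surjective _ (hp.comulL hS h)
  rw [← hp.antiSMul_eq_counitR hS hz,
    ← hp.mulAntiS_eq_counitL hS (hp.rightMk_flipMap_antiS hS hz)]
  clear hz
  induction z with
  | zero => simp
  | add x y hx hy => rw [map_add, map_add, map_add, map_add, unop_add, hx, hy]
  | tmul x y => simp

lemma counitR_eq (h : P) : hp.counitR hS h =
    unop (hp.antiInv hS (hp.counitL hS (unop (hp.antiS h)))) := by
  rw [← antiS_counitR, antiInv_antiS]

lemma counitR_mem (h : P) : hp.counitR hS h ∈ baseTildeOf p := by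
  rw [counitR_eq]
  exact hp.unop_anti_mem_baseTilde _ (hp.counitL_mem hS _)

lemma counitR_one : hp.counitR hS 1 = 1 := by
  simp [counitR_eq, counitL_one]

lemma counitR_mul_baseTilde {b : P} (hb : b ∈ baseTildeOf p) (x : P) :
    hp.counitR hS (x * b) = hp.counitR hS x * b := by
  rw [counitR_eq, counitR_eq, map_mul, unop_mul,
    hp.counitL_base_mul hS (hp.unop_anti_mem_base _ hb), map_mul, unop_mul, antiInv_antiS]

lemma counitR_mul_base {a : P} (ha : a ∈ baseOf p) (x : P) :
    hp.counitR hS (x * a) = unop (hp.antiS a) * hp.counitR hS x := by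
  rw [counitR_eq, counitR_eq, map_mul, unop_mul,
    hp.counitL_baseTilde_mul hS (hp.unop_anti_mem_baseTilde _ ha), map_mul, unop_mul,
    antiInv_antiS]

lemma counitR_of_mem_baseTilde {b : P} (hb : b ∈ baseTildeOf p) : hp.counitR hS b = b := by
  have e := hp.counitR_mul_baseTilde hS hb 1
  rwa [one_mul, counitR_one, one_mul] at e

lemma counitR_of_mem_base {a : P} (ha : a ∈ baseOf p) :
    hp.counitR hS a = unop (hp.antiS a) := by
  have e := hp.counitR_mul_base hS ha 1
  rwa [one_mul, counitR_one, mul_one] at e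

/-- `ε_r(x g)` depends on `x` only through `ε_r(x)`. -/
lemma counitR_mul_congr (g : P) {x y : P} (h : hp.counitR hS x = hp.counitR hS y) :
    hp.counitR hS (x * g) = hp.counitR hS (y * g) := by
  rw [counitR_eq, counitR_eq, map_mul, map_mul, unop_mul, unop_mul]
  congr 2
  exact hp.counitL_mul_congr hS _ (by rw [← antiS_counitR, ← antiS_counitR, h])

/-- `ε_r(S'(b)) = b` for `b ∈ Ã` -/
lemma counitR_target (b : P) (hb : b ∈ baseTildeOf p) :
    hp.counitR hS (unop (hp.antiInv hS b)) = b := by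
  rw [hp.counitR_of_mem_base hS (hp.unop_anti_mem_base _ hb), antiS_antiInv]

/-- `∑ h₍₁₎ ε_r(h₍₂₎) = h` -/
lemma mulCounitR_of_rightMk {z : P ⊗[k] P} {h : P} (hz : rightMk _ _ z = hp.comulR hS h) :
    TensorProduct.lift ((LinearMap.mul k P).compl₂ (hp.counitR hS)) z = h := by
  refine hp.antiS_injective hS (unop_injective ?_)
  rw [← hp.counitLMul_of_leftMk hS (hp.leftMk_flipMap_antiS hS hz)]
  clear hz
  induction z with
  | zero => simp
  | add x y hx hy => rw [map_add, map_add, map_add, map_add, unop_add, hx, hy]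
  | tmul x y => simp [antiS_counitR]

/-- `∑ h₍₂₎ S⁻¹(ε_r(h₍₁₎)) = h` -/
lemma counitRMul_of_rightMk {z : P ⊗[k] P} {h : P} (hz : rightMk _ _ z = hp.comulR hS h) :
    TensorProduct.lift ((LinearMap.mul k P).flip.comp (hp.antiInvLin hS ∘ₗ hp.counitR hS)) z =
      h := by
  refine hp.antiS_injective hS (unop_injective ?_)
  rw [← hp.mulCounitL_of_leftMk hS (hp.leftMk_flipMap_antiS hS hz)]
  clear hz
  induction z with
  | zero => simp
  | add x y hx hy => rw [map_add, map_add, map_add, map_add, unop_add, hx, hy]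
  | tmul x y => simp [antiS_antiInv, counitR_eq]

/-! ### The counits on products of classes -/

lemma counitL_map (h : H) : hp.counitL hS (p h) = epsOf p h := by
  have e := hp.counitL_map_mul hS h 1
  rwa [mul_one, counitL_one, adj, convConst_one, mul_one] at e

lemma counitR_map (h : H) : hp.counitR hS (p h) = epsTildeOf p h := by
  rw [← hp.antiSMul_eq_counitR hS (hp.comulL_map hS h).symm]
  rw [epsTildeOf, sweedler_eq_conv, (ℛ k h).convMul_apply, diag, LinearMap.comp_apply]
  conv_lhs => rw [← (ℛ k h).eq]
  simp

/-- `ε_l([g] [h] x) = ∑ ε_{g₍₁₎} ε_l([g₍₂₎ h] x)`, the recursion for the left counit on a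
product. -/
lemma counitL_map_map_mul (g h : H) (x : P) : hp.counitL hS (p g * (p h * x)) =
    sweedler (epsOf p) (hp.counitL hS ∘ₗ LinearMap.mulRight k x ∘ₗ p ∘ₗ LinearMap.mulRight k h)
      g := by
  have e := congrArg (fun F => F.ofConv g)
    (hp.toIsPartialRep.convHom_mul_convPost (convConst h) (.id k H))
  have e₁ : p g * p h = sweedler (epsOf p) (p ∘ₗ LinearMap.mulRight k h) g := by
    have e₂ : convHom (.id k H) * convConst h = toConv (LinearMap.mulRight k h) := by
      ext g
      exact mul_convConst_apply _ _ _
    rw [convPost_convConst, mul_convConst_apply, e₂] at e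
    exact e
  rw [← mul_assoc, e₁, sweedler_eq_conv, sweedler_eq_conv, (ℛ k g).convMul_apply,
    (ℛ k g).convMul_apply, Finset.sum_mul, map_sum]
  refine Finset.sum_congr rfl fun i _ => ?_
  rw [mul_assoc]
  exact hp.counitL_base_mul hS (eps_mem p _) _

/-- `ε_r(x [h] [g]) = ∑ ε_r(x [h g₍₁₎]) ε̃_{g₍₂₎}`, the recursion for the right counit on a
product. -/
lemma counitR_mul_map_map (x : P) (h g : H) : hp.counitR hS (x * p h * p g) =
    sweedler (hp.counitR hS ∘ₗ LinearMap.mulLeft k x ∘ₗ p ∘ₗ LinearMap.mulLeft k h) (epsTildeOf p)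
      g := by
  have e := congrArg (fun F => F.ofConv g)
    (hp.toIsPartialRep.convPost_mul_convHom (convConst h) (.id k H))
  have e₁ : p h * p g = sweedler (p ∘ₗ LinearMap.mulLeft k h) (epsTildeOf p) g := by
    have e₂ : convConst h * convHom (.id k H) = toConv (LinearMap.mulLeft k h) := by
      ext g
      exact convConst_mul_apply _ _ _
    rw [convPost_convConst, convConst_mul_apply, e₂] at e
    exact e
  rw [mul_assoc, e₁, sweedler_eq_conv, sweedler_eq_conv, (ℛ k g).convMul_apply,
    (ℛ k g).convMul_apply, Finset.mul_sum, map_sum]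
  refine Finset.sum_congr rfl fun i _ => ?_
  rw [← mul_assoc]
  exact hp.counitR_mul_baseTilde hS (epsTilde_mem p _) _

lemma counitL_word (h : H) (w : List H) : hp.counitL hS (((h :: w).map p).prod) =
    w.foldr (fun h φ => sweedler (epsOf p) (φ ∘ₗ LinearMap.mulRight k h)) (epsOf p) h := by
  induction w generalizing h with
  | nil => simpa using hp.counitL_map hS h
  | cons g w ih =>
    rw [List.map_cons, List.map_cons, List.prod_cons, List.prod_cons, counitL_map_map_mul,
      List.foldr_cons]
    congr 2
    ext v
    simpa using ih (v * g)

lemma counitR_word (w : List H) (h : H) : hp.counitR hS (((w ++ [h]).map p).prod) =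
    w.foldl (fun φ h => sweedler (φ ∘ₗ LinearMap.mulLeft k h) (epsTildeOf p)) (epsTildeOf p)
      h := by
  induction w using List.reverseRecOn generalizing h with
  | nil => simpa using hp.counitR_map hS h
  | append_singleton w g ih =>
    have e := hp.counitR_mul_map_map hS (w.map p).prod g h
    rw [List.foldl_concat]
    simp only [List.map_append, List.prod_append, List.map_cons, List.map_nil, List.prod_singleton]
    rw [e]
    congr 2
    ext v
    simpa using ih (g * v)

end IsParPresentation

/-! ### Coassociativity -/

section Join

variable {k : Type*} [CommRing k] {P : Type*} [Ring P] [Algebra k P] {A B : Type*}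
  (ρ₁ l₁ : A → P →ₗ[k] P) (ρ₂ l₂ : B → P →ₗ[k] P)

lemma balJoinLeft_tmul (r : P ⊗[k] P) (v : P) :
    balJoinLeft ρ₁ l₁ ρ₂ l₂ ((balRel k ρ₁ l₁).mkQ r ⊗ₜ v) =
      (balRelThree k ρ₁ l₁ ρ₂ l₂).mkQ (r ⊗ₜ v) := rfl

lemma balJoinRight_tmul (v : P) (r : P ⊗[k] P) :
    balJoinRight ρ₁ l₁ ρ₂ l₂ (v ⊗ₜ (balRel k ρ₂ l₂).mkQ r) =
      (balRelThree k ρ₁ l₁ ρ₂ l₂).mkQ ((TensorProduct.assoc k P P P).symm (v ⊗ₜ r)) := rfl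

variable {ρ₁ l₁ ρ₂ l₂}

/-- `D ⊗ I` is well defined as a map `P ⊗_B P → P ⊗_A P ⊗_B P` if `D` sends `x ◁ b` to
`∑ x₍₁₎ ⊗ x₍₂₎ ◁ b`. -/
lemma balJoinLeft_map_eq_zero {D : P →ₗ[k] BalTensor k ρ₁ l₁}
    (hD : ∀ b x r, (balRel k ρ₁ l₁).mkQ r = D x →
      D (ρ₂ b x) = (balRel k ρ₁ l₁).mkQ (TensorProduct.map LinearMap.id (ρ₂ b) r))
    {m : P ⊗[k] P} (hm : m ∈ balRel k ρ₂ l₂) :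
    balJoinLeft ρ₁ l₁ ρ₂ l₂ (TensorProduct.map D LinearMap.id m) = 0 := by
  refine LinearMap.mem_ker.1 ((Submodule.span_le (p := LinearMap.ker
    (balJoinLeft ρ₁ l₁ ρ₂ l₂ ∘ₗ TensorProduct.map D LinearMap.id))).2 ?_ hm)
  rintro _ ⟨b, x, y, rfl⟩
  obtain ⟨r, hr⟩ := Submodule.mkQ_surjective _ (D x)
  rw [SetLike.mem_coe, LinearMap.mem_ker, map_sub, sub_eq_zero, LinearMap.comp_apply,
    LinearMap.comp_apply, TensorProduct.map_tmul, TensorProduct.map_tmul, hD b x r hr, ← hr]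
  simp only [LinearMap.id_apply]
  rw [balJoinLeft_tmul, balJoinLeft_tmul]
  clear hr
  induction r with
  | zero => simp
  | add r r' h h' => rw [map_add, TensorProduct.add_tmul, TensorProduct.add_tmul, map_add, map_add,
      h, h']
  | tmul p q => exact (Submodule.Quotient.eq _).2 (Submodule.subset_span (Or.inr ⟨b, p, q, y, rfl⟩))

/-- `I ⊗ D` is well defined as a map `P ⊗_A P → P ⊗_A P ⊗_B P` if `D` sends `a ▷ x` to
`∑ a ▷ x₍₁₎ ⊗ x₍₂₎`. -/
lemma balJoinRight_map_eq_zero {D : P →ₗ[k] BalTensor k ρ₂ l₂}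
    (hD : ∀ a x r, (balRel k ρ₂ l₂).mkQ r = D x →
      D (l₁ a x) = (balRel k ρ₂ l₂).mkQ (TensorProduct.map (l₁ a) LinearMap.id r))
    {m : P ⊗[k] P} (hm : m ∈ balRel k ρ₁ l₁) :
    balJoinRight ρ₁ l₁ ρ₂ l₂ (TensorProduct.map LinearMap.id D m) = 0 := by
  refine LinearMap.mem_ker.1 ((Submodule.span_le (p := LinearMap.ker
    (balJoinRight ρ₁ l₁ ρ₂ l₂ ∘ₗ TensorProduct.map LinearMap.id D))).2 ?_ hm)
  rintro _ ⟨a, x, y, rfl⟩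
  obtain ⟨r, hr⟩ := Submodule.mkQ_surjective _ (D y)
  rw [SetLike.mem_coe, LinearMap.mem_ker, map_sub, sub_eq_zero, LinearMap.comp_apply,
    LinearMap.comp_apply, TensorProduct.map_tmul, TensorProduct.map_tmul, hD a y r hr, ← hr]
  simp only [LinearMap.id_apply]
  rw [balJoinRight_tmul, balJoinRight_tmul]
  clear hr
  induction r with
  | zero => simp
  | add r r' h h' => rw [map_add, TensorProduct.tmul_add, TensorProduct.tmul_add, map_add, map_add,
      map_add, map_add, h, h']
  | tmul p q => exact (Submodule.Quotient.eq _).2 (Submodule.subset_span (Or.inl ⟨a, x, p, q, rfl⟩))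

end Join

namespace IsParPresentation

open Coalgebra

variable {k : Type*} [CommRing k] {H : Type*} [Ring H] [HopfAlgebra k H]
  {P : Type*} [Ring P] [Algebra k P] {p : H →ₗ[k] P} (hp : IsParPresentation p)
  (hS : Function.Bijective (antip k H))

variable (k H) in
/-- The coproduct of the tensor algebra that extends that of `H` multiplicatively. -/
def tensorComul : TensorAlgebra k H →ₐ[k] TensorAlgebra k H ⊗[k] TensorAlgebra k H :=
  TensorAlgebra.lift k (diag (TensorAlgebra.ι k))

lemma diagLift_eq (w : TensorAlgebra k H) : diagLift p w =
    TensorProduct.map (TensorAlgebra.lift k p).toLinearMap (TensorAlgebra.lift k p).toLinearMap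
      (tensorComul k H w) := by
  have e : diagLift p = (Algebra.TensorProduct.map (TensorAlgebra.lift k p)
      (TensorAlgebra.lift k p)).comp (tensorComul k H) := by
    refine TensorAlgebra.hom_ext (LinearMap.ext fun h => ?_)
    simp only [LinearMap.comp_apply, AlgHom.toLinearMap_apply, AlgHom.comp_apply, tensorComul,
      TensorAlgebra.lift_ι_apply, diag]
    induction comul (R := k) h with
    | zero => simp
    | add x y hx hy => rw [map_add, map_add, map_add, hx, hy]
    | tmul x y => simp
  rw [e]
  rfl

lemma diagLift_coassoc (w : TensorAlgebra k H) :
    TensorProduct.map (diagLift p).toLinearMap (TensorAlgebra.lift k p).toLinearMap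
        (tensorComul k H w) =
      (TensorProduct.assoc k P P P).symm
        (TensorProduct.map (TensorAlgebra.lift k p).toLinearMap (diagLift p).toLinearMap
          (tensorComul k H w)) := by
  have e : (Algebra.TensorProduct.map (diagLift p) (TensorAlgebra.lift k p)).comp
      (tensorComul k H) = ((Algebra.TensorProduct.assoc k k k P P P).symm.toAlgHom.comp
        (Algebra.TensorProduct.map (TensorAlgebra.lift k p) (diagLift p))).comp
          (tensorComul k H) := by
    refine TensorAlgebra.hom_ext (LinearMap.ext fun h => ?_)
    simp only [LinearMap.comp_apply, AlgHom.toLinearMap_apply, AlgHom.comp_apply, tensorComul,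
      TensorAlgebra.lift_ι_apply, diag]
    have e₁ (z : H ⊗[k] H) : Algebra.TensorProduct.map (diagLift p) (TensorAlgebra.lift k p)
        (TensorProduct.map (TensorAlgebra.ι k) (TensorAlgebra.ι k) z) =
        TensorProduct.map (TensorProduct.map p p) p (comul.rTensor H z) := by
      induction z with
      | zero => simp
      | add x y hx hy => rw [map_add, map_add, map_add, map_add, hx, hy]
      | tmul x y => simp [diag]
    have e₂ (z : H ⊗[k] H) : Algebra.TensorProduct.map (TensorAlgebra.lift k p) (diagLift p)
        (TensorProduct.map (TensorAlgebra.ι k) (TensorAlgebra.ι k) z) =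
        TensorProduct.map p (TensorProduct.map p p) (comul.lTensor H z) := by
      induction z with
      | zero => simp
      | add x y hx hy => rw [map_add, map_add, map_add, map_add, hx, hy]
      | tmul x y => simp [diag]
    have e₃ (z : (H ⊗[k] H) ⊗[k] H) : TensorProduct.map (TensorProduct.map p p) p z =
        (Algebra.TensorProduct.assoc k k k P P P).symm (TensorProduct.map p (TensorProduct.map p p)
          (TensorProduct.assoc k H H H z)) := by
      refine LinearMap.congr_fun (f := TensorProduct.map (TensorProduct.map p p) p)
        (g := (Algebra.TensorProduct.assoc k k k P P P).symm.toLinearMap ∘ₗ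
          TensorProduct.map p (TensorProduct.map p p) ∘ₗ
          (TensorProduct.assoc k H H H).toLinearMap) ?_ z
      ext
      simp
    rw [e₁, e₂, ← coassoc_apply, e₃]
    rfl
  exact DFunLike.congr_fun e w

variable {A B : Type*} {ρ₁ l₁ : A → P →ₗ[k] P} {ρ₂ l₂ : B → P →ₗ[k] P}

include hp in
/-- Two comultiplications that both come from the diagonal map on the tensor algebra are mutually
coassociative, if each is compatible with the relations of the other. -/
lemma join_coassoc {D₁ : P →ₗ[k] BalTensor k ρ₁ l₁} {D₂ : P →ₗ[k] BalTensor k ρ₂ l₂}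
    (h₁ : ∀ w, D₁ (TensorAlgebra.lift k p w) = (balRel k ρ₁ l₁).mkQ (diagLift p w))
    (h₂ : ∀ w, D₂ (TensorAlgebra.lift k p w) = (balRel k ρ₂ l₂).mkQ (diagLift p w))
    (hD₁ : ∀ b x r, (balRel k ρ₁ l₁).mkQ r = D₁ x →
      D₁ (ρ₂ b x) = (balRel k ρ₁ l₁).mkQ (TensorProduct.map LinearMap.id (ρ₂ b) r))
    (hD₂ : ∀ a x r, (balRel k ρ₂ l₂).mkQ r = D₂ x →
      D₂ (l₁ a x) = (balRel k ρ₂ l₂).mkQ (TensorProduct.map (l₁ a) LinearMap.id r))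
    {h : P} {z z' : P ⊗[k] P} (hz : (balRel k ρ₂ l₂).mkQ z = D₂ h)
    (hz' : (balRel k ρ₁ l₁).mkQ z' = D₁ h) :
    balJoinLeft ρ₁ l₁ ρ₂ l₂ (TensorProduct.map D₁ LinearMap.id z) =
      balJoinRight ρ₁ l₁ ρ₂ l₂ (TensorProduct.map LinearMap.id D₂ z') := by
  obtain ⟨w, rfl⟩ := hp.lift_surjective h
  rw [h₂] at hz
  rw [h₁] at hz'
  have e := balJoinLeft_map_eq_zero hD₁ ((Submodule.Quotient.eq _).1 hz)
  have e' := balJoinRight_map_eq_zero hD₂ ((Submodule.Quotient.eq _).1 hz')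
  rw [map_sub, map_sub, sub_eq_zero] at e e'
  rw [e, e', diagLift_eq]
  have a (v : TensorAlgebra k H ⊗[k] TensorAlgebra k H) :
      balJoinLeft ρ₁ l₁ ρ₂ l₂ (TensorProduct.map D₁ LinearMap.id (TensorProduct.map
        (TensorAlgebra.lift k p).toLinearMap (TensorAlgebra.lift k p).toLinearMap v)) =
      (balRelThree k ρ₁ l₁ ρ₂ l₂).mkQ (TensorProduct.map (diagLift p).toLinearMap
        (TensorAlgebra.lift k p).toLinearMap v) := by
    induction v with
    | zero => simp
    | add x y hx hy => simp only [map_add, hx, hy]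
    | tmul x y =>
      simp only [TensorProduct.map_tmul, AlgHom.toLinearMap_apply, LinearMap.id_apply, h₁]
      exact balJoinLeft_tmul _ _ _ _ _ _
  have a' (v : TensorAlgebra k H ⊗[k] TensorAlgebra k H) :
      balJoinRight ρ₁ l₁ ρ₂ l₂ (TensorProduct.map LinearMap.id D₂ (TensorProduct.map
        (TensorAlgebra.lift k p).toLinearMap (TensorAlgebra.lift k p).toLinearMap v)) =
      (balRelThree k ρ₁ l₁ ρ₂ l₂).mkQ ((TensorProduct.assoc k P P P).symm (TensorProduct.map
        (TensorAlgebra.lift k p).toLinearMap (diagLift p).toLinearMap v)) := by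
    induction v with
    | zero => simp
    | add x y hx hy => simp only [map_add, hx, hy]
    | tmul x y =>
      simp only [TensorProduct.map_tmul, AlgHom.toLinearMap_apply, LinearMap.id_apply, h₂]
      exact balJoinRight_tmul _ _ _ _ _ _
  rw [a, a', diagLift_coassoc]

lemma map_id_mulLeft (a : P) (r : P ⊗[k] P) :
    TensorProduct.map LinearMap.id (LinearMap.mulLeft k a) r = inr k P a * r := by
  refine LinearMap.congr_fun (g := LinearMap.mulLeft k (inr k P a)) ?_ r
  ext
  simp

lemma map_mulLeft_id (a : P) (r : P ⊗[k] P) :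
    TensorProduct.map (LinearMap.mulLeft k a) LinearMap.id r = inl k P a * r := by
  refine LinearMap.congr_fun (g := LinearMap.mulLeft k (inl k P a)) ?_ r
  ext
  simp

lemma map_id_mulRight (a : P) (r : P ⊗[k] P) :
    TensorProduct.map LinearMap.id (LinearMap.mulRight k a) r = r * inr k P a := by
  refine LinearMap.congr_fun (g := LinearMap.mulRight k (inr k P a)) ?_ r
  ext
  simp

lemma map_mulRight_id (a : P) (r : P ⊗[k] P) :
    TensorProduct.map (LinearMap.mulRight k a) LinearMap.id r = r * inl k P a := by
  refine LinearMap.congr_fun (g := LinearMap.mulRight k (inl k P a)) ?_ r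
  ext
  simp

/-- `(Δ_l ⊗ I) Δ_l = (I ⊗ Δ_l) Δ_l` -/
lemma coassocL {h : P} {z z' : P ⊗[k] P} (hz : leftMk _ _ z = hp.comulL hS h)
    (hz' : leftMk _ _ z' = hp.comulL hS h) :
    balJoinLeft (mulLeftTarget (hp.tA hS)) (mulLeftSource (baseOf p).val)
        (mulLeftTarget (hp.tA hS)) (mulLeftSource (baseOf p).val)
        (TensorProduct.map (hp.comulL hS) LinearMap.id z) =
      balJoinRight (mulLeftTarget (hp.tA hS)) (mulLeftSource (baseOf p).val)
        (mulLeftTarget (hp.tA hS)) (mulLeftSource (baseOf p).val)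
        (TensorProduct.map LinearMap.id (hp.comulL hS) z') := by
  refine hp.join_coassoc (hp.comulL_lift hS) (hp.comulL_lift hS) (fun b x r hr => ?_)
    (fun a x r hr => ?_) hz hz'
  · rw [mulLeftTarget, map_id_mulLeft]
    exact hp.comulL_mul hS (hp.comulL_of_mem_baseTilde hS
      (hp.unop_anti_mem_baseTilde (isHopfAnti_antipInv hS) b.2)).symm hr
  · rw [mulLeftSource, map_mulLeft_id]
    exact hp.comulL_mul hS (hp.comulL_of_mem_base hS a.2).symm hr

/-- `(Δ_r ⊗ I) Δ_r = (I ⊗ Δ_r) Δ_r` -/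
lemma coassocR {h : P} {z z' : P ⊗[k] P} (hz : rightMk _ _ z = hp.comulR hS h)
    (hz' : rightMk _ _ z' = hp.comulR hS h) :
    balJoinLeft (mulRightSource (baseTildeOf p).val) (mulRightTarget (hp.tB hS))
        (mulRightSource (baseTildeOf p).val) (mulRightTarget (hp.tB hS))
        (TensorProduct.map (hp.comulR hS) LinearMap.id z) =
      balJoinRight (mulRightSource (baseTildeOf p).val) (mulRightTarget (hp.tB hS))
        (mulRightSource (baseTildeOf p).val) (mulRightTarget (hp.tB hS))
        (TensorProduct.map LinearMap.id (hp.comulR hS) z') := by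
  refine hp.join_coassoc (hp.comulR_lift hS) (hp.comulR_lift hS) (fun b x r hr => ?_)
    (fun a x r hr => ?_) hz hz'
  · rw [mulRightSource, map_id_mulRight]
    exact hp.comulR_mul hS hr (hp.comulR_of_mem_baseTilde hS b.2).symm
  · rw [mulRightTarget, map_mulRight_id]
    exact hp.comulR_mul hS hr (hp.comulR_of_mem_base hS
      (hp.unop_anti_mem_base (isHopfAnti_antipInv hS) a.2)).symm

/-- `(Δ_l ⊗ I) Δ_r = (I ⊗ Δ_r) Δ_l` -/
lemma coassocLR {h : P} {z z' : P ⊗[k] P} (hz : rightMk _ _ z = hp.comulR hS h)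
    (hz' : leftMk _ _ z' = hp.comulL hS h) :
    balJoinLeft (mulLeftTarget (hp.tA hS)) (mulLeftSource (baseOf p).val)
        (mulRightSource (baseTildeOf p).val) (mulRightTarget (hp.tB hS))
        (TensorProduct.map (hp.comulL hS) LinearMap.id z) =
      balJoinRight (mulLeftTarget (hp.tA hS)) (mulLeftSource (baseOf p).val)
        (mulRightSource (baseTildeOf p).val) (mulRightTarget (hp.tB hS))
        (TensorProduct.map LinearMap.id (hp.comulR hS) z') := by
  refine hp.join_coassoc (hp.comulL_lift hS) (hp.comulR_lift hS) (fun b x r hr => ?_)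
    (fun a x r hr => ?_) hz hz'
  · rw [mulRightSource, map_id_mulRight]
    exact hp.comulL_mul hS hr (hp.comulL_of_mem_baseTilde hS b.2).symm
  · rw [mulLeftSource, map_mulLeft_id]
    exact hp.comulR_mul hS (hp.comulR_of_mem_base hS a.2).symm hr

/-- `(I ⊗ Δ_l) Δ_r = (Δ_r ⊗ I) Δ_l` -/
lemma coassocRL {h : P} {z z' : P ⊗[k] P} (hz : rightMk _ _ z = hp.comulR hS h)
    (hz' : leftMk _ _ z' = hp.comulL hS h) :
    balJoinRight (mulRightSource (baseTildeOf p).val) (mulRightTarget (hp.tB hS))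
        (mulLeftTarget (hp.tA hS)) (mulLeftSource (baseOf p).val)
        (TensorProduct.map LinearMap.id (hp.comulL hS) z) =
      balJoinLeft (mulRightSource (baseTildeOf p).val) (mulRightTarget (hp.tB hS))
        (mulLeftTarget (hp.tA hS)) (mulLeftSource (baseOf p).val)
        (TensorProduct.map (hp.comulR hS) LinearMap.id z') := by
  refine (hp.join_coassoc (hp.comulR_lift hS) (hp.comulL_lift hS) (fun b x r hr => ?_)
    (fun a x r hr => ?_) hz' hz).symm
  · rw [mulLeftTarget, map_id_mulLeft]
    exact hp.comulR_mul hS (hp.comulR_of_mem_baseTilde hS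
      (hp.unop_anti_mem_baseTilde (isHopfAnti_antipInv hS) b.2)).symm hr
  · rw [mulRightTarget, map_mulRight_id]
    exact hp.comulL_mul hS hr (hp.comulL_of_mem_base hS
      (hp.unop_anti_mem_base (isHopfAnti_antipInv hS) a.2)).symm

end IsParPresentation

/-! ### The Hopf algebroid -/

namespace IsParPresentation

variable {k : Type*} [CommRing k] {H : Type*} [Ring H] [HopfAlgebra k H]
  {P : Type*} [Ring P] [Algebra k P] {p : H →ₗ[k] P} (hp : IsParPresentation p)
  (hS : Function.Bijective (antip k H))

/-- The left bialgebroid over the algebra generated by the elements `ε_h`. -/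
def leftBialgebroid : LeftBialgebroid k P (baseOf p) where
  s := (baseOf p).val
  t := hp.tA hS
  commute_st a b := base_comm_baseTilde hp.toIsPartialRep a.2
    (hp.unop_anti_mem_baseTilde (isHopfAnti_antipInv hS) b.2)
  comul := hp.comulL hS
  counit := (hp.counitL hS).codRestrict (Subalgebra.toSubmodule (baseOf p)) (hp.counitL_mem hS)
  comul_bilinear a b h z hz := by
    have e := hp.comulL_mul hS (hp.comulL_of_mem_base hS a.2).symm
      (hp.comulL_of_mem_baseTilde hS
        (hp.unop_anti_mem_baseTilde (isHopfAnti_antipInv hS) b.2)).symm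
    refine (hp.comulL_mul hS e.symm hz).trans ?_
    simp
  counit_bilinear a b h := by
    refine Subtype.ext ?_
    have e := hp.counitL_baseTilde_mul hS
      (hp.unop_anti_mem_baseTilde (isHopfAnti_antipInv hS) b.2) h
    rw [antiS_antiInv] at e
    refine Eq.trans (congrArg (hp.counitL hS) (mul_assoc _ _ _)) ?_
    refine (hp.counitL_base_mul hS a.2 _).trans ?_
    refine (congrArg (_ * ·) e).trans ?_
    exact (mul_assoc _ _ _).symm
  coassoc h z z' hz hz' := hp.coassocL hS hz hz'
  counit_comul h z hz := hp.counitLMul_of_leftMk hS hz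
  comul_counit h z hz := hp.mulCounitL_of_leftMk hS hz
  takeuchi h z hz a := hp.comulL_takeuchi hS hz a
  comul_one := hp.comulL_one hS
  comul_mul g h y z hy hz := hp.comulL_mul hS hy hz
  counit_one := Subtype.ext (hp.counitL_one hS)
  counit_mul_source g h := Subtype.ext (hp.counitL_mul_congr hS g
    (hp.counitL_of_mem_base hS (hp.counitL_mem hS h)).symm)
  counit_mul_target g h := Subtype.ext (hp.counitL_mul_congr hS g
    (hp.counitL_target hS _ (hp.counitL_mem hS h)).symm)

/-- The right bialgebroid over the algebra generated by the elements `ε̃_h`. -/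
def rightBialgebroid : RightBialgebroid k P (baseTildeOf p) where
  s := (baseTildeOf p).val
  t := hp.tB hS
  commute_st a b := (base_comm_baseTilde hp.toIsPartialRep
    (hp.unop_anti_mem_base (isHopfAnti_antipInv hS) b.2) a.2).symm
  comul := hp.comulR hS
  counit := (hp.counitR hS).codRestrict (Subalgebra.toSubmodule (baseTildeOf p))
    (hp.counitR_mem hS)
  comul_bilinear a b h z hz := by
    have e := hp.comulR_mul hS (hp.comulR_of_mem_baseTilde hS b.2).symm
      (hp.comulR_of_mem_base hS
        (hp.unop_anti_mem_base (isHopfAnti_antipInv hS) a.2)).symm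
    refine (congrArg (hp.comulR hS) (mul_assoc _ _ _)).trans ?_
    refine (hp.comulR_mul hS hz e.symm).trans ?_
    simp
  counit_bilinear a b h := by
    refine Subtype.ext ?_
    have e := hp.counitR_mul_base hS
      (hp.unop_anti_mem_base (isHopfAnti_antipInv hS) a.2) (h * b)
    rw [antiS_antiInv] at e
    refine e.trans ?_
    refine (congrArg (_ * ·) (hp.counitR_mul_baseTilde hS b.2 h)).trans ?_
    exact (mul_assoc _ _ _).symm
  coassoc h z z' hz hz' := hp.coassocR hS hz hz'
  counit_comul h z hz := hp.counitRMul_of_rightMk hS hz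
  comul_counit h z hz := hp.mulCounitR_of_rightMk hS hz
  takeuchi h z hz a := hp.comulR_takeuchi hS hz a
  comul_one := hp.comulR_one hS
  comul_mul g h y z hy hz := hp.comulR_mul hS hy hz
  counit_one := Subtype.ext (hp.counitR_one hS)
  counit_mul_source g h := Subtype.ext (hp.counitR_mul_congr hS h
    (hp.counitR_of_mem_baseTilde hS (hp.counitR_mem hS g)).symm)
  counit_mul_target g h := Subtype.ext (hp.counitR_mul_congr hS h
    (hp.counitR_target hS _ (hp.counitR_mem hS g)).symm)

/-- The antipode restricts to an anti-isomorphism of the base algebras. -/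
def baseEquiv : baseOf p ≃ₐ[k] (baseTildeOf p)ᵐᵒᵖ where
  toFun a := op ⟨unop (hp.antiS a), hp.unop_anti_mem_baseTilde (isHopfAnti_antip k H) a.2⟩
  invFun b := ⟨unop (hp.antiInv hS ((unop b : baseTildeOf p) : P)),
    hp.unop_anti_mem_base (isHopfAnti_antipInv hS) (unop b).2⟩
  left_inv a := Subtype.ext (hp.antiInv_antiS hS a)
  right_inv b := unop_injective (Subtype.ext (hp.antiS_antiInv hS ((unop b : baseTildeOf p) : P)))
  map_mul' a b := unop_injective (Subtype.ext (congrArg unop (map_mul hp.antiS (a : P) b)))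
  map_add' a b := unop_injective (Subtype.ext (congrArg unop (map_add hp.antiS (a : P) b)))
  commutes' r := unop_injective (Subtype.ext (congrArg unop (hp.antiS.commutes r)))

lemma comulL_prod (w : List H) :
    hp.comulL hS (w.map p).prod = leftMk _ _ (w.map (diag p)).prod := by
  have e := hp.comulL_lift hS (w.map (TensorAlgebra.ι k)).prod
  simpa [map_list_prod, Function.comp_def] using e

lemma comulR_prod (w : List H) :
    hp.comulR hS (w.map p).prod = rightMk _ _ (w.map (diag p)).prod := by
  have e := hp.comulR_lift hS (w.map (TensorAlgebra.ι k)).prod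
  simpa [map_list_prod, Function.comp_def] using e

/-- The Hopf algebroid structure on the partial Hopf algebra. -/
def hopfAlgebroid : HopfAlgebroid k P (baseOf p) (baseTildeOf p) where
  left := hp.leftBialgebroid hS
  right := hp.rightBialgebroid hS
  anti_isomorphic := ⟨hp.baseEquiv hS⟩
  antipode := hp.antiS
  left_counit_right_target b := hp.counitL_of_mem_base hS
    (hp.unop_anti_mem_base (isHopfAnti_antipInv hS) b.2)
  left_counit_right_source b := by
    have e := hp.counitL_baseTilde_mul hS b.2 1
    rw [mul_one, counitL_one, one_mul] at e
    exact (congrArg (fun x => unop (hp.antiInv hS x)) e).trans (hp.antiInv_antiS hS b)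
  right_counit_left_target a := hp.counitR_of_mem_baseTilde hS
    (hp.unop_anti_mem_baseTilde (isHopfAnti_antipInv hS) a.2)
  right_counit_left_source a :=
    (congrArg (fun x => unop (hp.antiInv hS x)) (hp.counitR_of_mem_base hS a.2)).trans
      (hp.antiInv_antiS hS a)
  left_right_coassoc h z z' hz hz' := hp.coassocLR hS hz hz'
  right_left_coassoc h z z' hz hz' := hp.coassocRL hS hz hz'
  antipode_target a b h := by
    have e₁ := hp.antiS_antiInv hS a
    have e₂ := hp.antiS_antiInv hS b
    change unop (hp.antiS (unop (hp.antiInv hS a) * h * unop (hp.antiInv hS b))) = _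
    rw [map_mul, map_mul, unop_mul, unop_mul, e₁, e₂, ← mul_assoc]
    rfl
  antipode_mul h z hz := hp.antiSMul_eq_counitR hS hz
  mul_antipode h z hz := hp.mulAntiS_eq_counitL hS hz

end IsParPresentation

end

theorem mainTheorem3 {k : Type*} [CommRing k] {H : Type*} [Ring H] [HopfAlgebra k H]
    (hS : Function.Bijective (antip k H)) :
    ∃ (S' : Hpar k H →ₐ[k] (Hpar k H)ᵐᵒᵖ)
      (X : HopfAlgebroid k (Hpar k H) (parBase k H) (parBaseTilde k H)),
      -- the anti-homomorphism induced by the inverse of the antipode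
      (∀ w : List H, S' (parWord k w) = op (parWord k (w.map (antipInv hS)).reverse)) ∧
      -- sources and targets
      (∀ a : parBase k H, X.left.s a = (a : Hpar k H)) ∧
      (∀ a : parBase k H, X.left.t (op a) = unop (S' (a : Hpar k H))) ∧
      (∀ b : parBaseTilde k H, X.right.s b = (b : Hpar k H)) ∧
      (∀ b : parBaseTilde k H, X.right.t (op b) = unop (S' (b : Hpar k H))) ∧
      -- comultiplications
      (∀ w : List H,
        X.left.comul (parWord k w) = leftMk X.left.s X.left.t (parWordComul k w)) ∧
      (∀ w : List H,
        X.right.comul (parWord k w) = rightMk X.right.s X.right.t (parWordComul k w)) ∧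
      -- counits
      (∀ (h : H) (w : List H),
        (X.left.counit (parWord k (h :: w)) : Hpar k H) = parCounitLeft k w h) ∧
      (∀ (w : List H) (h : H),
        (X.right.counit (parWord k (w ++ [h])) : Hpar k H) = parCounitRight k w h) ∧
      -- antipode
      (∀ w : List H, X.antipode (parWord k w) = op (parWord k (w.map (antip k H)).reverse)) := by
  have hp := isParPresentation_parCls k H
  refine ⟨hp.antiInv hS, hp.hopfAlgebroid hS, ?_, fun _ => rfl, fun _ => rfl, fun _ => rfl,
    fun _ => rfl, ?_, ?_, ?_, ?_, ?_⟩
  · intro w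
    exact hp.anti_prod (isHopfAnti_antipInv hS) w
  · intro w
    exact hp.comulL_prod hS w
  · intro w
    exact hp.comulR_prod hS w
  · intro h w
    exact hp.counitL_word hS h w
  · intro w h
    exact hp.counitR_word hS w h
  · intro w
    exact hp.anti_prod (isHopfAnti_antip k H) w
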